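/- **Setting.** Let $Ag$ be a non-empty finite set of agents, $Prop$ a set of atomic propositions and $Prop_a\subseteq Prop$ the propositions observable to agent $a$; $Prop_A=\bigcup_{a\in A}Prop_a$ for $A\subseteq Ag$. A *game arena* $\Gamma$ has a finite set $Q$ of states, a set $Q_0\subseteq Q$ of initial states, non-empty finite action sets $C_a$ ($a\in Ag$), a total transition relation $\delta:Q\times C\to 2^Q\setminus\{\emptyset\}$ with $C=\prod_{a\in Ag}C_a$, and a labelling $\lambda:Q\to 2^{Prop}$. Write $C_A=\prod_{a\in A}C_a$ and $\lambda_A(q)=\lambda(q)\cap Prop_A$; $q\xrightarrow{c}r$ means $r\in\delta(q,c)$. $\mathsf{Runs}^\omega(\Gamma)$ is the set of infinite runs $\rho=q_0\xrightarrow{c_1}q_1\xrightarrow{c_2}\cdots$ with $q_0\in Q_0$; $\rho[i]=q_i$. For such runs $\rho[0..i]\sim_A\rho'[0..i]$ means that the two prefixes have the same $A$-parts of their first $i$ action tuples and the same sequence of $\lambda_A$-labels. A *strategy* of $A$ is a map $\sigma:(2^{Prop_A})^*\to C_A$; it is compatible with $\rho$ (resp. with $\rho[0..i]$) if $\sigma(\lambda_A(q_0)\cdots\lambda_A(q_j))=c_{j+1}|_A$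 for all $j\ge 0$ (resp. all $0\le j<i$). **Logic.** Formulas of $\mathrm{ATL}^{D}_{iR}$ are $\phi::=p\mid\phi\wedge\phi\mid\neg\phi\mid\langle\!\langle A\rangle\!\rangle\bigcirc\phi\mid\langle\!\langle A\rangle\!\rangle\phi\,\mathcal U\,\phi\mid\langle\!\langle A\rangle\!\rangle\phi\,\mathcal W\,\phi\mid K_A\phi$ with $p\in Prop$, $A\subseteq Ag$. Satisfaction $(\Gamma,\rho,i)\models\phi$ is defined as usual for $p$ (that is, $p\in\lambda(\rho[i])$), $\wedge$, $\neg$; $(\Gamma,\rho,i)\models K_A\phi$ iff $(\Gamma,\rho',i)\models\phi$ for all $\rho'\in\mathsf{Runs}^\omega(\Gamma)$ with $\rho'[0..i]\sim_A\rho[0..i]$; $(\Gamma,\rho,i)\models\langle\!\langle A\rangle\!\rangle\psi$ iff there is a strategy $\sigma$ of $A$, compatible with $\rho[0..i]$, such that every $\rho'\in\mathsf{Runs}^\omega(\Gamma)$ that is compatible with $\sigma$ and satisfies $\rho'[0..i]\sim_A\rho[0..i]$ fulfils $\psi$ from position $i$, where: $\bigcirc\phi$ means $(\Gamma,\rho',i+1)\models\phi$;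 $\phi_1\,\mathcal U\,\phi_2$ means that for some $j\ge i$, $(\Gamma,\rho',j)\models\phi_2$ and $(\Gamma,\rho',k)\models\phi_1$ for $i\le k<j$; $\phi_1\,\mathcal W\,\phi_2$ means that $\phi_1\,\mathcal U\,\phi_2$ holds or $(\Gamma,\rho',k)\models\phi_1$ for all $k\ge i$. **State splitting.** Let $out(S,c_A,Z)=\{s'\mid\exists s\in S,\exists c\in C:\ c|_A=c_A,\ s\xrightarrow{c}s',\ \lambda_A(s')=Z\}$. The arena $\widehat\Gamma_A$ has the same agents, actions and observable propositions; its states are the pairs $(q,S)$ with $q\in S\subseteq Q$ and $\lambda_A(s)=\lambda_A(q)$ for all $s\in S$; its initial states are the $(q_0,S_0)$ with $q_0\in Q_0$, $S_0=\{s\in Q_0\mid\lambda_A(s)=\lambda_A(q_0)\}$; $\widehat\lambda(q,S)=\lambda(q)$; and $(q,S)\xrightarrow{c}(q',S')$ iff $q\xrightarrow{c}q'$ and $S'=out(S,c|_A,\lambda_A(q'))$. **Tree automata.** A tree automaton has states $X$, an alphabet $B$, initial states $X_0$, transitions $\Delta\subseteq X\times B\times(2^X\setminus\{\emptyset\})$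 and $\mathcal F\subseteq 2^X$. An accepting run is a labelling by $X\times B$ of a prefix-closed set of nodes in $\mathbb N^*$ containing the root, in which every node has a child and the children of a node are numbered consecutively from $0$, such that the root's state is in $X_0$, the states of distinct children of a node differ, (state, letter, set of children's states) is in $\Delta$ at every node, and the set of states occurring on each infinite path from the root is in $\mathcal F$. For $A$, propositions $p_1,p_2$ and a state $(q,S)$ of $\widehat\Gamma_A$, let $\breve{\mathcal A}_{(q,S)}$ be the following automaton over $C_A$, with $Q[p_2]=\{r\in Q\mid p_2\in\lambda(r)\}$. States: $\bot$ and all pairs $(R_1,R_2)$ with $R_1\subseteq R_2\subseteq Q$, $\lambda_A$ constant on $R_2$, and $p_1\in\lambda(r)$, $p_2\notin\lambda(r)$ for $r\in R_1$. Initial state: $\bot$ if some $s\in S$ has $\lambda(s)\cap\{p_1,p_2\}=\emptyset$, else $(S\setminus Q[p_2],S)$. The successor set of $\bot$ is $\{\bot\}$; that of $(R_1,R_2)$ under $c_A$ is $\{\bot\}$ if there are $r_1\in R_1$ and $(r_1,R_2)\xrightarrow{c}(r,R)$ in $\widehat\Gamma_A$ with $c|_A=c_A$ and $\lambda(r)\cap\{p_1,p_2\}=\emptyset$,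 and otherwise it is $\{(out(R_1,c_A,Z)\setminus Q[p_2],\,out(R_2,c_A,Z))\mid Z\subseteq Prop_A,\ out(R_2,c_A,Z)\ne\emptyset\}$ (there is no transition if this set is empty). $\mathcal F$ consists of the sets containing some $(\emptyset,R)$. The automaton $\widetilde{\mathcal A}_{(q,S)}$ is the same, except that $\mathcal F$ consists of the sets not containing $\bot$. **Algorithm.** Let $\phi_1,\dots,\phi_n=\phi$ enumerate the subformulas of $\phi$ without repetition, so that for $i\neq j$, $\phi_i$ is a subformula of $\phi_j$ only if $i<j$. Let $p_{\phi_1},\dots,p_{\phi_n}$ be fresh propositions, observable to no agent, and put $\Gamma_0=\Gamma$. The arena $\Gamma_k$ arises from $\Gamma_{k-1}$ by adding $p_{\phi_k}$ to the labels of certain states: if $\phi_k$ is $p$, $\neg\psi$ or $\psi\wedge\chi$, to the labels of the states $q$ of $\Gamma_{k-1}$ with $p\in\lambda_{k-1}(q)$, $p_\psi\notin\lambda_{k-1}(q)$, or $p_\psi,p_\chi\in\lambda_{k-1}(q)$, respectively; in the other cases one passes from $\Gamma_{k-1}$ to its splitting for the coalition $A$ of $\phi_k$ and adds $p_{\phi_k}$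 to the label of $(q,S)$ exactly when - $\phi_k=K_A\psi$ and $p_\psi\in\lambda_{k-1}(s)$ for all $s\in S$; - $\phi_k=\langle\!\langle A\rangle\!\rangle\bigcirc\psi$ and for some $c_A\in C_A$, $p_\psi\in\widehat\lambda_{k-1}(r',S')$ whenever $r\in S$, $(r,S)\xrightarrow{c}(r',S')$ and $c|_A=c_A$; - $\phi_k=\langle\!\langle A\rangle\!\rangle\psi\,\mathcal U\,\chi$, and $\breve{\mathcal A}_{(q,S)}$ for $p_1=p_\psi$, $p_2=p_\chi$ has an accepting run; - $\phi_k=\langle\!\langle A\rangle\!\rangle\psi\,\mathcal W\,\chi$, and $\widetilde{\mathcal A}_{(q,S)}$ for $p_1=p_\psi$, $p_2=p_\chi$ has an accepting run. **Theorem.** (1) For every such $\Gamma$, $\phi$ and enumeration, $p_\phi\in\lambda_n(q)$ for all initial states $q$ of $\Gamma_n$ if and only if $(\Gamma,\rho,0)\models\phi$ for all $\rho\in\mathsf{Runs}^\omega(\Gamma)$. (2) The model-checking problem of $\mathrm{ATL}^{D}_{iR}$ is decidable: there is an algorithm that, given a finite arena $\Gamma$ (with finitely many propositions, presented by explicit lists)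 and a formula $\phi$ over its agents and propositions, decides whether $(\Gamma,\rho,0)\models\phi$ for all $\rho\in\mathsf{Runs}^\omega(\Gamma)$. -/

import Mathlib

universe u v w x

namespace ATLD

/-! ### Formulas -/

/-- Formulas over agents `Ag` and atomic propositions `P`; coalitions are finite sets of agents.
`nxt A φ` is `⟨⟨A⟩⟩ ○ φ`, `untl A φ ψ` is `⟨⟨A⟩⟩ φ U ψ`, `wuntl A φ ψ` is `⟨⟨A⟩⟩ φ W ψ`
and `know A φ` is `K_A φ`. -/
inductive Formula (Ag : Type u) (P : Type w) : Type (max u w)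
  | atom (p : P) : Formula Ag P
  | conj (φ ψ : Formula Ag P) : Formula Ag P
  | neg (φ : Formula Ag P) : Formula Ag P
  | nxt (A : Finset Ag) (φ : Formula Ag P) : Formula Ag P
  | untl (A : Finset Ag) (φ ψ : Formula Ag P) : Formula Ag P
  | wuntl (A : Finset Ag) (φ ψ : Formula Ag P) : Formula Ag P
  | know (A : Finset Ag) (φ : Formula Ag P) : Formula Ag P

/-- The set of subformulas of a formula, the formula itself included. -/
def Formula.subformulas {Ag : Type u} {P : Type w} : Formula Ag P → Set (Formula Ag P)
  | .atom p => {.atom p}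
  | .conj φ ψ => {.conj φ ψ} ∪ (φ.subformulas ∪ ψ.subformulas)
  | .neg φ => {.neg φ} ∪ φ.subformulas
  | .nxt A φ => {.nxt A φ} ∪ φ.subformulas
  | .untl A φ ψ => {.untl A φ ψ} ∪ (φ.subformulas ∪ ψ.subformulas)
  | .wuntl A φ ψ => {.wuntl A φ ψ} ∪ (φ.subformulas ∪ ψ.subformulas)
  | .know A φ => {.know A φ} ∪ φ.subformulas

/-- `L = [φ₁, …, φₙ]` enumerates the subformulas of `φ`, each of them once, with `φₙ = φ`, and
such that, for distinct `i`, `j`, `φᵢ` is a subformula of `φⱼ` only if `i < j`. -/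
structure IsSubformulaEnum {Ag : Type u} {P : Type w} (φ : Formula Ag P)
    (L : List (Formula Ag P)) : Prop where
  nodup : L.Nodup
  mem_iff : ∀ ψ, ψ ∈ L ↔ ψ ∈ φ.subformulas
  ordered : L.Pairwise (fun ψ χ => χ ∉ ψ.subformulas)
  last : L.getLast? = some φ

/-! ### Tree automata with occurrence acceptance conditions -/

/-- A partial function `t : ℕ* ⇀ Δ` is a labelled tree: it is defined at the root, its support is
prefix-closed and full, and all its branches are infinite. -/
structure IsLabelledTree {Δ : Type u} (t : List ℕ → Option Δ) : Prop where
  root : t [] ≠ none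
  prefix_closed : ∀ y z : List ℕ, y <+: z → t z ≠ none → t y ≠ none
  full : ∀ (y : List ℕ) (i j : ℕ), j ≤ i → t (y ++ [i]) ≠ none → t (y ++ [j]) ≠ none
  infinite : ∀ y : List ℕ, t y ≠ none → t (y ++ [0]) ≠ none

/-- Initialized (infinite) paths of a tree. -/
structure IsInitPath {Δ : Type u} (t : List ℕ → Option Δ) (π : ℕ → List ℕ) : Prop where
  root : π 0 = []
  succ : ∀ k, ∃ l : ℕ, π (k + 1) = π k ++ [l]
  mem : ∀ k, t (π k) ≠ none

/-- Tree automata with states `S` and alphabet `B`. -/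
structure TreeAutomaton (S : Type u) (B : Type v) where
  init : Set S
  delta : Set (S × B × Set S)
  delta_nonempty : ∀ s b T, (s, b, T) ∈ delta → T.Nonempty
  acc : Set (Set S)

/-- The tree `t` is an accepting run of the automaton `𝒜`. -/
structure TreeAutomaton.IsAcceptingRun {S : Type u} {B : Type v} (𝒜 : TreeAutomaton S B)
    (t : List ℕ → Option (S × B)) : Prop where
  tree : IsLabelledTree t
  root : ∀ s b, t [] = some (s, b) → s ∈ 𝒜.init
  distinct : ∀ (y : List ℕ) (i j : ℕ) (s s' : S) (b b' : B), i ≠ j →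
    t (y ++ [i]) = some (s, b) → t (y ++ [j]) = some (s', b') → s ≠ s'
  step : ∀ (y : List ℕ) (s : S) (b : B), t y = some (s, b) →
    (s, b, {s' | ∃ (i : ℕ) (b' : B), t (y ++ [i]) = some (s', b')}) ∈ 𝒜.delta
  accept : ∀ π : ℕ → List ℕ, IsInitPath t π →
    {s | ∃ (k : ℕ) (b : B), t (π k) = some (s, b)} ∈ 𝒜.acc

/-- The language of the automaton is non-empty. -/
def TreeAutomaton.NonemptyLanguage {S : Type u} {B : Type v} (𝒜 : TreeAutomaton S B) : Prop :=
  ∃ t, 𝒜.IsAcceptingRun t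

/-! ### Game arenas -/

/-- Game arenas for the agents `Ag`, with action sets `Act a` and atomic propositions `P`.
`obs a` is the set of propositions observable to agent `a`; propositions observable to no agent
are allowed. -/
structure Arena (Ag : Type u) (Act : Ag → Type v) (P : Type w) where
  State : Type x
  trans : State → (∀ a, Act a) → Set State
  trans_nonempty : ∀ q c, (trans q c).Nonempty
  init : Set State
  obs : Ag → Set P
  label : State → Set P

/-- The action tuples `C_A` of a coalition. -/
abbrev CoalAct {Ag : Type u} (Act : Ag → Type v) (A : Finset Ag) : Type (max u v) :=
  ∀ a : {a // a ∈ A}, Act a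

/-- The restriction `c|_A` of an action tuple to a coalition. -/
def restr {Ag : Type u} {Act : Ag → Type v} (A : Finset Ag) (c : ∀ a, Act a) : CoalAct Act A :=
  fun a => c a

namespace Arena

section

variable {Ag : Type u} {Act : Ag → Type v} {P : Type w}

/-- `Prop_A`, the propositions observable to some member of `A`. -/
def propOf (Γ : Arena.{u, v, w, x} Ag Act P) (A : Finset Ag) : Set P :=
  ⋃ a ∈ A, Γ.obs a

/-- `λ_A(q)`, as a subset of `Prop_A`. -/
def view (Γ : Arena.{u, v, w, x} Ag Act P) (A : Finset Ag) (q : Γ.State) : Set (Γ.propOf A) :=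
  {p | (p : P) ∈ Γ.label q}

/-- `out(S, c_A, Z)`. -/
def out (Γ : Arena.{u, v, w, x} Ag Act P) (A : Finset Ag) (S : Set Γ.State) (cA : CoalAct Act A)
    (Z : Set (Γ.propOf A)) : Set Γ.State :=
  {s' | (∃ s ∈ S, ∃ c : ∀ a, Act a, restr A c = cA ∧ s' ∈ Γ.trans s c) ∧ Γ.view A s' = Z}

/-- Initialized infinite runs. -/
structure Run (Γ : Arena.{u, v, w, x} Ag Act P) where
  st : ℕ → Γ.State
  act : ℕ → ∀ a, Act a
  init_mem : st 0 ∈ Γ.init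
  step_mem : ∀ i, st (i + 1) ∈ Γ.trans (st i) (act i)

/-- `ρ[0..i] ∼_A ρ'[0..i]`. -/
def IndistUpTo (Γ : Arena.{u, v, w, x} Ag Act P) (A : Finset Ag) (i : ℕ) (ρ ρ' : Γ.Run) : Prop :=
  (∀ j < i, restr A (ρ.act j) = restr A (ρ'.act j)) ∧
    ∀ j ≤ i, Γ.view A (ρ.st j) = Γ.view A (ρ'.st j)

/-- Strategies of the coalition `A`. -/
abbrev Strategy (Γ : Arena.{u, v, w, x} Ag Act P) (A : Finset Ag) : Type (max u v w) :=
  List (Set (Γ.propOf A)) → CoalAct Act A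

/-- The `A`-history `λ_A(ρ[0]) ⋯ λ_A(ρ[i])`. -/
def history (Γ : Arena.{u, v, w, x} Ag Act P) (A : Finset Ag) (ρ : Γ.Run) (i : ℕ) :
    List (Set (Γ.propOf A)) :=
  (List.range (i + 1)).map (fun j => Γ.view A (ρ.st j))

/-- The strategy `σ` is compatible with the infinite run `ρ`. -/
def Compatible (Γ : Arena.{u, v, w, x} Ag Act P) (A : Finset Ag) (σ : Γ.Strategy A)
    (ρ : Γ.Run) : Prop :=
  ∀ j, σ (Γ.history A ρ j) = restr A (ρ.act j)

/-- The strategy `σ` is compatible with the finite run `ρ[0..i]`. -/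
def CompatibleUpTo (Γ : Arena.{u, v, w, x} Ag Act P) (A : Finset Ag) (i : ℕ) (σ : Γ.Strategy A)
    (ρ : Γ.Run) : Prop :=
  ∀ j < i, σ (Γ.history A ρ j) = restr A (ρ.act j)

/-- Satisfaction `(Γ, ρ, i) ⊨ φ`. The strategies that witness the cooperation modalities at
position `i` of `ρ` are compatible with the past `ρ[0..i]`. -/
def Sat (Γ : Arena.{u, v, w, x} Ag Act P) : Formula Ag P → Γ.Run → ℕ → Prop
  | .atom p, ρ, i => p ∈ Γ.label (ρ.st i)
  | .conj φ ψ, ρ, i => Γ.Sat φ ρ i ∧ Γ.Sat ψ ρ i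
  | .neg φ, ρ, i => ¬ Γ.Sat φ ρ i
  | .nxt A φ, ρ, i => ∃ σ : Γ.Strategy A, Γ.CompatibleUpTo A i σ ρ ∧
      ∀ ρ' : Γ.Run, Γ.Compatible A σ ρ' → Γ.IndistUpTo A i ρ' ρ → Γ.Sat φ ρ' (i + 1)
  | .untl A φ ψ, ρ, i => ∃ σ : Γ.Strategy A, Γ.CompatibleUpTo A i σ ρ ∧
      ∀ ρ' : Γ.Run, Γ.Compatible A σ ρ' → Γ.IndistUpTo A i ρ' ρ →
        ∃ j, i ≤ j ∧ Γ.Sat ψ ρ' j ∧ ∀ k, i ≤ k → k < j → Γ.Sat φ ρ' k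
  | .wuntl A φ ψ, ρ, i => ∃ σ : Γ.Strategy A, Γ.CompatibleUpTo A i σ ρ ∧
      ∀ ρ' : Γ.Run, Γ.Compatible A σ ρ' → Γ.IndistUpTo A i ρ' ρ →
        (∃ j, i ≤ j ∧ Γ.Sat ψ ρ' j ∧ ∀ k, i ≤ k → k < j → Γ.Sat φ ρ' k) ∨
          ∀ k, i ≤ k → Γ.Sat φ ρ' k
  | .know A φ, ρ, i => ∀ ρ' : Γ.Run, Γ.IndistUpTo A i ρ' ρ → Γ.Sat φ ρ' i

/-- `Γ ⊨ φ`. -/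
def Valid (Γ : Arena.{u, v, w, x} Ag Act P) (φ : Formula Ag P) : Prop :=
  ∀ ρ : Γ.Run, Γ.Sat φ ρ 0

/-! ### State splitting -/

/-- The states `(q, S)` of the split arena. -/
abbrev HatState (Γ : Arena.{u, v, w, x} Ag Act P) (A : Finset Ag) : Type x :=
  {y : Γ.State × Set Γ.State // y.1 ∈ y.2 ∧ ∀ s ∈ y.2, Γ.view A s = Γ.view A y.1}

/-- The split arena of `Γ` for the coalition `A`. -/
def hat (Γ : Arena.{u, v, w, x} Ag Act P) (A : Finset Ag) : Arena.{u, v, w, x} Ag Act P where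
  State := Γ.HatState A
  trans y c := {z | z.1.1 ∈ Γ.trans y.1.1 c ∧
    z.1.2 = Γ.out A y.1.2 (restr A c) (Γ.view A z.1.1)}
  trans_nonempty := by
    intro y c
    obtain ⟨q', hq'⟩ := Γ.trans_nonempty y.1.1 c
    exact ⟨⟨(q', Γ.out A y.1.2 (restr A c) (Γ.view A q')),
      ⟨⟨y.1.1, y.2.1, c, rfl, hq'⟩, rfl⟩, fun s hs => hs.2⟩, hq', rfl⟩
  init := {y | y.1.1 ∈ Γ.init ∧ y.1.2 = {s | s ∈ Γ.init ∧ Γ.view A s = Γ.view A y.1.1}}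
  obs := Γ.obs
  label y := Γ.label y.1.1

/-! ### State labelling -/

/-- The states of the split arena that are labelled with `K_A p`. -/
def knowSet (Γ : Arena.{u, v, w, x} Ag Act P) (A : Finset Ag) (p : P) : Set (Γ.hat A).State :=
  {y : Γ.HatState A | ∀ s ∈ y.1.2, p ∈ Γ.label s}

/-- The states `(q, S)` of the split arena that are labelled with `⟨⟨A⟩⟩ ○ p`; here `y` ranges over
the states `(r, S)` with `r ∈ S` and `z` over the states `(r', S')`. -/
def nextSet (Γ : Arena.{u, v, w, x} Ag Act P) (A : Finset Ag) (p : P) : Set (Γ.hat A).State :=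
  {qS : Γ.HatState A | ∃ cA : CoalAct Act A, ∀ (y z : Γ.HatState A) (c : ∀ a, Act a),
    y.1.2 = qS.1.2 → z ∈ (Γ.hat A).trans y c → restr A c = cA → p ∈ (Γ.hat A).label z}

/-- The pairs `(R₁, R₂)` that occur as states of the tree automata: `R₂` is a set of states that
look alike to `A`, and `R₁` is the part of `R₂` that still has to fulfil the obligation. -/
abbrev ObligationPair (Γ : Arena.{u, v, w, x} Ag Act P) (A : Finset Ag) (p₁ p₂ : P) : Type x :=
  {R : Set Γ.State × Set Γ.State // R.1 ⊆ R.2 ∧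
    (∀ r₁ ∈ R.2, ∀ r₂ ∈ R.2, Γ.view A r₁ = Γ.view A r₂) ∧
    ∀ r₁ ∈ R.1, p₂ ∉ Γ.label r₁ ∧ p₁ ∈ Γ.label r₁}

/-- The states of the tree automata: the pairs `(R₁, R₂)` and the failure state `⊥ = none`. -/
abbrev AutState (Γ : Arena.{u, v, w, x} Ag Act P) (A : Finset Ag) (p₁ p₂ : P) : Type x :=
  Option (Γ.ObligationPair A p₁ p₂)

/-- Playing `c_A` from `(R₁, R₂)` may lead from `R₁` to a state with neither `p₁` nor `p₂`. -/
def Fails (Γ : Arena.{u, v, w, x} Ag Act P) (A : Finset Ag) (p₁ p₂ : P)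
    (R : Γ.ObligationPair A p₁ p₂) (cA : CoalAct Act A) : Prop :=
  ∃ r₁ ∈ R.1.1, ∃ (y z : Γ.HatState A) (c : ∀ a, Act a), y.1 = (r₁, R.1.2) ∧
    z ∈ (Γ.hat A).trans y c ∧ restr A c = cA ∧ p₁ ∉ Γ.label z.1.1 ∧ p₂ ∉ Γ.label z.1.1

/-- The set of initial states of the tree automata for the state `(q, S)`. -/
def autInit (Γ : Arena.{u, v, w, x} Ag Act P) (A : Finset Ag) (p₁ p₂ : P) (qS : Γ.HatState A) :
    Set (Γ.AutState A p₁ p₂) :=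
  {s | ((∃ q ∈ qS.1.2, p₁ ∉ Γ.label q ∧ p₂ ∉ Γ.label q) ∧ s = none) ∨
    ((¬ ∃ q ∈ qS.1.2, p₁ ∉ Γ.label q ∧ p₂ ∉ Γ.label q) ∧ ∃ R : Γ.ObligationPair A p₁ p₂,
      s = some R ∧ R.1 = (qS.1.2 \ {q | p₂ ∈ Γ.label q}, qS.1.2))}

/-- The set of successors of a state of the tree automata under the letter `c_A`. -/
def autSucc (Γ : Arena.{u, v, w, x} Ag Act P) (A : Finset Ag) (p₁ p₂ : P) :
    Γ.AutState A p₁ p₂ → CoalAct Act A → Set (Γ.AutState A p₁ p₂)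
  | none, _ => {none}
  | some R, cA => {s | (Γ.Fails A p₁ p₂ R cA ∧ s = none) ∨
      (¬ Γ.Fails A p₁ p₂ R cA ∧ ∃ (Z : Set (Γ.propOf A)) (R' : Γ.ObligationPair A p₁ p₂),
        (Γ.out A R.1.2 cA Z).Nonempty ∧ s = some R' ∧
        R'.1 = (Γ.out A R.1.1 cA Z \ {q | p₂ ∈ Γ.label q}, Γ.out A R.1.2 cA Z))}

/-- The transition relation of the tree automata. -/
def autDelta (Γ : Arena.{u, v, w, x} Ag Act P) (A : Finset Ag) (p₁ p₂ : P) :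
    Set (Γ.AutState A p₁ p₂ × CoalAct Act A × Set (Γ.AutState A p₁ p₂)) :=
  {τ | τ.2.2.Nonempty ∧ τ.2.2 = Γ.autSucc A p₁ p₂ τ.1 τ.2.1}

/-- The tree automaton for `⟨⟨A⟩⟩ p₁ U p₂` at the state `(q, S)`: on every path some state
`(∅, R)` has to occur. -/
def untilAut (Γ : Arena.{u, v, w, x} Ag Act P) (A : Finset Ag) (p₁ p₂ : P) (qS : Γ.HatState A) :
    TreeAutomaton (Γ.AutState A p₁ p₂) (CoalAct Act A) where
  init := Γ.autInit A p₁ p₂ qS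
  delta := Γ.autDelta A p₁ p₂
  delta_nonempty _ _ _ h := h.1
  acc := {𝓡 | ∃ R : Γ.ObligationPair A p₁ p₂, R.1.1 = ∅ ∧ some R ∈ 𝓡}

/-- The tree automaton for `⟨⟨A⟩⟩ p₁ W p₂` at the state `(q, S)`: on every path only pairs
`(R₁, R₂)`, and never the failure state, may occur. -/
def wuntilAut (Γ : Arena.{u, v, w, x} Ag Act P) (A : Finset Ag) (p₁ p₂ : P) (qS : Γ.HatState A) :
    TreeAutomaton (Γ.AutState A p₁ p₂) (CoalAct Act A) where
  init := Γ.autInit A p₁ p₂ qS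
  delta := Γ.autDelta A p₁ p₂
  delta_nonempty _ _ _ h := h.1
  acc := {𝓡 | none ∉ 𝓡}

/-! ### The algorithm

Propositions of the arenas `Γ₀, …, Γₙ` are the original ones, `Sum.inl p`, and the fresh ones,
`Sum.inr ψ`, which stand for `p_ψ`. The fresh ones are observable to no agent. -/

/-- `Γ₀`: the arena `Γ`, no state of which carries a fresh proposition yet. -/
def extend (Γ : Arena.{u, v, w, x} Ag Act P) :
    Arena.{u, v, max u w, x} Ag Act (P ⊕ Formula Ag P) where
  State := Γ.State
  trans := Γ.trans
  trans_nonempty := Γ.trans_nonempty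
  init := Γ.init
  obs a := Sum.inl '' Γ.obs a
  label q := Sum.inl '' Γ.label q

/-- Add the proposition `p` to the labels of precisely the states in `X`. -/
def mark (Γ : Arena.{u, v, w, x} Ag Act P) (p : P) (X : Set Γ.State) :
    Arena.{u, v, w, x} Ag Act P where
  State := Γ.State
  trans := Γ.trans
  trans_nonempty := Γ.trans_nonempty
  init := Γ.init
  obs := Γ.obs
  label q := Γ.label q ∪ {p' | p' = p ∧ q ∈ X}

/-- One step of the algorithm: `Γₖ` from `Γₖ₋₁` and `φₖ`. The main connective of `φₖ` is applied
to the fresh propositions that stand for the immediate subformulas of `φₖ`. -/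
def algStep (Γ : Arena.{u, v, max u w, x} Ag Act (P ⊕ Formula Ag P)) :
    Formula Ag P → Arena.{u, v, max u w, x} Ag Act (P ⊕ Formula Ag P)
  | .atom p => Γ.mark (.inr (.atom p)) {q | .inl p ∈ Γ.label q}
  | .conj φ ψ => Γ.mark (.inr (.conj φ ψ)) {q | .inr φ ∈ Γ.label q ∧ .inr ψ ∈ Γ.label q}
  | .neg φ => Γ.mark (.inr (.neg φ)) {q | .inr φ ∉ Γ.label q}
  | .know A φ => (Γ.hat A).mark (.inr (.know A φ)) (Γ.knowSet A (.inr φ))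
  | .nxt A φ => (Γ.hat A).mark (.inr (.nxt A φ)) (Γ.nextSet A (.inr φ))
  | .untl A φ ψ => (Γ.hat A).mark (.inr (.untl A φ ψ))
      {y : Γ.HatState A | (Γ.untilAut A (.inr φ) (.inr ψ) y).NonemptyLanguage}
  | .wuntl A φ ψ => (Γ.hat A).mark (.inr (.wuntl A φ ψ))
      {y : Γ.HatState A | (Γ.wuntilAut A (.inr φ) (.inr ψ) y).NonemptyLanguage}

/-- The last arena `Γₙ` that the algorithm produces for the enumeration `L = [φ₁, …, φₙ]`. -/
def algResult (Γ : Arena.{u, v, w, x} Ag Act P) (L : List (Formula Ag P)) :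
    Arena.{u, v, max u w, x} Ag Act (P ⊕ Formula Ag P) :=
  L.foldl algStep Γ.extend

end

end Arena

/-! ### Inputs of the model-checking problem -/

/-- A finite arena, given by explicit lists. Its agents are `0, …, m`, the actions of agent `a` are
`0, …, k a`, its states are `0, …, numStates - 1` and its propositions `0, …, numProps - 1`. -/
structure ArenaData where
  m : ℕ
  k : Fin (m + 1) → ℕ
  numStates : ℕ
  numProps : ℕ
  transList : List (Fin numStates × (∀ a, Fin (k a + 1)) × Fin numStates)
  total : ∀ q c, ∃ q', (q, c, q') ∈ transList
  initList : List (Fin numStates)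
  obsList : List (Fin (m + 1) × Fin numProps)
  labelList : List (Fin numStates × Fin numProps)

/-- The arena described by the data. -/
def ArenaData.toArena (D : ArenaData) :
    Arena.{0, 0, 0, 0} (Fin (D.m + 1)) (fun a => Fin (D.k a + 1)) (Fin D.numProps) where
  State := Fin D.numStates
  trans q c := {q' | (q, c, q') ∈ D.transList}
  trans_nonempty q c := D.total q c
  init := {q | q ∈ D.initList}
  obs a := {p | (a, p) ∈ D.obsList}
  label q := {p | (q, p) ∈ D.labelList}

/-- The arena data written with natural numbers: number of states, number of propositions, the
list `[k 0, …, k m]`, transitions, initial states, observability and labels. -/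
abbrev ArenaCode : Type :=
  ℕ × ℕ × List ℕ × List (ℕ × List ℕ × ℕ) × List ℕ × List (ℕ × ℕ) × List (ℕ × ℕ)

def ArenaData.code (D : ArenaData) : ArenaCode :=
  (D.numStates, D.numProps, List.ofFn D.k,
    D.transList.map (fun τ => (τ.1.1, List.ofFn (fun a => (τ.2.1 a : ℕ)), τ.2.2.1)),
    D.initList.map (fun q => q.1),
    D.obsList.map (fun y => (y.1.1, y.2.1)),
    D.labelList.map (fun y => (y.1.1, y.2.1)))

/-- The members of a coalition, in increasing order. -/
def coalCode {n : ℕ} (A : Finset (Fin n)) : List ℕ :=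
  ((List.finRange n).filter (fun a => a ∈ A)).map (fun a => a.1)

/-- Formulas written in postfix notation, as words of tokens (connective, argument). -/
def Formula.code {n l : ℕ} : Formula (Fin n) (Fin l) → List (ℕ × List ℕ)
  | .atom p => [(0, [p.1])]
  | .conj φ ψ => φ.code ++ ψ.code ++ [(1, [])]
  | .neg φ => φ.code ++ [(2, [])]
  | .nxt A φ => φ.code ++ [(3, coalCode A)]
  | .untl A φ ψ => φ.code ++ ψ.code ++ [(4, coalCode A)]
  | .wuntl A φ ψ => φ.code ++ ψ.code ++ [(5, coalCode A)]
  | .know A φ => φ.code ++ [(6, coalCode A)]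

/-- The model-checking problem is decidable: some computable function tells, for every finite arena
and every formula, whether the formula is valid in the arena. -/
def ModelCheckingDecidable : Prop :=
  ∃ f : ArenaCode × List (ℕ × List ℕ) → Bool, Computable f ∧
    ∀ (D : ArenaData) (φ : Formula (Fin (D.m + 1)) (Fin D.numProps)),
      f (D.code, φ.code) = true ↔ D.toArena.Valid φ

end ATLD

-- Both parts rest on one semantic analysis: along runs of a suitably split arena, the truth of a
-- formula at a position depends only on the current state. Compatibility with the past dictates
-- what a strategy does before position `i`, so enforcing a property from `i` on amounts to choosing
-- a plan that reads only the views after `i` (`enforce_iff`). What the coalition knows at `i` is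
-- its belief, the set of states in which an indistinguishable run may be. Beliefs evolve by `out`
-- (`belief_zero`, `belief_succ`); hence the second component of a state of the split arena is the
-- belief (`hat_st_snd`). This settles `K_A` and, since only the first action of the plan matters,
-- `○` (`enforce_next`). For `U` and `W` the coalition need only remember the pending states, those
-- it may be in without having visited `X₂` since position `i`. This gives a game on sets of states
-- with a monotone one-step operator `gameOp`. Weak until is its greatest fixed point
-- (`enforce_weak`), because the pending sets reachable under a good plan form a post-fixed point.
-- Until is its least fixed point (`enforce_until`): if a plan runs through losing, hence non-empty,
-- pending sets forever, König's lemma extracts a single run that avoids `X₂`. Conversely,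
-- positional strategies win, for until because they decrease a rank. For part (1), non-emptiness of
-- the tree automata is identified with winning these games: positional strategies unfold to
-- accepting runs, and accepting runs cannot exist from losing pairs
-- (`nonemptyLanguage_untilAut_iff`, `nonemptyLanguage_wuntilAut_iff`). Splitting and marking are
-- covers (`Cover`), along which runs lift and the views of every coalition induce the same
-- partition, so sets that represent formulas survive all later steps. An induction along the
-- enumeration finishes (`Labelled.foldl`). For part (2), the same facts (`Represents`) are
-- evaluated on lists of numbers, without automata: formulas are read in postfix notation with a
-- stack of state sets, and the two fixed points are found by running through all families of sets.
-- The program is primitive recursive.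

universe y z y₁ z₁

namespace ATLD

/-! ### Runs, plans after a fixed past, and beliefs. -/

namespace Arena

section

variable {Ag : Type u} {Act : Ag → Type v} {P : Type w}

/-- Replace the future of a run after position `i` by another infinite path. -/
theorem Run.glue {Γ : Arena.{u, v, w, x} Ag Act P} (ρ : Γ.Run) (i : ℕ) (s : ℕ → Γ.State)
    (a : ℕ → ∀ a, Act a) (h0 : s 0 = ρ.st i) (hs : ∀ k, s (k + 1) ∈ Γ.trans (s k) (a k)) :
    ∃ ρ' : Γ.Run, (∀ j ≤ i, ρ'.st j = ρ.st j) ∧ (∀ j < i, ρ'.act j = ρ.act j) ∧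
      ∀ k, ρ'.st (i + k) = s k ∧ ρ'.act (i + k) = a k := by
  refine ⟨⟨fun j => if j ≤ i then ρ.st j else s (j - i),
    fun j => if j < i then ρ.act j else a (j - i), ?_, ?_⟩, ?_, ?_, ?_⟩
  · simpa using ρ.init_mem
  · intro j
    rcases lt_trichotomy j i with h | h | h
    · simpa [h, h.le, Nat.succ_le_of_lt h] using ρ.step_mem j
    · subst h
      simpa [h0] using hs 0
    · have h2 : j + 1 - i = j - i + 1 := by omega
      simpa [not_le.2 h, not_lt.2 h.le, not_le.2 (h.trans (Nat.lt_succ_self j)), h2] using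
        hs (j - i)
  · intro j hj
    simp [hj]
  · intro j hj
    simp [hj]
  · intro k
    rcases Nat.eq_zero_or_pos k with rfl | hk
    · simp [h0]
    · have : ¬ (i + k ≤ i) := by omega
      simp [hk.ne']

theorem exists_restr_eq {Ag : Type u} {Act : Ag → Type v} [∀ a, Nonempty (Act a)] (A : Finset Ag)
    (cA : CoalAct Act A) : ∃ c : ∀ a, Act a, restr A c = cA := by
  classical
  refine ⟨fun a => if h : a ∈ A then cA ⟨a, h⟩ else Classical.arbitrary _, ?_⟩
  funext a
  simp [restr]

theorem IndistUpTo.trans {Γ : Arena.{u, v, w, x} Ag Act P} {A : Finset Ag} {i : ℕ}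
    {ρ ρ' ρ'' : Γ.Run} (h : Γ.IndistUpTo A i ρ ρ') (h' : Γ.IndistUpTo A i ρ' ρ'') :
    Γ.IndistUpTo A i ρ ρ'' :=
  ⟨fun j hj => (h.1 j hj).trans (h'.1 j hj), fun j hj => (h.2 j hj).trans (h'.2 j hj)⟩

theorem IndistUpTo.mono {Γ : Arena.{u, v, w, x} Ag Act P} {A : Finset Ag} {i j : ℕ}
    {ρ ρ' : Γ.Run} (h : Γ.IndistUpTo A i ρ ρ') (hj : j ≤ i) : Γ.IndistUpTo A j ρ ρ' :=
  ⟨fun k hk => h.1 k (hk.trans_le hj), fun k hk => h.2 k (hk.trans hj)⟩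

theorem IndistUpTo.of_eq {Γ : Arena.{u, v, w, x} Ag Act P} {A : Finset Ag} {i : ℕ}
    {ρ ρ' : Γ.Run} (hs : ∀ j ≤ i, ρ.st j = ρ'.st j) (ha : ∀ j < i, ρ.act j = ρ'.act j) :
    Γ.IndistUpTo A i ρ ρ' :=
  ⟨fun j hj => by rw [ha j hj], fun j hj => by rw [hs j hj]⟩

theorem history_eq_of_indist {Γ : Arena.{u, v, w, x} Ag Act P} {A : Finset Ag} {i j : ℕ}
    {ρ ρ' : Γ.Run} (h : Γ.IndistUpTo A i ρ ρ') (hj : j ≤ i) :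
    Γ.history A ρ j = Γ.history A ρ' j := by
  unfold history
  refine List.map_congr_left fun k hk => h.2 k ?_
  have := List.mem_range.1 hk
  omega

/-- The coalition `A` can enforce the property `T` of runs after the segment `ρ[0..i]`. -/
def Enforce (Γ : Arena.{u, v, w, x} Ag Act P) (A : Finset Ag) (i : ℕ) (ρ : Γ.Run)
    (T : Γ.Run → Prop) : Prop :=
  ∃ σ : Γ.Strategy A, Γ.CompatibleUpTo A i σ ρ ∧
    ∀ ρ' : Γ.Run, Γ.Compatible A σ ρ' → Γ.IndistUpTo A i ρ' ρ → T ρ'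

/-- The views of `ρ` at the `k` positions after `i`. -/
def future (Γ : Arena.{u, v, w, x} Ag Act P) (A : Finset Ag) (ρ : Γ.Run) (i k : ℕ) :
    List (Set (Γ.propOf A)) :=
  (List.range k).map (fun j => Γ.view A (ρ.st (i + 1 + j)))

theorem future_succ (Γ : Arena.{u, v, w, x} Ag Act P) (A : Finset Ag) (ρ : Γ.Run) (i k : ℕ) :
    Γ.future A ρ i (k + 1) = Γ.future A ρ i k ++ [Γ.view A (ρ.st (i + k + 1))] := by
  simp [future, List.range_succ, Nat.add_right_comm]

@[simp] theorem length_history (Γ : Arena.{u, v, w, x} Ag Act P) (A : Finset Ag) (ρ : Γ.Run)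
    (i : ℕ) : (Γ.history A ρ i).length = i + 1 := by
  simp [history]

theorem history_add (Γ : Arena.{u, v, w, x} Ag Act P) (A : Finset Ag) (ρ : Γ.Run) (i k : ℕ) :
    Γ.history A ρ (i + k) = Γ.history A ρ i ++ Γ.future A ρ i k := by
  have : i + k + 1 = (i + 1) + k := by omega
  rw [history, history, future, this, List.range_add, List.map_append, List.map_map]
  rfl

/-- The run `ρ'` follows, after position `i`, the plan `τ`, which depends on later views. -/
def Follows (Γ : Arena.{u, v, w, x} Ag Act P) (A : Finset Ag) (i : ℕ)
    (τ : List (Set (Γ.propOf A)) → CoalAct Act A) (ρ' : Γ.Run) : Prop :=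
  ∀ k, restr A (ρ'.act (i + k)) = τ (Γ.future A ρ' i k)

/-- On histories of positions before `i` the strategy is dictated by `ρ`, and all later histories of
the relevant runs extend the history of `ρ` at `i`. Only the dependence on the views after `i` is
free, which removes the compatibility clause from the semantics. -/
theorem enforce_iff (Γ : Arena.{u, v, w, x} Ag Act P) (A : Finset Ag) (i : ℕ) (ρ : Γ.Run)
    (T : Γ.Run → Prop) :
    Γ.Enforce A i ρ T ↔ ∃ τ : List (Set (Γ.propOf A)) → CoalAct Act A,
      ∀ ρ' : Γ.Run, Γ.IndistUpTo A i ρ' ρ → Γ.Follows A i τ ρ' → T ρ' := by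
  constructor
  · rintro ⟨σ, hσ, h⟩
    refine ⟨fun l => σ (Γ.history A ρ i ++ l), fun ρ' hi hf => h ρ' (fun j => ?_) hi⟩
    rcases lt_or_ge j i with hj | hj
    · rw [history_eq_of_indist hi hj.le, hσ j hj, hi.1 j hj]
    · obtain ⟨k, rfl⟩ := Nat.exists_eq_add_of_le hj
      rw [hf k, history_add, history_eq_of_indist hi le_rfl]
  · rintro ⟨τ, h⟩
    -- A list of length at most `i` is the history of position `l.length - 1`, where `ρ` prescribes
    -- the action; on longer lists the first `i + 1` views are the past and are dropped.
    refine ⟨fun l => if l.length ≤ i then restr A (ρ.act (l.length - 1)) else τ (l.drop (i + 1)),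
      fun j hj => ?_, fun ρ' hc hi => h ρ' hi fun k => ?_⟩
    · simp [Nat.succ_le_of_lt hj]
    · rw [← hc (i + k), history_add]
      have : ¬ (i + 1 + (Γ.future A ρ' i k).length ≤ i) := by omega
      simp [this]

/-- A finite path, given as an initial segment of a run, can be continued according to a plan. -/
theorem exists_follow [∀ a, Nonempty (Act a)] (Γ : Arena.{u, v, w, x} Ag Act P) (A : Finset Ag)
    (i n : ℕ) (τ : List (Set (Γ.propOf A)) → CoalAct Act A) (ρ : Γ.Run)
    (hρ : ∀ k < n, restr A (ρ.act (i + k)) = τ (Γ.future A ρ i k)) :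
    ∃ ρ' : Γ.Run, (∀ j ≤ i + n, ρ'.st j = ρ.st j) ∧ (∀ j < i + n, ρ'.act j = ρ.act j) ∧
      Γ.Follows A i τ ρ' := by
  choose ext hext using exists_restr_eq (Act := Act) A
  choose nx hnx using Γ.trans_nonempty
  -- The recursion carries the views since position `i`, which the plan needs, along with the
  -- current state.
  let f : ℕ → List (Set (Γ.propOf A)) × Γ.State := fun k => Nat.rec (Γ.future A ρ i n, ρ.st (i + n))
    (fun _ p => (p.1 ++ [Γ.view A (nx p.2 (ext (τ p.1)))], nx p.2 (ext (τ p.1)))) k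
  have hf : ∀ k, f (k + 1) = ((f k).1 ++ [Γ.view A (nx (f k).2 (ext (τ (f k).1)))],
    nx (f k).2 (ext (τ (f k).1))) := fun k => rfl
  obtain ⟨ρ', h1, h2, h3⟩ := ρ.glue (i + n) (fun k => (f k).2) (fun k => ext (τ (f k).1)) rfl
    (fun k => by rw [hf]; exact hnx _ _)
  have hfut : ∀ k ≤ n, Γ.future A ρ' i k = Γ.future A ρ i k := by
    intro k hk
    refine List.map_congr_left fun j hj => ?_
    have := List.mem_range.1 hj
    rw [h1 _ (by omega)]
  have hfut2 : ∀ k, Γ.future A ρ' i (n + k) = (f k).1 := by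
    intro k
    induction k with
    | zero => exact hfut n le_rfl
    | succ k ih =>
      rw [← Nat.add_assoc, future_succ, ih, hf]
      have := (h3 (k + 1)).1
      rw [hf] at this
      rw [← Nat.add_assoc] at this
      rw [← Nat.add_assoc, this]
  refine ⟨ρ', h1, h2, fun k => ?_⟩
  rcases lt_or_ge k n with hk | hk
  · rw [h2 _ (by omega), hρ k hk, hfut k hk.le]
  · obtain ⟨m, rfl⟩ := Nat.exists_eq_add_of_le hk
    rw [hfut2, ← Nat.add_assoc, (h3 m).2, hext]

/-- Change the step that a run makes at position `i`. -/
theorem exists_step [∀ a, Nonempty (Act a)] {Γ : Arena.{u, v, w, x} Ag Act P} (ρ : Γ.Run) (i : ℕ)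
    (c : ∀ a, Act a) (r : Γ.State) (hr : r ∈ Γ.trans (ρ.st i) c) :
    ∃ ρ' : Γ.Run, (∀ j ≤ i, ρ'.st j = ρ.st j) ∧ (∀ j < i, ρ'.act j = ρ.act j) ∧
      ρ'.act i = c ∧ ρ'.st (i + 1) = r := by
  choose nx hnx using Γ.trans_nonempty
  let g : ℕ → Γ.State := fun k => Nat.rec r (fun _ s => nx s c) k
  obtain ⟨ρ', h1, h2, h3⟩ := ρ.glue i (fun k => Nat.casesOn k (ρ.st i) g) (fun _ => c) rfl
    (fun k => by cases k with
      | zero => exact hr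
      | succ k => exact hnx _ _)
  exact ⟨ρ', h1, h2, (h3 0).2, (h3 1).1⟩

/-- The states in which, as far as `A` knows, the run `ρ` may be at position `i`. -/
def belief (Γ : Arena.{u, v, w, x} Ag Act P) (A : Finset Ag) (ρ : Γ.Run) (i : ℕ) : Set Γ.State :=
  {s | ∃ ρ' : Γ.Run, Γ.IndistUpTo A i ρ' ρ ∧ ρ'.st i = s}

theorem belief_zero [∀ a, Nonempty (Act a)] (Γ : Arena.{u, v, w, x} Ag Act P) (A : Finset Ag)
    (ρ : Γ.Run) : Γ.belief A ρ 0 = {s | s ∈ Γ.init ∧ Γ.view A s = Γ.view A (ρ.st 0)} := by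
  ext s
  constructor
  · rintro ⟨ρ', h, rfl⟩
    exact ⟨ρ'.init_mem, h.2 0 le_rfl⟩
  · rintro ⟨h1, h2⟩
    choose nx hnx using Γ.trans_nonempty
    refine ⟨⟨fun k => Nat.rec s (fun _ s => nx s (fun _ => Classical.arbitrary _)) k,
      fun _ _ => Classical.arbitrary _, h1, fun i => hnx _ _⟩, ⟨fun j hj => by omega, ?_⟩, rfl⟩
    intro j hj
    obtain rfl : j = 0 := by omega
    exact h2

/-- Indistinguishability up to `i + 1` is indistinguishability up to `i` and one more step with the
same `A`-action and the same view. Any such step is realised by redirecting a run with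
`exists_step`, so this is the update rule of the split arena. -/
theorem belief_succ [∀ a, Nonempty (Act a)] (Γ : Arena.{u, v, w, x} Ag Act P) (A : Finset Ag)
    (ρ : Γ.Run) (i : ℕ) : Γ.belief A ρ (i + 1) =
      Γ.out A (Γ.belief A ρ i) (restr A (ρ.act i)) (Γ.view A (ρ.st (i + 1))) := by
  ext s
  constructor
  · rintro ⟨ρ', h, rfl⟩
    exact ⟨⟨ρ'.st i, ⟨ρ', h.mono (Nat.le_succ i), rfl⟩, ρ'.act i, h.1 i (Nat.lt_succ_self i),
      ρ'.step_mem i⟩, h.2 _ le_rfl⟩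
  · rintro ⟨⟨r, ⟨ρ', h, rfl⟩, c, hc, hs⟩, hv⟩
    obtain ⟨ρ'', h1, h2, h3, h4⟩ := exists_step ρ' i c s hs
    refine ⟨ρ'', ⟨fun j hj => ?_, fun j hj => ?_⟩, h4⟩
    · rcases Nat.lt_succ_iff_lt_or_eq.1 hj with hj | rfl
      · rw [h2 j hj, h.1 j hj]
      · rw [h3, hc]
    · rcases Nat.le_succ_iff.1 hj with hj | rfl
      · rw [h1 j hj, h.2 j hj]
      · rw [Nat.succ_eq_add_one, h4, hv]

theorem enforce_next [∀ a, Nonempty (Act a)] (Γ : Arena.{u, v, w, x} Ag Act P) (A : Finset Ag)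
    (i : ℕ) (ρ : Γ.Run) (X : Set Γ.State) :
    Γ.Enforce A i ρ (fun ρ' => ρ'.st (i + 1) ∈ X) ↔
      ∃ cA : CoalAct Act A, ∀ r ∈ Γ.belief A ρ i, ∀ c, restr A c = cA →
        ∀ r' ∈ Γ.trans r c, r' ∈ X := by
  rw [enforce_iff]
  constructor
  · rintro ⟨τ, h⟩
    -- Only the first action matters, and no view after position `i` is available when it is chosen.
    -- The redirected run below must still be completed according to `τ`, since the hypothesis
    -- speaks of infinite runs that follow the plan.
    refine ⟨τ [], ?_⟩
    rintro _ ⟨ρ', hi, rfl⟩ c hc r' hr'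
    obtain ⟨ρ₁, h1, h2, h3, h4⟩ := exists_step ρ' i c r' hr'
    obtain ⟨ρ₂, g1, g2, g3⟩ := Γ.exists_follow A i 1 τ ρ₁ (by
      intro k hk
      obtain rfl : k = 0 := by omega
      exact (congrArg (restr A) h3).trans hc)
    have := h ρ₂ ((IndistUpTo.of_eq (fun j hj => by rw [g1 j (by omega), h1 j hj])
      (fun j hj => by rw [g2 j (by omega), h2 j hj])).trans hi) g3
    rwa [g1 _ le_rfl, h4] at this
  · rintro ⟨cA, h⟩
    exact ⟨fun _ => cA, fun ρ' hi hf => h _ ⟨ρ', hi, rfl⟩ _ (hf 0) _ (ρ'.step_mem i)⟩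

end

end Arena

/-! ### König's lemma and the fixed-point games on sets of pending states. -/

/-- König's lemma for a sequence of non-empty levels in a finite set. -/
theorem exists_path_of_levels {α : Type u} [Finite α] (L : ℕ → Set α) (E : ℕ → α → α → Prop)
    (hL : ∀ k, (L k).Nonempty) (hE : ∀ k, ∀ y ∈ L (k + 1), ∃ x ∈ L k, E k x y) :
    ∃ s : ℕ → α, ∀ k, s k ∈ L k ∧ E k (s k) (s (k + 1)) := by
  classical
  -- `Reach n k x` says that a path of `n` edges through the levels starts at `x` in level `k`. Such
  -- paths exist because edges can be prolonged backwards by `hE`.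
  let Reach : ℕ → ℕ → α → Prop := fun n => Nat.rec (fun k x => x ∈ L k)
    (fun _ R k x => x ∈ L k ∧ ∃ y, E k x y ∧ R (k + 1) y) n
  have r0 : ∀ k x, Reach 0 k x ↔ x ∈ L k := fun _ _ => Iff.rfl
  have rs : ∀ n k x, Reach (n + 1) k x ↔ x ∈ L k ∧ ∃ y, E k x y ∧ Reach n (k + 1) y :=
    fun _ _ _ => Iff.rfl
  have anti : ∀ n k x, Reach (n + 1) k x → Reach n k x := by
    intro n
    induction n with
    | zero => exact fun k x h => h.1
    | succ n ih =>
      rintro k x ⟨h, y, hy, hr⟩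
      exact ⟨h, y, hy, ih _ _ hr⟩
  have anti' : ∀ k x, Antitone fun n => Reach n k x := fun k x =>
    antitone_nat_of_succ_le fun n => anti n k x
  have ex : ∀ n k, ∃ x, Reach n k x := by
    intro n
    induction n with
    | zero => exact fun k => hL k
    | succ n ih =>
      intro k
      obtain ⟨y, hy⟩ := ih (k + 1)
      have hyL : y ∈ L (k + 1) := anti' _ _ (Nat.zero_le n) hy
      obtain ⟨x, hx, he⟩ := hE k y hyL
      exact ⟨x, hx, y, he, hy⟩
  -- Finiteness enters here: if every `x` failed at some stage `N x`, then by antitonicity all would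
  -- fail at the largest of these stages.
  have pigeon : ∀ Q : ℕ → α → Prop, (∀ x, Antitone fun n => Q n x) → (∀ n, ∃ x, Q n x) →
      ∃ x, ∀ n, Q n x := by
    intro Q hQ hex
    by_contra! hcon
    choose N hN using hcon
    cases nonempty_fintype α
    obtain ⟨x, hx⟩ := hex (Finset.univ.sup N)
    exact hN x (hQ x (Finset.le_sup (Finset.mem_univ x)) hx)
  have start : ∃ x, ∀ n, Reach n 0 x := pigeon _ (fun x => anti' 0 x) (fun n => ex n 0)
  have next : ∀ k x, (∀ n, Reach n k x) → ∃ y, E k x y ∧ ∀ n, Reach n (k + 1) y := by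
    intro k x h
    obtain ⟨y, hy⟩ := pigeon (fun n y => E k x y ∧ Reach n (k + 1) y)
      (fun y m n hmn h => ⟨h.1, anti' _ _ hmn h.2⟩) (fun n => (h (n + 1)).2)
    exact ⟨y, (hy 0).1, fun n => (hy n).2⟩
  choose! nx hnx using next
  obtain ⟨x0, hx0⟩ := start
  let s : ℕ → α := fun k => Nat.rec x0 (fun k x => nx k x) k
  have hs : ∀ k, ∀ n, Reach n k (s k) := by
    intro k
    induction k with
    | zero => exact hx0
    | succ k ih => exact (hnx k _ ih).2
  exact ⟨s, fun k => ⟨hs k 0, (hnx k _ (hs k)).1⟩⟩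

namespace Arena

section

variable {Ag : Type u} {Act : Ag → Type v} {P : Type w}

/-- Under `cA`, all successors of `R` lie in `X₁ ∪ X₂`, and the sets of those successors outside
`X₂` that look alike to `A` belong to `W`. -/
def SafeStep (Γ : Arena.{u, v, w, x} Ag Act P) (A : Finset Ag) (X₁ X₂ : Set Γ.State)
    (W : Set (Set Γ.State)) (R : Set Γ.State) (cA : CoalAct Act A) : Prop :=
  ∀ r ∈ R, ∀ c, restr A c = cA → ∀ r' ∈ Γ.trans r c,
    (r' ∈ X₁ ∨ r' ∈ X₂) ∧ Γ.out A R cA (Γ.view A r') \ X₂ ∈ W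

theorem SafeStep.mono {Γ : Arena.{u, v, w, x} Ag Act P} {A : Finset Ag} {X₁ X₂ : Set Γ.State}
    {W W' : Set (Set Γ.State)} {R : Set Γ.State} {cA : CoalAct Act A}
    (h : Γ.SafeStep A X₁ X₂ W R cA) (hW : W ⊆ W') : Γ.SafeStep A X₁ X₂ W' R cA :=
  fun r hr c hc r' hr' => ⟨(h r hr c hc r' hr').1, hW (h r hr c hc r' hr').2⟩

/-- The one-step operator of the games on sets of states. -/
def gameOp (Γ : Arena.{u, v, w, x} Ag Act P) (A : Finset Ag) (X₁ X₂ : Set Γ.State) :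
    Set (Set Γ.State) →o Set (Set Γ.State) where
  toFun W := {R | ∃ cA, Γ.SafeStep A X₁ X₂ W R cA}
  monotone' _ _ hW _ := fun ⟨cA, h⟩ => ⟨cA, h.mono hW⟩

theorem mem_gameOp {Γ : Arena.{u, v, w, x} Ag Act P} {A : Finset Ag} {X₁ X₂ : Set Γ.State}
    {W : Set (Set Γ.State)} {R : Set Γ.State} :
    R ∈ Γ.gameOp A X₁ X₂ W ↔ ∃ cA, Γ.SafeStep A X₁ X₂ W R cA := Iff.rfl

/-- The sets from which `A` can force all plays, uniformly, into `X₂` through `X₁`. -/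
def winUntil (Γ : Arena.{u, v, w, x} Ag Act P) (A : Finset Ag) (X₁ X₂ : Set Γ.State) :
    Set (Set Γ.State) :=
  (Γ.gameOp A X₁ X₂).lfp

/-- The sets from which `A` can force all plays to remain in `X₁` until they reach `X₂`, if
ever. -/
def winWeak (Γ : Arena.{u, v, w, x} Ag Act P) (A : Finset Ag) (X₁ X₂ : Set Γ.State) :
    Set (Set Γ.State) :=
  (Γ.gameOp A X₁ X₂).gfp

theorem winUntil_eq (Γ : Arena.{u, v, w, x} Ag Act P) (A : Finset Ag) (X₁ X₂ : Set Γ.State) :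
    Γ.gameOp A X₁ X₂ (Γ.winUntil A X₁ X₂) = Γ.winUntil A X₁ X₂ :=
  (Γ.gameOp A X₁ X₂).map_lfp

theorem winWeak_eq (Γ : Arena.{u, v, w, x} Ag Act P) (A : Finset Ag) (X₁ X₂ : Set Γ.State) :
    Γ.gameOp A X₁ X₂ (Γ.winWeak A X₁ X₂) = Γ.winWeak A X₁ X₂ :=
  (Γ.gameOp A X₁ X₂).map_gfp

/-- With nothing pending, every action is vacuously safe. Conversely, a losing pending set is
non-empty, which is what feeds König's lemma. -/
theorem empty_mem_winUntil [∀ a, Nonempty (Act a)] (Γ : Arena.{u, v, w, x} Ag Act P)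
    (A : Finset Ag) (X₁ X₂ : Set Γ.State) : ∅ ∈ Γ.winUntil A X₁ X₂ := by
  rw [← winUntil_eq]
  exact ⟨fun _ => Classical.arbitrary _, fun r hr => absurd hr (Set.notMem_empty r)⟩

theorem empty_mem_winWeak [∀ a, Nonempty (Act a)] (Γ : Arena.{u, v, w, x} Ag Act P)
    (A : Finset Ag) (X₁ X₂ : Set Γ.State) : ∅ ∈ Γ.winWeak A X₁ X₂ := by
  rw [← winWeak_eq]
  exact ⟨fun _ => Classical.arbitrary _, fun r hr => absurd hr (Set.notMem_empty r)⟩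

/-- A positional strategy for the weak game. -/
theorem exists_positional_weak [∀ a, Nonempty (Act a)] (Γ : Arena.{u, v, w, x} Ag Act P)
    (A : Finset Ag) (X₁ X₂ : Set Γ.State) :
    ∃ f : Set Γ.State → CoalAct Act A, ∀ R ∈ Γ.winWeak A X₁ X₂,
      Γ.SafeStep A X₁ X₂ (Γ.winWeak A X₁ X₂) R (f R) := by
  have key : ∀ R ∈ Γ.winWeak A X₁ X₂, ∃ cA, Γ.SafeStep A X₁ X₂ (Γ.winWeak A X₁ X₂) R cA := by
    intro R hR
    rwa [← winWeak_eq] at hR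
  have : Nonempty (CoalAct Act A) := ⟨fun _ => Classical.arbitrary _⟩
  choose! f hf using key
  exact ⟨f, hf⟩

/-- A positional strategy for the until game, which decreases a rank. -/
theorem exists_positional_until [∀ a, Nonempty (Act a)] (Γ : Arena.{u, v, w, x} Ag Act P)
    [Finite Γ.State] (A : Finset Ag) (X₁ X₂ : Set Γ.State) :
    ∃ (f : Set Γ.State → CoalAct Act A) (rk : Set Γ.State → ℕ),
      ∀ R ∈ Γ.winUntil A X₁ X₂, R.Nonempty →
        Γ.SafeStep A X₁ X₂ {R' | R' ∈ Γ.winUntil A X₁ X₂ ∧ (R'.Nonempty → rk R' < rk R)} R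
          (f R) := by
  classical
  -- The finite approximants of the least fixed point from below.
  let G : ℕ → Set (Set Γ.State) := fun n => (Γ.gameOp A X₁ X₂)^[n] ∅
  have hG : ∀ n, G (n + 1) = Γ.gameOp A X₁ X₂ (G n) := fun n =>
    Function.iterate_succ_apply' _ _ _
  have hmono : Monotone G := by
    refine monotone_nat_of_le_succ fun n => ?_
    induction n with
    | zero => exact Set.empty_subset _
    | succ n ih =>
      rw [hG n, hG (n + 1)]
      exact (Γ.gameOp A X₁ X₂).monotone ih
  have hsub : ∀ n, G n ⊆ Γ.winUntil A X₁ X₂ := by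
    intro n
    induction n with
    | zero => exact Set.empty_subset _
    | succ n ih =>
      rw [hG, ← winUntil_eq]
      exact (Γ.gameOp A X₁ X₂).monotone ih
  -- The union of the approximants is already a pre-fixed point: there are finitely many sets of
  -- states, so a single stage contains all those that ever enter.
  have hex : Γ.winUntil A X₁ X₂ ⊆ {R | ∃ n, R ∈ G n} := by
    refine OrderHom.lfp_le _ ?_
    rintro R ⟨cA, h⟩
    cases nonempty_fintype (Set Γ.State)
    have : ∀ R' : Set Γ.State, ∃ n, (∃ n, R' ∈ G n) → R' ∈ G n := by
      intro R'
      by_cases hR' : ∃ n, R' ∈ G n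
      · exact ⟨_, fun _ => hR'.choose_spec⟩
      · exact ⟨0, fun h => absurd h hR'⟩
    choose N hN using this
    refine ⟨Finset.univ.sup N + 1, ?_⟩
    rw [hG]
    exact ⟨cA, h.mono fun R' hR' =>
      hmono (Finset.le_sup (Finset.mem_univ R')) (hN R' hR')⟩
  -- The rank is the stage of entry. It is positive on winning sets, as `G 0` is empty, and an
  -- action that witnesses entry at stage `m + 1` leads to sets already present at stage `m`.
  let rk : Set Γ.State → ℕ := fun R => if h : ∃ n, R ∈ G n then Nat.find h else 0
  have key : ∀ R ∈ Γ.winUntil A X₁ X₂, ∃ cA, Γ.SafeStep A X₁ X₂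
      {R' | R' ∈ Γ.winUntil A X₁ X₂ ∧ (R'.Nonempty → rk R' < rk R)} R cA := by
    intro R hR
    have h : ∃ n, R ∈ G n := hex hR
    have hrk : rk R = Nat.find h := dif_pos h
    have hf : R ∈ G (rk R) := hrk ▸ Nat.find_spec h
    obtain ⟨m, hm⟩ : ∃ m, rk R = m + 1 := by
      refine Nat.exists_eq_succ_of_ne_zero fun h0 => ?_
      rw [h0] at hf
      exact hf
    rw [hm, hG] at hf
    obtain ⟨cA, hc⟩ := hf
    refine ⟨cA, hc.mono fun R' hR' => ⟨hsub m hR', fun _ => ?_⟩⟩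
    have h' : ∃ n, R' ∈ G n := ⟨m, hR'⟩
    have : rk R' = Nat.find h' := dif_pos h'
    rw [this, hm]
    exact Nat.lt_succ_of_le (Nat.find_min' h' hR')
  have : Nonempty (CoalAct Act A) := ⟨fun _ => Classical.arbitrary _⟩
  choose! f hf using key
  exact ⟨f, rk, fun R hR _ => hf R hR⟩

/-- `X₁ U X₂` holds from position `i` on. -/
def UntilFrom {Γ : Arena.{u, v, w, x} Ag Act P} (X₁ X₂ : Set Γ.State) (i : ℕ) (ρ : Γ.Run) :
    Prop :=
  ∃ j, i ≤ j ∧ ρ.st j ∈ X₂ ∧ ∀ k, i ≤ k → k < j → ρ.st k ∈ X₁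

/-- The set of pending states after the views `l`, under the positional strategy `f`. -/
def pendingPos (Γ : Arena.{u, v, w, x} Ag Act P) (A : Finset Ag) (X₂ R₀ : Set Γ.State)
    (f : Set Γ.State → CoalAct Act A) (l : List (Set (Γ.propOf A))) : Set Γ.State :=
  l.foldl (fun R Z => Γ.out A R (f R) Z \ X₂) R₀

/-- Playing a positional strategy that is safe on an invariant family of sets. -/
theorem until_or_pending {Γ : Arena.{u, v, w, x} Ag Act P} {A : Finset Ag} {X₁ X₂ : Set Γ.State}
    {f : Set Γ.State → CoalAct Act A} {W : Set (Set Γ.State)}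
    {rel : Set Γ.State → Set Γ.State → Prop} {i : ℕ} {R₀ : Set Γ.State}
    (hf : ∀ R ∈ W, R.Nonempty → Γ.SafeStep A X₁ X₂ {R' | R' ∈ W ∧ rel R' R} R (f R)) {ρ : Γ.Run}
    (h0 : R₀ ∈ W)
    (hst : ρ.st i ∈ X₁ ∨ ρ.st i ∈ X₂) (hR : ρ.st i ∉ X₂ → ρ.st i ∈ R₀)
    (hfol : Γ.Follows A i (fun l => f (Γ.pendingPos A X₂ R₀ f l)) ρ)
    (hU : ¬ UntilFrom X₁ X₂ i ρ) (k : ℕ) :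
    ρ.st (i + k) ∈ X₁ ∧ ρ.st (i + k) ∈ Γ.pendingPos A X₂ R₀ f (Γ.future A ρ i k) ∧
      rel (Γ.pendingPos A X₂ R₀ f (Γ.future A ρ i (k + 1)))
        (Γ.pendingPos A X₂ R₀ f (Γ.future A ρ i k)) := by
  have hstep : ∀ k, Γ.pendingPos A X₂ R₀ f (Γ.future A ρ i (k + 1)) =
      Γ.out A (Γ.pendingPos A X₂ R₀ f (Γ.future A ρ i k))
        (f (Γ.pendingPos A X₂ R₀ f (Γ.future A ρ i k))) (Γ.view A (ρ.st (i + k + 1))) \ X₂ := by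
    intro k
    simp [future_succ, pendingPos]
  -- As long as `X₁` has held throughout, a visit to `X₂` would fulfil the until property.
  have hnot : ∀ k, (∀ j < k, ρ.st (i + j) ∈ X₁) → ρ.st (i + k) ∉ X₂ := by
    intro k hk h2
    refine hU ⟨i + k, Nat.le_add_right _ _, h2, fun j hj hj' => ?_⟩
    obtain ⟨m, rfl⟩ := Nat.exists_eq_add_of_le hj
    exact hk m (by omega)
  have main : ∀ k, (∀ j ≤ k, ρ.st (i + j) ∈ X₁) ∧
      ρ.st (i + k) ∈ Γ.pendingPos A X₂ R₀ f (Γ.future A ρ i k) ∧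
      Γ.pendingPos A X₂ R₀ f (Γ.future A ρ i k) ∈ W := by
    intro k
    induction k with
    | zero =>
      have h2 := hnot 0 (by simp)
      refine ⟨fun j hj => ?_, hR h2, h0⟩
      obtain rfl : j = 0 := by omega
      exact hst.resolve_right h2
    | succ k ih =>
      obtain ⟨h1, h2, h3⟩ := ih
      obtain ⟨h4, h5⟩ := hf _ h3 ⟨_, h2⟩ _ h2 _ (hfol k) _ (ρ.step_mem (i + k))
      have h6 := hnot (k + 1) fun j hj => h1 j (Nat.lt_succ_iff.1 hj)
      refine ⟨fun j hj => ?_, ?_, by rw [hstep]; exact h5.1⟩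
      · rcases Nat.le_succ_iff.1 hj with hj | rfl
        · exact h1 j hj
        · exact h4.resolve_right h6
      · rw [hstep]
        exact ⟨⟨⟨_, h2, _, hfol k, ρ.step_mem (i + k)⟩, rfl⟩, h6⟩
  obtain ⟨h1, h2, h3⟩ := main k
  obtain ⟨h4, h5⟩ := hf _ h3 ⟨_, h2⟩ _ h2 _ (hfol k) _ (ρ.step_mem (i + k))
  exact ⟨h1 k le_rfl, h2, by rw [hstep]; exact h5.2⟩

/-- The set of pending states after the views `l`, the last one first, under the plan `τ`. -/
def pending (Γ : Arena.{u, v, w, x} Ag Act P) (A : Finset Ag) (X₂ R₀ : Set Γ.State)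
    (τ : List (Set (Γ.propOf A)) → CoalAct Act A) : List (Set (Γ.propOf A)) → Set Γ.State
  | [] => R₀
  | Z :: l => Γ.out A (Γ.pending A X₂ R₀ τ l) (τ l.reverse) Z \ X₂

/-- Pending states are not mere possibilities of the bookkeeping: each is the end of a genuine run
that obeys the plan, shows the views `l` and has avoided `X₂` since `i`. The run is built by
grafting one step for each view. -/
theorem exists_run_of_pending [∀ a, Nonempty (Act a)] {Γ : Arena.{u, v, w, x} Ag Act P}
    {A : Finset Ag} {X₂ : Set Γ.State} {τ : List (Set (Γ.propOf A)) → CoalAct Act A} {i : ℕ}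
    {ρ : Γ.Run} (l : List (Set (Γ.propOf A))) (r : Γ.State)
    (hr : r ∈ Γ.pending A X₂ (Γ.belief A ρ i \ X₂) τ l) :
    ∃ ρ' : Γ.Run, Γ.IndistUpTo A i ρ' ρ ∧
      (∀ k < l.length, restr A (ρ'.act (i + k)) = τ (Γ.future A ρ' i k)) ∧
      Γ.future A ρ' i l.length = l.reverse ∧ ρ'.st (i + l.length) = r ∧
      ∀ k ≤ l.length, ρ'.st (i + k) ∉ X₂ := by
  induction l generalizing r with
  | nil =>
    obtain ⟨⟨ρ', h, rfl⟩, h2⟩ := hr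
    refine ⟨ρ', h, by simp, rfl, rfl, fun k hk => ?_⟩
    obtain rfl : k = 0 := by simpa using hk
    exact h2
  | cons Z l ih =>
    obtain ⟨⟨⟨s, hs, c, hc, hr⟩, hv⟩, h2⟩ := hr
    obtain ⟨ρ', g1, g2, g3, rfl, g5⟩ := ih s hs
    obtain ⟨ρ₁, f1, f2, f3, f4⟩ := exists_step ρ' _ c r hr
    have hfut : ∀ k ≤ l.length, Γ.future A ρ₁ i k = Γ.future A ρ' i k := by
      intro k hk
      refine List.map_congr_left fun j hj => ?_
      have := List.mem_range.1 hj
      rw [f1 _ (by omega)]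
    refine ⟨ρ₁, (IndistUpTo.of_eq (fun j hj => f1 j (by omega))
      fun j hj => f2 j (by omega)).trans g1, fun k hk => ?_, ?_, f4, fun k hk => ?_⟩
    · rw [List.length_cons] at hk
      rcases Nat.lt_succ_iff_lt_or_eq.1 hk with hk | rfl
      · rw [f2 _ (by omega), g2 k hk, hfut k hk.le]
      · rw [f3, hc, hfut _ le_rfl, g3]
    · rw [List.length_cons, future_succ, hfut _ le_rfl, g3, f4, hv, List.reverse_cons]
    · rw [List.length_cons] at hk
      rcases Nat.le_succ_iff.1 hk with hk | rfl
      · rw [f1 _ (by omega)]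
        exact g5 k hk
      · exact fun h => h2 (f4 ▸ h)

/-- A plan that enforces the weak until property never leads to states outside `X₁ ∪ X₂`. -/
theorem safe_of_enforce_weak [∀ a, Nonempty (Act a)] {Γ : Arena.{u, v, w, x} Ag Act P}
    {A : Finset Ag} {X₁ X₂ : Set Γ.State} {τ : List (Set (Γ.propOf A)) → CoalAct Act A} {i : ℕ}
    {ρ : Γ.Run} (h : ∀ ρ' : Γ.Run, Γ.IndistUpTo A i ρ' ρ → Γ.Follows A i τ ρ' →
      UntilFrom X₁ X₂ i ρ' ∨ ∀ k, i ≤ k → ρ'.st k ∈ X₁) :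
    (∀ s ∈ Γ.belief A ρ i, s ∈ X₁ ∨ s ∈ X₂) ∧
      ∀ l, Γ.SafeStep A X₁ X₂
        {R | ∃ Z, R = Γ.pending A X₂ (Γ.belief A ρ i \ X₂) τ (Z :: l)}
        (Γ.pending A X₂ (Γ.belief A ρ i \ X₂) τ l) (τ l.reverse) := by
  constructor
  · rintro _ ⟨ρ', hi, rfl⟩
    obtain ⟨ρ₁, f1, f2, f3⟩ := Γ.exists_follow A i 0 τ ρ' (by simp)
    have := h ρ₁ ((IndistUpTo.of_eq f1 f2).trans hi) f3
    rw [← f1 i le_rfl]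
    rcases this with ⟨j, hj, h2, h1⟩ | h1
    · rcases hj.eq_or_lt with rfl | hj
      · exact Or.inr h2
      · exact Or.inl (h1 i le_rfl hj)
    · exact Or.inl (h1 i le_rfl)
  · intro l r hr c hc r' hr'
    refine ⟨?_, ⟨_, rfl⟩⟩
    obtain ⟨ρ', g1, g2, g3, rfl, g5⟩ := exists_run_of_pending l r hr
    obtain ⟨ρ₁, f1, f2, f3, f4⟩ := exists_step ρ' _ c r' hr'
    have hfut : ∀ k ≤ l.length, Γ.future A ρ₁ i k = Γ.future A ρ' i k := by
      intro k hk
      refine List.map_congr_left fun j hj => ?_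
      have := List.mem_range.1 hj
      rw [f1 _ (by omega)]
    obtain ⟨ρ₂, e1, e2, e3⟩ := Γ.exists_follow A i (l.length + 1) τ ρ₁ (by
      intro k hk
      rcases Nat.lt_succ_iff_lt_or_eq.1 hk with hk | rfl
      · rw [f2 _ (by omega), g2 k hk, hfut k hk.le]
      · rw [f3, hc, hfut _ le_rfl, g3])
    have hr2 : ρ₂.st (i + l.length + 1) = r' := by
      rw [Nat.add_assoc, e1 _ le_rfl, ← Nat.add_assoc, f4]
    have := h ρ₂ ((IndistUpTo.of_eq (fun j hj => by rw [e1 j (by omega), f1 j (by omega)])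
      fun j hj => by rw [e2 j (by omega), f2 j (by omega)]).trans g1) e3
    rw [← hr2]
    -- A witness for until cannot come before the new state, because the run avoids `X₂` up to
    -- position `i + l.length`.
    rcases this with ⟨j, hj, h2, h1⟩ | h1
    · rcases lt_trichotomy j (i + l.length + 1) with hlt | rfl | hlt
      · obtain ⟨k, rfl⟩ := Nat.exists_eq_add_of_le hj
        rw [e1 _ hlt.le, f1 _ (by omega)] at h2
        exact absurd h2 (g5 k (by omega))
      · exact Or.inr h2
      · exact Or.inl (h1 _ (by omega) hlt)
    · exact Or.inl (h1 _ (by omega))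

/-- The pending sets that occur under a good plan form a post-fixed point of `gameOp`, hence lie in
its greatest fixed point. Conversely, a positional strategy on pending sets is a plan, as the
pending set can be recomputed from the views. -/
theorem enforce_weak [∀ a, Nonempty (Act a)] (Γ : Arena.{u, v, w, x} Ag Act P) (A : Finset Ag)
    (X₁ X₂ : Set Γ.State) (i : ℕ) (ρ : Γ.Run) :
    Γ.Enforce A i ρ (fun ρ' => UntilFrom X₁ X₂ i ρ' ∨ ∀ k, i ≤ k → ρ'.st k ∈ X₁) ↔
      (∀ s ∈ Γ.belief A ρ i, s ∈ X₁ ∨ s ∈ X₂) ∧ Γ.belief A ρ i \ X₂ ∈ Γ.winWeak A X₁ X₂ := by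
  rw [enforce_iff]
  constructor
  · rintro ⟨τ, h⟩
    obtain ⟨h1, h2⟩ := safe_of_enforce_weak h
    refine ⟨h1, ?_⟩
    have : {R | ∃ l, R = Γ.pending A X₂ (Γ.belief A ρ i \ X₂) τ l} ≤ Γ.winWeak A X₁ X₂ := by
      refine OrderHom.le_gfp _ ?_
      rintro _ ⟨l, rfl⟩
      exact ⟨_, (h2 l).mono fun R hR => ⟨_, hR.choose_spec⟩⟩
    exact this ⟨[], rfl⟩
  · rintro ⟨h1, h2⟩
    obtain ⟨f, hf⟩ := Γ.exists_positional_weak A X₁ X₂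
    refine ⟨fun l => f (Γ.pendingPos A X₂ (Γ.belief A ρ i \ X₂) f l), fun ρ' hi hfol => ?_⟩
    by_contra! hcon
    obtain ⟨hU, k, hk, hk'⟩ := hcon
    obtain ⟨m, rfl⟩ := Nat.exists_eq_add_of_le hk
    exact hk' (until_or_pending (f := f) (R₀ := Γ.belief A ρ i \ X₂)
      (W := Γ.winWeak A X₁ X₂) (rel := fun _ _ => True)
      (fun R hR _ => (hf R hR).mono fun R' h => ⟨h, trivial⟩) h2
      (h1 _ ⟨ρ', hi, rfl⟩) (fun h => ⟨⟨ρ', hi, rfl⟩, h⟩) hfol hU m).1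

/-- If the initial pending set is losing, every plan admits an infinite sequence of views along
which it stays losing and so non-empty; König's lemma then yields one run that never reaches `X₂`.
If it is winning, a run on which until fails would make the rank descend forever. -/
theorem enforce_until [∀ a, Nonempty (Act a)] (Γ : Arena.{u, v, w, x} Ag Act P)
    [Finite Γ.State] (A : Finset Ag) (X₁ X₂ : Set Γ.State) (i : ℕ) (ρ : Γ.Run) :
    Γ.Enforce A i ρ (UntilFrom X₁ X₂ i) ↔
      (∀ s ∈ Γ.belief A ρ i, s ∈ X₁ ∨ s ∈ X₂) ∧ Γ.belief A ρ i \ X₂ ∈ Γ.winUntil A X₁ X₂ := by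
  rw [enforce_iff]
  constructor
  · rintro ⟨τ, h⟩
    obtain ⟨h1, h2⟩ := safe_of_enforce_weak fun ρ' g1 g2 => Or.inl (h ρ' g1 g2)
    refine ⟨h1, ?_⟩
    by_contra h3
    -- If all successors under the planned action were winning, the fixed-point equation would make
    -- the present pending set winning.
    have next : ∀ l, Γ.pending A X₂ (Γ.belief A ρ i \ X₂) τ l ∉ Γ.winUntil A X₁ X₂ →
        ∃ Z, Γ.pending A X₂ (Γ.belief A ρ i \ X₂) τ (Z :: l) ∉ Γ.winUntil A X₁ X₂ := by
      intro l hl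
      by_contra! hcon
      refine hl ?_
      rw [← winUntil_eq]
      exact ⟨_, (h2 l).mono fun R ⟨Z, hZ⟩ => hZ ▸ hcon Z⟩
    choose! nx hnx using next
    let z : ℕ → List (Set (Γ.propOf A)) := fun k => Nat.rec [] (fun _ l => nx l :: l) k
    have hz : ∀ k, z (k + 1) = nx (z k) :: z k := fun _ => rfl
    have hzl : ∀ k, (z k).length = k := by
      intro k
      induction k with
      | zero => rfl
      | succ k ih => rw [hz, List.length_cons, ih]
    have hlose : ∀ k, Γ.pending A X₂ (Γ.belief A ρ i \ X₂) τ (z k) ∉ Γ.winUntil A X₁ X₂ := by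
      intro k
      induction k with
      | zero => exact h3
      | succ k ih => exact hnx _ ih
    -- The levels are the pending sets along the chosen views; an edge is a transition that obeys
    -- the plan and shows the next view.
    obtain ⟨s, hs⟩ := exists_path_of_levels
      (fun k => Γ.pending A X₂ (Γ.belief A ρ i \ X₂) τ (z k))
      (fun k r r' => Γ.view A r' = nx (z k) ∧ ∃ c, restr A c = τ (z k).reverse ∧ r' ∈ Γ.trans r c)
      (fun k => by
        rw [Set.nonempty_iff_ne_empty]
        exact fun h => hlose k (h ▸ Γ.empty_mem_winUntil A X₁ X₂))
      (fun k y hy => by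
        obtain ⟨⟨⟨r, hr, hc⟩, hv⟩, -⟩ := hy
        exact ⟨r, hr, hv, hc⟩)
    choose hs1 hv a ha hs2 using hs
    obtain ⟨ρ', hi, hρ'⟩ := (hs1 0).1
    obtain ⟨ρ₁, f1, f2, f3⟩ := ρ'.glue i s a hρ'.symm hs2
    have hfut : ∀ k, Γ.future A ρ₁ i k = (z k).reverse := by
      intro k
      induction k with
      | zero => rfl
      | succ k ih =>
        rw [future_succ, ih, hz, List.reverse_cons, Nat.add_assoc, (f3 _).1, hv]
    obtain ⟨j, hj, h5, -⟩ := h ρ₁ ((IndistUpTo.of_eq f1 f2).trans hi) fun k => by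
      rw [(f3 k).2, ha, hfut]
    obtain ⟨k, rfl⟩ := Nat.exists_eq_add_of_le hj
    rw [(f3 k).1] at h5
    have : ∀ l, ∀ r ∈ Γ.pending A X₂ (Γ.belief A ρ i \ X₂) τ l, r ∉ X₂ := by
      intro l r hr
      cases l with
      | nil => exact hr.2
      | cons Z l => exact hr.2
    exact this _ _ (hs1 k) h5
  · rintro ⟨h1, h2⟩
    obtain ⟨f, rk, hf⟩ := Γ.exists_positional_until A X₁ X₂
    refine ⟨fun l => f (Γ.pendingPos A X₂ (Γ.belief A ρ i \ X₂) f l), fun ρ' hi hfol => ?_⟩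
    by_contra hU
    have key := until_or_pending (f := f) (R₀ := Γ.belief A ρ i \ X₂)
      (W := Γ.winUntil A X₁ X₂) (rel := fun R' R => R'.Nonempty → rk R' < rk R) hf h2
      (h1 _ ⟨ρ', hi, rfl⟩) (fun h => ⟨⟨ρ', hi, rfl⟩, h⟩) hfol hU
    exact not_strictAnti_of_wellFoundedLT
      (fun k => rk (Γ.pendingPos A X₂ (Γ.belief A ρ i \ X₂) f (Γ.future A ρ' i k)))
      (strictAnti_nat_of_succ_lt fun k => (key k).2.2 ⟨_, (key (k + 1)).2.1⟩)

end

end Arena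

/-! ### Covers of arenas and sets of states that represent formulas. -/

namespace Arena

section

variable {Ag : Type u} {Act : Ag → Type v} {P : Type w} {P' : Type y} {P'' : Type y₁}

/-- A projection of arenas along which runs can be lifted and which respects what coalitions
see. -/
structure Cover (Γ : Arena.{u, v, w, x} Ag Act P) (Δ : Arena.{u, v, y, z} Ag Act P') where
  proj : Δ.State → Γ.State
  init : ∀ y ∈ Δ.init, proj y ∈ Γ.init
  trans : ∀ y c, ∀ z ∈ Δ.trans y c, proj z ∈ Γ.trans (proj y) c
  lift_init : ∀ q ∈ Γ.init, ∃ y ∈ Δ.init, proj y = q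
  lift_trans : ∀ y c, ∀ r ∈ Γ.trans (proj y) c, ∃ z ∈ Δ.trans y c, proj z = r
  view_iff : ∀ A y z, Δ.view A y = Δ.view A z ↔ Γ.view A (proj y) = Γ.view A (proj z)

namespace Cover

variable {Γ : Arena.{u, v, w, x} Ag Act P} {Δ : Arena.{u, v, y, z} Ag Act P'}
  {Θ : Arena.{u, v, y₁, z₁} Ag Act P''}

/-- The identity cover. -/
def refl (Γ : Arena.{u, v, w, x} Ag Act P) : Cover Γ Γ where
  proj := id
  init _ hy := hy
  trans _ _ _ hz := hz
  lift_init q hq := ⟨q, hq, rfl⟩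
  lift_trans _ _ r hr := ⟨r, hr, rfl⟩
  view_iff _ _ _ := Iff.rfl

/-- The composition of two covers. -/
def comp (C : Cover Γ Δ) (D : Cover Δ Θ) : Cover Γ Θ where
  proj y := C.proj (D.proj y)
  init y hy := C.init _ (D.init y hy)
  trans y c z hz := C.trans _ c _ (D.trans y c z hz)
  lift_init q hq := by
    obtain ⟨y, hy, rfl⟩ := C.lift_init q hq
    obtain ⟨z, hz, rfl⟩ := D.lift_init y hy
    exact ⟨z, hz, rfl⟩
  lift_trans y c r hr := by
    obtain ⟨s, hs, rfl⟩ := C.lift_trans _ c r hr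
    obtain ⟨z, hz, rfl⟩ := D.lift_trans y c s hs
    exact ⟨z, hz, rfl⟩
  view_iff A y z := (D.view_iff A y z).trans (C.view_iff A _ _)

/-- The projection of runs. -/
def map (C : Cover Γ Δ) (ρ : Δ.Run) : Γ.Run where
  st i := C.proj (ρ.st i)
  act := ρ.act
  init_mem := C.init _ ρ.init_mem
  step_mem i := C.trans _ _ _ (ρ.step_mem i)

theorem exists_lift (C : Cover Γ Δ) (ρ : Γ.Run) : ∃ ρ' : Δ.Run, C.map ρ' = ρ := by
  obtain ⟨y0, hy0, h0⟩ := C.lift_init _ ρ.init_mem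
  have next : ∀ (i : ℕ) (y : Δ.State), C.proj y = ρ.st i →
      ∃ z ∈ Δ.trans y (ρ.act i), C.proj z = ρ.st (i + 1) := by
    intro i y hy
    exact C.lift_trans y _ _ (hy ▸ ρ.step_mem i)
  choose! nx hnx hpr using next
  let s : ℕ → Δ.State := fun k => Nat.rec y0 (fun i y => nx i y) k
  have hs : ∀ k, C.proj (s k) = ρ.st k := by
    intro k
    induction k with
    | zero => exact h0
    | succ k ih => exact hpr k _ ih
  refine ⟨⟨s, ρ.act, hy0, fun i => hnx i _ (hs i)⟩, ?_⟩
  cases ρ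
  simp only [map, Run.mk.injEq, and_true]
  exact funext hs

theorem indist_iff (C : Cover Γ Δ) (A : Finset Ag) (i : ℕ) (ρ ρ' : Δ.Run) :
    Γ.IndistUpTo A i (C.map ρ) (C.map ρ') ↔ Δ.IndistUpTo A i ρ ρ' :=
  and_congr Iff.rfl (forall₂_congr fun _ _ => (C.view_iff A _ _).symm)

/-- The views of `Γ` and `Δ` live in different types, but by `view_iff` they induce the same
partition of the states of `Δ`, so a representative translates one into the other. The value `∅` is
taken only on sets that are the view of no state. -/
theorem exists_view_map (C : Cover Γ Δ) (A : Finset Ag) :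
    ∃ g : Set (Δ.propOf A) → Set (Γ.propOf A), ∀ y, g (Δ.view A y) = Γ.view A (C.proj y) := by
  classical
  refine ⟨fun Z => if h : ∃ y, Δ.view A y = Z then Γ.view A (C.proj h.choose) else ∅,
    fun y => ?_⟩
  have h : ∃ z, Δ.view A z = Δ.view A y := ⟨y, rfl⟩
  exact (dif_pos h).trans ((C.view_iff A _ _).1 h.choose_spec)

theorem exists_view_comap (C : Cover Γ Δ) (A : Finset Ag) :
    ∃ g : Set (Γ.propOf A) → Set (Δ.propOf A), ∀ y, g (Γ.view A (C.proj y)) = Δ.view A y := by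
  classical
  refine ⟨fun Z => if h : ∃ y, Γ.view A (C.proj y) = Z then Δ.view A h.choose else ∅,
    fun y => ?_⟩
  have h : ∃ z, Γ.view A (C.proj z) = Γ.view A (C.proj y) := ⟨y, rfl⟩
  exact (dif_pos h).trans ((C.view_iff A _ _).2 h.choose_spec)

/-- Plans are transported by translating each view. Because every run of `Γ` lifts to `Δ`, no run
that has to be controlled is lost. -/
theorem enforce_iff (C : Cover Γ Δ) (A : Finset Ag) (i : ℕ) (ρ : Δ.Run) (T : Γ.Run → Prop) :
    Γ.Enforce A i (C.map ρ) T ↔ Δ.Enforce A i ρ fun ρ' => T (C.map ρ') := by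
  rw [Arena.enforce_iff, Arena.enforce_iff]
  constructor
  · rintro ⟨τ, h⟩
    obtain ⟨g, hg⟩ := C.exists_view_map A
    refine ⟨fun l => τ (l.map g), fun ρ' hi hf => h _ ((C.indist_iff A i _ _).2 hi) fun k => ?_⟩
    refine (hf k).trans (congrArg τ ?_)
    simp only [future, List.map_map]
    exact List.map_congr_left fun j _ => hg _
  · rintro ⟨τ, h⟩
    obtain ⟨g, hg⟩ := C.exists_view_comap A
    refine ⟨fun l => τ (l.map g), fun ρ₀ hi hf => ?_⟩
    obtain ⟨ρ', rfl⟩ := C.exists_lift ρ₀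
    refine h _ ((C.indist_iff A i _ _).1 hi) fun k => ?_
    refine (hf k).trans (congrArg τ ?_)
    simp only [future, List.map_map]
    exact List.map_congr_left fun j _ => hg _

/-- The split arena covers the original one. -/
def hat (Γ : Arena.{u, v, w, x} Ag Act P) (A : Finset Ag) : Cover Γ (Γ.hat A) where
  proj := fun y : Γ.HatState A => y.1.1
  init y hy := hy.1
  trans y c z hz := hz.1
  lift_init q hq := ⟨(⟨(q, {s | s ∈ Γ.init ∧ Γ.view A s = Γ.view A q}), ⟨hq, rfl⟩,
    fun s hs => hs.2⟩ : Γ.HatState A), ⟨hq, rfl⟩, rfl⟩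
  lift_trans y c r hr := by
    change Γ.HatState A at y
    exact ⟨(⟨(r, Γ.out A y.1.2 (restr A c) (Γ.view A r)), ⟨⟨y.1.1, y.2.1, c, rfl, hr⟩, rfl⟩,
      fun s hs => hs.2⟩ : Γ.HatState A), ⟨hr, rfl⟩, rfl⟩
  view_iff _ _ _ := Iff.rfl

/-- Additional propositions that nobody observes do not matter. -/
def mark (Γ : Arena.{u, v, w, x} Ag Act P) (p : P) (X : Set Γ.State) (hp : ∀ a, p ∉ Γ.obs a) :
    Cover Γ (Γ.mark p X) where
  proj := id
  init _ hy := hy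
  trans _ _ _ hz := hz
  lift_init q hq := ⟨q, hq, rfl⟩
  lift_trans _ _ r hr := ⟨r, hr, rfl⟩
  view_iff A y z := by
    have hne : ∀ q : Γ.propOf A, (q : P) ≠ p := by
      rintro ⟨q, hq⟩ rfl
      obtain ⟨a, -, ha⟩ := Set.mem_iUnion₂.1 hq
      exact hp a ha
    have : ∀ y, (Γ.mark p X).view A y = Γ.view A y := by
      intro y
      ext q
      change _ ∨ _ ↔ _
      exact or_iff_left fun h => hne q h.1
    rw [this, this]
    rfl

/-- The arena with fresh propositions. -/
def extend (Γ : Arena.{u, v, w, x} Ag Act P) : Cover Γ Γ.extend where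
  proj := id
  init _ hy := hy
  trans _ _ _ hz := hz
  lift_init q hq := ⟨q, hq, rfl⟩
  lift_trans _ _ r hr := ⟨r, hr, rfl⟩
  view_iff A y z := by
    have key : ∀ y z : Γ.State, Γ.extend.view A y = Γ.extend.view A z ↔
        ∀ p ∈ Γ.propOf A, (p ∈ Γ.label y ↔ p ∈ Γ.label z) := by
      intro y z
      rw [Set.ext_iff]
      constructor
      · intro h p hp
        have hp' : Sum.inl p ∈ Γ.extend.propOf A := by
          obtain ⟨a, ha, h⟩ := Set.mem_iUnion₂.1 hp
          exact Set.mem_iUnion₂.2 ⟨a, ha, p, h, rfl⟩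
        exact Sum.inl_injective.mem_set_image.symm.trans
          ((h ⟨_, hp'⟩).trans Sum.inl_injective.mem_set_image)
      · rintro h ⟨q, hq⟩
        obtain ⟨a, ha, p, hp, rfl⟩ := Set.mem_iUnion₂.1 hq
        exact Sum.inl_injective.mem_set_image.trans
          ((h p (Set.mem_iUnion₂.2 ⟨a, ha, hp⟩)).trans Sum.inl_injective.mem_set_image.symm)
    refine (key y z).trans ?_
    rw [Set.ext_iff]
    exact ⟨fun h p => h p.1 p.2, fun h p hp => h ⟨p, hp⟩⟩

end Cover

/-- The purpose of state splitting: initial states and transitions of the split arena follow the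
recursion of `belief_zero` and `belief_succ`. -/
theorem hat_st_snd [∀ a, Nonempty (Act a)] (Γ : Arena.{u, v, w, x} Ag Act P) (A : Finset Ag)
    (ρ : (Γ.hat A).Run) (i : ℕ) :
    (ρ.st i : Γ.HatState A).1.2 = Γ.belief A ((Cover.hat Γ A).map ρ) i := by
  induction i with
  | zero => exact ρ.init_mem.2.trans (Γ.belief_zero A ((Cover.hat Γ A).map ρ)).symm
  | succ i ih =>
    rw [belief_succ, ← ih]
    exact (ρ.step_mem i).2

/-- The set `X` of states of the cover `Δ` consists, as far as runs are concerned, of the states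
in which `ψ` holds. -/
def Represents {Γ : Arena.{u, v, w, x} Ag Act P} {Δ : Arena.{u, v, y, z} Ag Act P'}
    (C : Cover Γ Δ) (X : Set Δ.State) (ψ : Formula Ag P) : Prop :=
  ∀ (ρ : Δ.Run) (i : ℕ), ρ.st i ∈ X ↔ Γ.Sat ψ (C.map ρ) i

namespace Represents

variable {Γ : Arena.{u, v, w, x} Ag Act P} {Δ : Arena.{u, v, y, z} Ag Act P'}
  {Θ : Arena.{u, v, y₁, z₁} Ag Act P''}
  {C : Cover Γ Δ} {X X₁ X₂ : Set Δ.State} {ψ ψ₁ ψ₂ : Formula Ag P}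

theorem atom (C : Cover Γ Δ) (p : P) : Represents C {y | p ∈ Γ.label (C.proj y)} (.atom p) :=
  fun _ _ => by simp only [Sat]; exact Iff.rfl

theorem conj (h₁ : Represents C X₁ ψ₁) (h₂ : Represents C X₂ ψ₂) :
    Represents C {y | y ∈ X₁ ∧ y ∈ X₂} (.conj ψ₁ ψ₂) :=
  fun ρ i => by simp only [Sat]; exact and_congr (h₁ ρ i) (h₂ ρ i)

theorem neg (h : Represents C X ψ) : Represents C {y | y ∉ X} (.neg ψ) :=
  fun ρ i => by simp only [Sat]; exact not_congr (h ρ i)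

theorem pullback (h : Represents C X ψ) (D : Cover Δ Θ) :
    Represents (C.comp D) {y | D.proj y ∈ X} ψ :=
  fun ρ i => h (D.map ρ) i

/-- As for the strategic modalities below, `hat_st_snd` turns the condition on the state into one on
the belief in `Δ`, which is then transported to `Γ` along `C`. -/
theorem know [∀ a, Nonempty (Act a)] (h : Represents C X ψ) (A : Finset Ag) :
    Represents (C.comp (Cover.hat Δ A)) {y : Δ.HatState A | ∀ s ∈ y.1.2, s ∈ X}
      (.know A ψ) := by
  intro ρ i
  change (∀ s ∈ (ρ.st i : Δ.HatState A).1.2, s ∈ X) ↔ _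
  rw [hat_st_snd]
  simp only [Sat]
  constructor
  · intro h1 ρ₀ hi
    obtain ⟨ρ', rfl⟩ := C.exists_lift ρ₀
    exact (h ρ' i).1 (h1 _ ⟨ρ', (C.indist_iff A i _ ((Cover.hat Δ A).map ρ)).1 hi, rfl⟩)
  · rintro h1 _ ⟨ρ', hi, rfl⟩
    exact (h ρ' i).2 (h1 _ ((C.indist_iff A i _ ((Cover.hat Δ A).map ρ)).2 hi))

theorem nxt [∀ a, Nonempty (Act a)] (h : Represents C X ψ) (A : Finset Ag) :
    Represents (C.comp (Cover.hat Δ A)) {y : Δ.HatState A | ∃ cA : CoalAct Act A,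
      ∀ r ∈ y.1.2, ∀ c, restr A c = cA → ∀ r' ∈ Δ.trans r c, r' ∈ X} (.nxt A ψ) := by
  intro ρ i
  change (∃ cA : CoalAct Act A, ∀ r ∈ (ρ.st i : Δ.HatState A).1.2, _) ↔ _
  rw [hat_st_snd, ← enforce_next]
  have hT : (fun ρ' : Δ.Run => ρ'.st (i + 1) ∈ X) = fun ρ' => Γ.Sat ψ (C.map ρ') (i + 1) :=
    funext fun ρ' => propext (h ρ' (i + 1))
  rw [hT]
  refine (C.enforce_iff A i ((Cover.hat Δ A).map ρ) fun ρ' => Γ.Sat ψ ρ' (i + 1)).symm.trans ?_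
  simp only [Sat]
  exact Iff.rfl

theorem untilFrom_iff (h₁ : Represents C X₁ ψ₁) (h₂ : Represents C X₂ ψ₂) (i : ℕ) (ρ : Δ.Run) :
    UntilFrom X₁ X₂ i ρ ↔ ∃ j, i ≤ j ∧ Γ.Sat ψ₂ (C.map ρ) j ∧
      ∀ k, i ≤ k → k < j → Γ.Sat ψ₁ (C.map ρ) k :=
  exists_congr fun j => and_congr Iff.rfl
    (and_congr (h₂ ρ j) (forall_congr' fun k => forall₂_congr fun _ _ => h₁ ρ k))

theorem untl [∀ a, Nonempty (Act a)] [Finite Δ.State] (h₁ : Represents C X₁ ψ₁)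
    (h₂ : Represents C X₂ ψ₂) (A : Finset Ag) :
    Represents (C.comp (Cover.hat Δ A)) {y : Δ.HatState A | (∀ s ∈ y.1.2, s ∈ X₁ ∨ s ∈ X₂) ∧
      y.1.2 \ X₂ ∈ Δ.winUntil A X₁ X₂} (.untl A ψ₁ ψ₂) := by
  intro ρ i
  change ((∀ s ∈ (ρ.st i : Δ.HatState A).1.2, _) ∧ (ρ.st i : Δ.HatState A).1.2 \ X₂ ∈ _) ↔ _
  rw [hat_st_snd, ← enforce_until]
  rw [show UntilFrom X₁ X₂ i = _ from funext fun ρ' => propext (untilFrom_iff h₁ h₂ i ρ')]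
  refine (C.enforce_iff A i ((Cover.hat Δ A).map ρ) fun ρ' => ∃ j, i ≤ j ∧ Γ.Sat ψ₂ ρ' j ∧
    ∀ k, i ≤ k → k < j → Γ.Sat ψ₁ ρ' k).symm.trans ?_
  simp only [Sat]
  exact Iff.rfl

theorem wuntl [∀ a, Nonempty (Act a)] (h₁ : Represents C X₁ ψ₁)
    (h₂ : Represents C X₂ ψ₂) (A : Finset Ag) :
    Represents (C.comp (Cover.hat Δ A)) {y : Δ.HatState A | (∀ s ∈ y.1.2, s ∈ X₁ ∨ s ∈ X₂) ∧
      y.1.2 \ X₂ ∈ Δ.winWeak A X₁ X₂} (.wuntl A ψ₁ ψ₂) := by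
  intro ρ i
  change ((∀ s ∈ (ρ.st i : Δ.HatState A).1.2, _) ∧ (ρ.st i : Δ.HatState A).1.2 \ X₂ ∈ _) ↔ _
  rw [hat_st_snd, ← enforce_weak]
  rw [show (fun ρ' : Δ.Run => UntilFrom X₁ X₂ i ρ' ∨ ∀ k, i ≤ k → ρ'.st k ∈ X₁) = _ from
    funext fun ρ' => propext (or_congr (untilFrom_iff h₁ h₂ i ρ')
      (forall₂_congr fun k _ => h₁ ρ' k))]
  refine (C.enforce_iff A i ((Cover.hat Δ A).map ρ) fun ρ' => (∃ j, i ≤ j ∧ Γ.Sat ψ₂ ρ' j ∧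
    ∀ k, i ≤ k → k < j → Γ.Sat ψ₁ ρ' k) ∨ ∀ k, i ≤ k → Γ.Sat ψ₁ ρ' k).symm.trans ?_
  simp only [Sat]
  exact Iff.rfl

/-- Every run of `Γ` lifts, and totality lets every initial state of `Δ` begin a run. -/
theorem forall_init_iff [∀ a, Nonempty (Act a)] (h : Represents C X ψ) :
    (∀ y ∈ Δ.init, y ∈ X) ↔ ∀ ρ : Γ.Run, Γ.Sat ψ ρ 0 := by
  constructor
  · intro h1 ρ₀
    obtain ⟨ρ, rfl⟩ := C.exists_lift ρ₀
    exact (h ρ 0).1 (h1 _ ρ.init_mem)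
  · intro h1 y hy
    choose nx hnx using Δ.trans_nonempty
    exact (h ⟨fun k => Nat.rec y (fun _ s => nx s (fun _ => Classical.arbitrary _)) k,
      fun _ _ => Classical.arbitrary _, hy, fun i => hnx _ _⟩ 0).2 (h1 _)

end Represents

end

end Arena

/-! ### Accepting runs of tree automata: unfolding strategies and selecting paths. -/

namespace TreeAutomaton

variable {S : Type u} {B : Type v}

/-- A positional strategy `f`, with successor sets `T`, unfolds to an accepting run. -/
theorem nonemptyLanguage_of_positional [Finite S] (𝒜 : TreeAutomaton S B) (f : S → B)
    (T : S → Set S) (I : Set S) (s₀ : S) (h0 : s₀ ∈ I) (hinit : s₀ ∈ 𝒜.init)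
    (hT : ∀ s ∈ I, (s, f s, T s) ∈ 𝒜.delta) (hI : ∀ s ∈ I, T s ⊆ I)
    (hacc : ∀ σ : ℕ → S, σ 0 = s₀ → (∀ k, σ k ∈ I) → (∀ k, σ (k + 1) ∈ T (σ k)) →
      Set.range σ ∈ 𝒜.acc) : 𝒜.NonemptyLanguage := by
  classical
  cases nonempty_fintype S
  -- A duplicate-free enumeration of the successors numbers the children consecutively and keeps
  -- their states distinct.
  let en : S → List S := fun s => (Finset.univ.filter (· ∈ T s)).toList
  have hen : ∀ s s', s' ∈ en s ↔ s' ∈ T s := fun s s' => by simp [en]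
  have hnd : ∀ s, (en s).Nodup := fun s => Finset.nodup_toList _
  -- Addresses in the tree grow at their end, whereas lists recurse at their head; `g` therefore
  -- reads the reversed address.
  let g : List ℕ → Option S := fun y => List.rec (some s₀)
    (fun i _ o => o.bind fun s => (en s)[i]?) y
  let st : List ℕ → Option S := fun y => g y.reverse
  let t : List ℕ → Option (S × B) := fun y => (st y).map fun s => (s, f s)
  have st0 : st [] = some s₀ := rfl
  have sts : ∀ y i, st (y ++ [i]) = (st y).bind fun s => (en s)[i]? := by
    intro y i
    simp only [st, List.reverse_append, List.reverse_singleton, List.singleton_append]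
    rfl
  have tn : ∀ y, t y ≠ none ↔ ∃ s, st y = some s := by
    intro y
    simp [t, Option.ne_none_iff_exists']
  have ts : ∀ y s b, t y = some (s, b) ↔ st y = some s ∧ b = f s := by
    intro y s b
    simp only [t, Option.map_eq_some_iff, Prod.mk.injEq]
    constructor
    · rintro ⟨a, h, rfl, rfl⟩
      exact ⟨h, rfl⟩
    · rintro ⟨h, rfl⟩
      exact ⟨s, h, rfl, rfl⟩
  have inv : ∀ y s, st y = some s → s ∈ I := by
    intro y
    induction y using List.reverseRecOn with
    | nil =>
      intro s h
      rw [st0] at h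
      cases h
      exact h0
    | append_singleton y i ih =>
      intro s h
      rw [sts, Option.bind_eq_some_iff] at h
      obtain ⟨s', h1, h2⟩ := h
      exact hI s' (ih s' h1) ((hen _ _).1 (List.mem_of_getElem? h2))
  have child : ∀ y s, st y = some s → ∀ s', (∃ i, st (y ++ [i]) = some s') ↔ s' ∈ T s := by
    intro y s h s'
    simp only [sts, h, Option.bind_some]
    rw [← hen, List.mem_iff_getElem?]
  refine ⟨t, ⟨?_, ?_, ?_, ?_⟩, ?_, ?_, ?_, ?_⟩
  · exact (tn []).2 ⟨s₀, st0⟩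
  · rintro y z ⟨w, rfl⟩
    induction w using List.reverseRecOn with
    | nil => simp
    | append_singleton w i ih =>
      intro h
      refine ih ((tn _).2 ?_)
      obtain ⟨s, hs⟩ := (tn _).1 h
      rw [← List.append_assoc, sts, Option.bind_eq_some_iff] at hs
      exact ⟨_, hs.choose_spec.1⟩
  · intro y i j hij h
    obtain ⟨s, hs⟩ := (tn _).1 h
    rw [sts, Option.bind_eq_some_iff] at hs
    obtain ⟨s', h1, h2⟩ := hs
    obtain ⟨hi, -⟩ := List.getElem?_eq_some_iff.1 h2
    refine (tn _).2 ⟨(en s')[j]'(by omega), ?_⟩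
    rw [sts, h1]
    exact List.getElem?_eq_getElem _
  · intro y h
    obtain ⟨s, hs⟩ := (tn _).1 h
    obtain ⟨s', hs'⟩ := 𝒜.delta_nonempty _ _ _ (hT s (inv y s hs))
    rw [← hen] at hs'
    refine (tn _).2 ⟨(en s)[0]'(List.length_pos_of_mem hs'), ?_⟩
    rw [sts, hs]
    exact List.getElem?_eq_getElem _
  · intro s b h
    have hs := ((ts [] s b).1 h).1
    rw [st0] at hs
    cases hs
    exact hinit
  · rintro y i j s s' b b' hij h h' rfl
    have hs := ((ts _ _ _).1 h).1
    have hs' := ((ts _ _ _).1 h').1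
    rw [sts, Option.bind_eq_some_iff] at hs hs'
    obtain ⟨r, h1, h2⟩ := hs
    obtain ⟨r', h1', h2'⟩ := hs'
    obtain rfl : r = r' := Option.some_injective _ (h1.symm.trans h1')
    obtain ⟨hi, h2⟩ := List.getElem?_eq_some_iff.1 h2
    obtain ⟨hj, h2'⟩ := List.getElem?_eq_some_iff.1 h2'
    exact hij ((hnd r).getElem_inj_iff.1 (h2.trans h2'.symm))
  · intro y s b h
    obtain ⟨hs, rfl⟩ := (ts _ _ _).1 h
    have : {s' | ∃ (i : ℕ) (b' : B), t (y ++ [i]) = some (s', b')} = T s := by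
      ext s'
      rw [← child y s hs s']
      constructor
      · rintro ⟨i, b', h⟩
        exact ⟨i, ((ts _ _ _).1 h).1⟩
      · rintro ⟨i, h⟩
        exact ⟨i, _, (ts _ _ _).2 ⟨h, rfl⟩⟩
    rw [this]
    exact hT s (inv y s hs)
  · intro π hπ
    have hm : ∀ k, ∃ s, st (π k) = some s := fun k => (tn _).1 (hπ.mem k)
    choose σ hσ using hm
    have hr : {s | ∃ (k : ℕ) (b : B), t (π k) = some (s, b)} = Set.range σ := by
      ext s
      constructor
      · rintro ⟨k, b, h⟩
        exact ⟨k, Option.some_injective _ ((hσ k).symm.trans ((ts _ _ _).1 h).1)⟩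
      · rintro ⟨k, rfl⟩
        exact ⟨k, _, (ts _ _ _).2 ⟨hσ k, rfl⟩⟩
    rw [hr]
    refine hacc σ ?_ (fun k => inv _ _ (hσ k)) fun k => ?_
    · have := hσ 0
      rw [hπ.root, st0] at this
      exact (Option.some_injective _ this).symm
    · obtain ⟨l, hl⟩ := hπ.succ k
      rw [← child _ _ (hσ k)]
      exact ⟨l, hl ▸ hσ (k + 1)⟩

/-- Every accepting run has a path all states of which satisfy a property that can be
propagated. -/
theorem IsAcceptingRun.exists_acc {𝒜 : TreeAutomaton S B} {t : List ℕ → Option (S × B)}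
    (h : 𝒜.IsAcceptingRun t) (Q : S → Prop) (hroot : ∀ s ∈ 𝒜.init, Q s)
    (hstep : ∀ s b T, (s, b, T) ∈ 𝒜.delta → Q s → ∃ s' ∈ T, Q s') :
    ∃ R ∈ 𝒜.acc, ∀ s ∈ R, Q s := by
  have next : ∀ y : List ℕ, (∃ s b, t y = some (s, b) ∧ Q s) →
      ∃ l : ℕ, ∃ s b, t (y ++ [l]) = some (s, b) ∧ Q s := by
    rintro y ⟨s, b, hy, hq⟩
    obtain ⟨s', ⟨i, b', h1⟩, h2⟩ := hstep _ _ _ (h.step y s b hy) hq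
    exact ⟨i, s', b', h1, h2⟩
  choose! nx hnx using next
  let π : ℕ → List ℕ := fun k => Nat.rec [] (fun _ y => y ++ [nx y]) k
  have hπ : ∀ k, ∃ s b, t (π k) = some (s, b) ∧ Q s := by
    intro k
    induction k with
    | zero =>
      obtain ⟨⟨s, b⟩, hsb⟩ := Option.ne_none_iff_exists'.1 h.tree.root
      exact ⟨s, b, hsb, hroot s (h.root s b hsb)⟩
    | succ k ih => exact hnx _ ih
  refine ⟨_, h.accept π ⟨rfl, fun k => ⟨_, rfl⟩, fun k => ?_⟩, ?_⟩
  · obtain ⟨s, b, h1, -⟩ := hπ k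
    simp [h1]
  · rintro s ⟨k, b, hk⟩
    obtain ⟨s', b', h1, h2⟩ := hπ k
    have := Option.some_injective _ (h1.symm.trans hk)
    cases this
    exact h2

/-- Every state of a run occurs on an initialized path. -/
theorem IsAcceptingRun.exists_acc_mem {𝒜 : TreeAutomaton S B} {t : List ℕ → Option (S × B)}
    (h : 𝒜.IsAcceptingRun t) {y : List ℕ} {s : S} {b : B} (hy : t y = some (s, b)) :
    ∃ R ∈ 𝒜.acc, s ∈ R := by
  -- Descend to `y` and then take the child `0` forever.
  let π : ℕ → List ℕ := fun k => y.take k ++ List.replicate (k - y.length) 0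
  have hm : ∀ k, t (y ++ List.replicate k 0) ≠ none := by
    intro k
    induction k with
    | zero => simp [hy]
    | succ k ih =>
      rw [List.replicate_succ', ← List.append_assoc]
      exact h.tree.infinite _ ih
  refine ⟨_, h.accept π ⟨by simp [π], fun k => ?_, fun k => ?_⟩, y.length, b, by simpa [π] using hy⟩
  · rcases lt_or_ge k y.length with hk | hk
    · refine ⟨y[k], ?_⟩
      have h1 : k - y.length = 0 := by omega
      have h2 : k + 1 - y.length = 0 := by omega
      simp [π, h1, h2]
    · refine ⟨0, ?_⟩
      have h2 : k + 1 - y.length = k - y.length + 1 := by omega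
      simp only [π, h2, List.replicate_succ', ← List.append_assoc]
      rw [List.take_of_length_le hk, List.take_of_length_le (by omega)]
  · rcases lt_or_ge k y.length with hk | hk
    · have h1 : k - y.length = 0 := by omega
      simp only [π, h1, List.replicate_zero, List.append_nil]
      exact h.tree.prefix_closed _ y ⟨y.drop k, List.take_append_drop k y⟩ (by simp [hy])
    · simp only [π, List.take_of_length_le hk]
      exact hm _

end TreeAutomaton

/-! ### Non-emptiness of the automata as winning in the games. -/

namespace Arena

section

variable {Ag : Type u} {Act : Ag → Type v} {P : Type w} {Γ : Arena.{u, v, w, x} Ag Act P}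
  {A : Finset Ag} {p₁ p₂ : P}

/-- The split arena drops out: `(r, R₂)` with `r ∈ R₁` is one of its states, and each transition
from `r` lifts to it. -/
theorem fails_iff (R : Γ.ObligationPair A p₁ p₂) (cA : CoalAct Act A) :
    Γ.Fails A p₁ p₂ R cA ↔ ∃ r ∈ R.1.1, ∃ c, restr A c = cA ∧ ∃ r' ∈ Γ.trans r c,
      p₁ ∉ Γ.label r' ∧ p₂ ∉ Γ.label r' := by
  constructor
  · rintro ⟨r, hr, y, z, c, hy, hz, hc, h⟩
    refine ⟨r, hr, c, hc, z.1.1, ?_, h⟩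
    have := hz.1
    rwa [hy] at this
  · rintro ⟨r, hr, c, hc, r', hr', h⟩
    exact ⟨r, hr, ⟨(r, R.1.2), R.2.1 hr, fun s hs => R.2.2.1 _ hs _ (R.2.1 hr)⟩,
      ⟨(r', Γ.out A R.1.2 (restr A c) (Γ.view A r')), ⟨⟨r, R.2.1 hr, c, rfl, hr'⟩, rfl⟩,
        fun s hs => hs.2⟩, c, rfl, ⟨hr', rfl⟩, hc, h⟩

/-- Failure is exactly what could put a state without `p₁` and `p₂` into the new obligation set. -/
theorem exists_succ_pair {R : Γ.ObligationPair A p₁ p₂} {cA : CoalAct Act A}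
    (h : ¬ Γ.Fails A p₁ p₂ R cA) (Z : Set (Γ.propOf A)) : ∃ R' : Γ.ObligationPair A p₁ p₂,
      R'.1 = (Γ.out A R.1.1 cA Z \ {q | p₂ ∈ Γ.label q}, Γ.out A R.1.2 cA Z) := by
  refine ⟨⟨_, ?_, ?_, ?_⟩, rfl⟩
  · rintro r ⟨⟨⟨s, hs, h1⟩, h2⟩, -⟩
    exact ⟨⟨s, R.2.1 hs, h1⟩, h2⟩
  · exact fun r hr s hs => hr.2.trans hs.2.symm
  · rintro r ⟨⟨⟨s, hs, c, hc, hr⟩, -⟩, h2⟩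
    refine ⟨h2, ?_⟩
    by_contra h1
    exact h ((fails_iff R cA).2 ⟨s, hs, c, hc, r, hr, h1, h2⟩)

/-- A losing pair has a losing successor. -/
theorem exists_losing_succ {W : Set (Set Γ.State)} {R : Γ.ObligationPair A p₁ p₂}
    {cA : CoalAct Act A} {T : Set (Γ.AutState A p₁ p₂)} (hT : T = Γ.autSucc A p₁ p₂ (some R) cA)
    (hR : ¬ Γ.SafeStep A {q | p₁ ∈ Γ.label q} {q | p₂ ∈ Γ.label q} W R.1.1 cA) :
    none ∈ T ∨ ∃ R' : Γ.ObligationPair A p₁ p₂, some R' ∈ T ∧ R'.1.1 ∉ W := by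
  subst hT
  by_cases hf : Γ.Fails A p₁ p₂ R cA
  · exact Or.inl (Or.inl ⟨hf, rfl⟩)
  · right
    unfold SafeStep at hR
    push Not at hR
    obtain ⟨r, hr, c, hc, r', hr', h⟩ := hR
    have hgood : r' ∈ {q | p₁ ∈ Γ.label q} ∨ r' ∈ {q | p₂ ∈ Γ.label q} := by
      by_contra! hcon
      exact hf ((fails_iff R cA).2 ⟨r, hr, c, hc, r', hr', hcon⟩)
    obtain ⟨R', hR'⟩ := exists_succ_pair hf (Γ.view A r')
    refine ⟨R', Or.inr ⟨hf, Γ.view A r', R', ⟨r', ⟨r, R.2.1 hr, c, hc, hr'⟩, rfl⟩, rfl, hR'⟩, ?_⟩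
    rw [hR']
    exact h hgood

/-- Call a state losing if it is `⊥` or its obligation set is not winning. Being losing passes to
some child, so a losing root would yield a path of losing states; acceptance puts some `(∅, R)` on
it, but `∅` is winning. -/
theorem winUntil_of_nonemptyLanguage [∀ a, Nonempty (Act a)] (qS : Γ.HatState A)
    (h : (Γ.untilAut A p₁ p₂ qS).NonemptyLanguage) :
    (∀ s ∈ qS.1.2, s ∈ {q | p₁ ∈ Γ.label q} ∨ s ∈ {q | p₂ ∈ Γ.label q}) ∧
      qS.1.2 \ {q | p₂ ∈ Γ.label q} ∈
        Γ.winUntil A {q | p₁ ∈ Γ.label q} {q | p₂ ∈ Γ.label q} := by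
  obtain ⟨t, ht⟩ := h
  by_contra hcon
  obtain ⟨𝓡, ⟨R, hR, hRm⟩, hQ⟩ := ht.exists_acc (fun s => ∀ R, s = some R →
      R.1.1 ∉ Γ.winUntil A {q | p₁ ∈ Γ.label q} {q | p₂ ∈ Γ.label q}) (by
    rintro _ (⟨-, rfl⟩ | ⟨h1, R, rfl, hR⟩) R' h
    · cases h
    · cases h
      refine fun h2 => hcon ⟨fun s hs => ?_, ?_⟩
      · by_contra! h3
        exact h1 ⟨s, hs, h3⟩
      · rwa [hR] at h2) (by
    rintro s cA T ⟨-, hT⟩ hQ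
    cases s with
    | none =>
      refine ⟨none, ?_, fun R h => by cases h⟩
      change T = {none} at hT
      rw [hT]
      rfl
    | some R =>
      have h1 := hQ R rfl
      rw [← winUntil_eq] at h1
      rcases exists_losing_succ hT (fun h => h1 ⟨cA, h⟩) with h | ⟨R', h, h'⟩
      · exact ⟨none, h, fun R h => by cases h⟩
      · refine ⟨some R', h, fun R h => ?_⟩
        cases h
        exact h')
  exact hQ _ hRm R rfl (hR ▸ Γ.empty_mem_winUntil A _ _)

/-- Every node lies on an initialized path, so `⊥` occurs nowhere in the run. The obligation sets
occurring in the tree then form a post-fixed point, with the letters as witnesses. -/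
theorem winWeak_of_nonemptyLanguage (qS : Γ.HatState A)
    (h : (Γ.wuntilAut A p₁ p₂ qS).NonemptyLanguage) :
    (∀ s ∈ qS.1.2, s ∈ {q | p₁ ∈ Γ.label q} ∨ s ∈ {q | p₂ ∈ Γ.label q}) ∧
      qS.1.2 \ {q | p₂ ∈ Γ.label q} ∈
        Γ.winWeak A {q | p₁ ∈ Γ.label q} {q | p₂ ∈ Γ.label q} := by
  obtain ⟨t, ht⟩ := h
  have hnone : ∀ y b, t y ≠ some (none, b) := by
    intro y b hy
    obtain ⟨R, hR, hm⟩ := ht.exists_acc_mem hy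
    exact hR hm
  obtain ⟨⟨s, b⟩, hsb⟩ := Option.ne_none_iff_exists'.1 ht.tree.root
  rcases ht.root s b hsb with ⟨-, rfl⟩ | ⟨h1, R, rfl, hR⟩
  · exact absurd hsb (hnone _ _)
  · refine ⟨fun s hs => ?_, ?_⟩
    · by_contra! h3
      exact h1 ⟨s, hs, h3⟩
    · have : {R₁ | ∃ (y : List ℕ) (R : Γ.ObligationPair A p₁ p₂) (b : CoalAct Act A),
          t y = some (some R, b) ∧ R.1.1 = R₁} ≤
            Γ.winWeak A {q | p₁ ∈ Γ.label q} {q | p₂ ∈ Γ.label q} := by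
        refine OrderHom.le_gfp _ ?_
        rintro _ ⟨y, R, cA, hy, rfl⟩
        refine ⟨cA, ?_⟩
        by_contra hcon
        rcases exists_losing_succ (ht.step _ _ _ hy).2 hcon with
          ⟨i, b', h⟩ | ⟨R', ⟨i, b', h⟩, h'⟩
        · exact hnone _ _ h
        · exact h' ⟨_, R', b', h, rfl⟩
      exact this ⟨[], R, b, hsb, by rw [hR]⟩

/-- Winning positional strategies of the game on sets give accepting runs. -/
theorem nonemptyLanguage_of_safe [Finite Γ.State] [∀ a, Nonempty (Act a)] (qS : Γ.HatState A)
    (𝒜 : TreeAutomaton (Γ.AutState A p₁ p₂) (CoalAct Act A))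
    (hinit : 𝒜.init = Γ.autInit A p₁ p₂ qS) (hdelta : 𝒜.delta = Γ.autDelta A p₁ p₂)
    (f : Set Γ.State → CoalAct Act A) (W : Set (Set Γ.State))
    (rel : Set Γ.State → Set Γ.State → Prop) (hW : ∅ ∈ W)
    (hf : ∀ R ∈ W, R.Nonempty → Γ.SafeStep A {q | p₁ ∈ Γ.label q} {q | p₂ ∈ Γ.label q}
      {R' | R' ∈ W ∧ rel R' R} R (f R))
    (h0 : ∀ s ∈ qS.1.2, s ∈ {q | p₁ ∈ Γ.label q} ∨ s ∈ {q | p₂ ∈ Γ.label q})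
    (h1 : qS.1.2 \ {q | p₂ ∈ Γ.label q} ∈ W)
    (hacc : ∀ R : ℕ → Γ.ObligationPair A p₁ p₂,
      (∀ k, (R (k + 1)).1.1.Nonempty → rel (R (k + 1)).1.1 (R k).1.1) →
        Set.range (fun k => some (R k)) ∈ 𝒜.acc) :
    𝒜.NonemptyLanguage := by
  let f' : Γ.AutState A p₁ p₂ → CoalAct Act A := fun s =>
    s.elim (fun _ => Classical.arbitrary _) fun R => f R.1.1
  have hnf : ∀ R : Γ.ObligationPair A p₁ p₂, R.1.1 ∈ W → ¬ Γ.Fails A p₁ p₂ R (f R.1.1) := by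
    intro R hR hF
    obtain ⟨r, hr, c, hc, r', hr', h2, h3⟩ := (fails_iff R _).1 hF
    rcases (hf _ hR ⟨r, hr⟩ r hr c hc r' hr').1 with h | h
    · exact h2 h
    · exact h3 h
  have hsucc : ∀ R : Γ.ObligationPair A p₁ p₂, R.1.1 ∈ W → ∀ s ∈ Γ.autSucc A p₁ p₂ (some R)
      (f R.1.1), ∃ R' : Γ.ObligationPair A p₁ p₂, s = some R' ∧ R'.1.2.Nonempty ∧ R'.1.1 ∈ W ∧
        (R'.1.1.Nonempty → rel R'.1.1 R.1.1) := by
    rintro R hR s (⟨h, -⟩ | ⟨-, Z, R', hne, rfl, hR'⟩)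
    · exact absurd h (hnf R hR)
    · refine ⟨R', rfl, by rwa [hR'], ?_⟩
      -- A view may be reachable from `R₂` but leave nothing pending. `SafeStep` is silent on views
      -- that no successor of `R₁` shows, which is why `∅ ∈ W` is assumed.
      rcases Set.eq_empty_or_nonempty R'.1.1 with h | h
      · exact ⟨h ▸ hW, fun h' => absurd h h'.ne_empty⟩
      · obtain ⟨r', hr'⟩ := h
        rw [hR'] at hr' ⊢
        obtain ⟨⟨⟨r, hr, c, hc, htr⟩, rfl⟩, -⟩ := hr'
        have := (hf _ hR ⟨r, hr⟩ r hr c hc r' htr).2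
        exact ⟨this.1, fun _ => this.2⟩
  have hok : ∀ s ∈ qS.1.2 \ {q | p₂ ∈ Γ.label q}, p₂ ∉ Γ.label s ∧ p₁ ∈ Γ.label s :=
    fun s hs => ⟨hs.2, (h0 s hs.1).resolve_right hs.2⟩
  let R₀ : Γ.ObligationPair A p₁ p₂ := ⟨(qS.1.2 \ {q | p₂ ∈ Γ.label q}, qS.1.2),
    Set.sdiff_subset, fun r hr s hs => (qS.2.2 r hr).trans (qS.2.2 s hs).symm, hok⟩
  -- Non-emptiness of the second component belongs to the invariant: by totality it guarantees that
  -- the successor set in the automaton is non-empty.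
  refine 𝒜.nonemptyLanguage_of_positional f' (fun s => Γ.autSucc A p₁ p₂ s (f' s))
    {s | ∃ R : Γ.ObligationPair A p₁ p₂, s = some R ∧ R.1.2.Nonempty ∧ R.1.1 ∈ W} (some R₀)
    ⟨R₀, rfl, ⟨qS.1.1, qS.2.1⟩, h1⟩ ?_ ?_ ?_ ?_
  · rw [hinit]
    refine Or.inr ⟨?_, R₀, rfl, rfl⟩
    rintro ⟨q, hq, h2, h3⟩
    rcases h0 q hq with h | h
    · exact h2 h
    · exact h3 h
  · rintro _ ⟨R, rfl, ⟨r, hr⟩, hR⟩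
    rw [hdelta]
    refine ⟨?_, rfl⟩
    obtain ⟨c, hc⟩ := exists_restr_eq (Act := Act) A (f R.1.1)
    obtain ⟨r', hr'⟩ := Γ.trans_nonempty r c
    obtain ⟨R', hR'⟩ := exists_succ_pair (hnf R hR) (Γ.view A r')
    exact ⟨some R', Or.inr ⟨hnf R hR, Γ.view A r', R', ⟨r', ⟨r, hr, c, hc, hr'⟩, rfl⟩, rfl, hR'⟩⟩
  · rintro _ ⟨R, rfl, -, hR⟩ s hs
    obtain ⟨R', h2, h3, h4, -⟩ := hsucc R hR s hs
    exact ⟨R', h2, h3, h4⟩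
  · intro σ _ hσ hst
    choose R hR hne hRW using hσ
    obtain rfl : σ = fun k => some (R k) := funext hR
    refine hacc R fun k => ?_
    obtain ⟨R', h2, -, -, h5⟩ := hsucc (R k) (hRW k) _ (hst k)
    cases h2
    exact h5

/-- In the unfolding of the rank-decreasing strategy, a path without any `(∅, R)` would have
obligation sets of ever smaller rank. -/
theorem nonemptyLanguage_untilAut_iff [Finite Γ.State] [∀ a, Nonempty (Act a)]
    (qS : Γ.HatState A) : (Γ.untilAut A p₁ p₂ qS).NonemptyLanguage ↔
      (∀ s ∈ qS.1.2, s ∈ {q | p₁ ∈ Γ.label q} ∨ s ∈ {q | p₂ ∈ Γ.label q}) ∧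
        qS.1.2 \ {q | p₂ ∈ Γ.label q} ∈
          Γ.winUntil A {q | p₁ ∈ Γ.label q} {q | p₂ ∈ Γ.label q} := by
  refine ⟨winUntil_of_nonemptyLanguage qS, fun ⟨h0, h1⟩ => ?_⟩
  obtain ⟨f, rk, hf⟩ := Γ.exists_positional_until A {q | p₁ ∈ Γ.label q} {q | p₂ ∈ Γ.label q}
  refine nonemptyLanguage_of_safe qS _ rfl rfl f _ _ (Γ.empty_mem_winUntil A _ _) hf h0 h1
    fun R hR => ?_
  by_contra hcon
  have hne : ∀ k, (R k).1.1.Nonempty := by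
    intro k
    rw [Set.nonempty_iff_ne_empty]
    exact fun h => hcon ⟨R k, h, k, rfl⟩
  exact not_strictAnti_of_wellFoundedLT (fun k => rk (R k).1.1)
    (strictAnti_nat_of_succ_lt fun k => hR k (hne _) (hne _))

theorem nonemptyLanguage_wuntilAut_iff [Finite Γ.State] [∀ a, Nonempty (Act a)]
    (qS : Γ.HatState A) : (Γ.wuntilAut A p₁ p₂ qS).NonemptyLanguage ↔
      (∀ s ∈ qS.1.2, s ∈ {q | p₁ ∈ Γ.label q} ∨ s ∈ {q | p₂ ∈ Γ.label q}) ∧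
        qS.1.2 \ {q | p₂ ∈ Γ.label q} ∈
          Γ.winWeak A {q | p₁ ∈ Γ.label q} {q | p₂ ∈ Γ.label q} := by
  refine ⟨winWeak_of_nonemptyLanguage qS, fun ⟨h0, h1⟩ => ?_⟩
  obtain ⟨f, hf⟩ := Γ.exists_positional_weak A {q | p₁ ∈ Γ.label q} {q | p₂ ∈ Γ.label q}
  refine nonemptyLanguage_of_safe qS _ rfl rfl f _ (fun _ _ => True)
    (Γ.empty_mem_winWeak A _ _) (fun R hR _ => (hf R hR).mono fun R' h => ⟨h, trivial⟩) h0 h1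
    fun R _ => ?_
  rintro ⟨k, hk⟩
  cases hk

end

end Arena

/-! ### Subformulas and immediate subformulas. -/

namespace Formula

variable {Ag : Type u} {P : Type w}

theorem mem_subformulas_self (φ : Formula Ag P) : φ ∈ φ.subformulas := by
  cases φ <;> simp [subformulas]

theorem subformulas_trans {χ ψ φ : Formula Ag P} (h : χ ∈ ψ.subformulas)
    (h' : ψ ∈ φ.subformulas) : χ ∈ φ.subformulas := by
  induction φ with
  | atom p =>
    obtain rfl : ψ = atom p := h'
    exact h
  | conj φ₁ φ₂ ih₁ ih₂ =>
    rcases h' with h' | h' | h'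
    · obtain rfl : ψ = _ := h'
      exact h
    · exact Or.inr (Or.inl (ih₁ h'))
    · exact Or.inr (Or.inr (ih₂ h'))
  | neg φ ih =>
    rcases h' with h' | h'
    · obtain rfl : ψ = _ := h'
      exact h
    · exact Or.inr (ih h')
  | nxt A φ ih =>
    rcases h' with h' | h'
    · obtain rfl : ψ = _ := h'
      exact h
    · exact Or.inr (ih h')
  | untl A φ₁ φ₂ ih₁ ih₂ =>
    rcases h' with h' | h' | h'
    · obtain rfl : ψ = _ := h'
      exact h
    · exact Or.inr (Or.inl (ih₁ h'))
    · exact Or.inr (Or.inr (ih₂ h'))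
  | wuntl A φ₁ φ₂ ih₁ ih₂ =>
    rcases h' with h' | h' | h'
    · obtain rfl : ψ = _ := h'
      exact h
    · exact Or.inr (Or.inl (ih₁ h'))
    · exact Or.inr (Or.inr (ih₂ h'))
  | know A φ ih =>
    rcases h' with h' | h'
    · obtain rfl : ψ = _ := h'
      exact h
    · exact Or.inr (ih h')

/-- The immediate subformulas. -/
def children : Formula Ag P → Set (Formula Ag P)
  | .atom _ => ∅
  | .conj φ ψ => {φ, ψ}
  | .neg φ => {φ}
  | .nxt _ φ => {φ}
  | .untl _ φ ψ => {φ, ψ}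
  | .wuntl _ φ ψ => {φ, ψ}
  | .know _ φ => {φ}

theorem mem_subformulas_of_mem_children {χ ψ : Formula Ag P} (h : χ ∈ ψ.children) :
    χ ∈ ψ.subformulas := by
  cases ψ <;> simp only [children, Set.mem_empty_iff_false, Set.mem_insert_iff,
    Set.mem_singleton_iff] at h
  all_goals rcases h with rfl | rfl <;> simp [subformulas, mem_subformulas_self]

/-- Needed because the order of the enumeration constrains only distinct entries; a comparison of
sizes suffices. -/
theorem ne_of_mem_children {χ ψ : Formula Ag P} (h : χ ∈ ψ.children) : χ ≠ ψ := by
  intro he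
  have hs := congrArg sizeOf he
  cases ψ <;> simp only [children, Set.mem_empty_iff_false, Set.mem_insert_iff,
    Set.mem_singleton_iff] at h
  all_goals rcases h with rfl | rfl <;> simp at hs <;> omega

end Formula

/-! ### Correctness of the labelling algorithm. -/

namespace Arena

section

variable {Ag : Type u} {Act : Ag → Type v} {P : Type w}

/-- The fresh propositions `p_ψ` with `ψ ∈ D` have been added, correctly, to the labels of the
cover `Δ` of `Γ`. -/
structure Labelled {Γ : Arena.{u, v, w, x} Ag Act P}
    {Δ : Arena.{u, v, max u w, x} Ag Act (P ⊕ Formula Ag P)} (C : Cover Γ Δ)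
    (D : Set (Formula Ag P)) : Prop where
  finite : Finite Δ.State
  obs : ∀ a ψ, Sum.inr ψ ∉ Δ.obs a
  label : ∀ p y, Sum.inl p ∈ Δ.label y ↔ p ∈ Γ.label (C.proj y)
  represents : ∀ ψ ∈ D, Represents C {y | Sum.inr ψ ∈ Δ.label y} ψ
  fresh : ∀ ψ ∉ D, ∀ y, Sum.inr ψ ∉ Δ.label y

theorem nextSet_eq (Δ : Arena.{u, v, w, x} Ag Act P) (A : Finset Ag) (p : P) :
    Δ.nextSet A p = {y : Δ.HatState A | ∃ cA : CoalAct Act A,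
      ∀ r ∈ y.1.2, ∀ c, restr A c = cA → ∀ r' ∈ Δ.trans r c, r' ∈ {q | p ∈ Δ.label q}} := by
  ext y
  change Δ.HatState A at y
  refine exists_congr fun cA => ⟨fun h r hr c hc r' hr' => ?_, fun h y' z c hy hz hc => ?_⟩
  · exact h ⟨(r, y.1.2), hr, fun s hs => (y.2.2 s hs).trans (y.2.2 r hr).symm⟩
      ⟨(r', Δ.out A y.1.2 (restr A c) (Δ.view A r')), ⟨⟨r, hr, c, rfl, hr'⟩, rfl⟩,
        fun s hs => hs.2⟩ c rfl ⟨hr', rfl⟩ hc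
  · exact h y'.1.1 (hy ▸ y'.2.1) c hc z.1.1 hz.1

namespace Labelled

variable {Γ : Arena.{u, v, w, x} Ag Act P}
  {Δ : Arena.{u, v, max u w, x} Ag Act (P ⊕ Formula Ag P)} {C : Cover Γ Δ}
  {D : Set (Formula Ag P)} {ψ : Formula Ag P}

theorem extend (Γ : Arena.{u, v, w, x} Ag Act P) [h : Finite Γ.State] :
    Labelled (Cover.extend Γ) ∅ where
  finite := h
  obs := by
    rintro a ψ ⟨p, -, h⟩
    cases h
  label p y := Sum.inl_injective.mem_set_image
  represents ψ h := absurd h (Set.notMem_empty ψ)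
  fresh := by
    rintro ψ - y ⟨p, -, h⟩
    cases h

theorem hat (h : Labelled C D) (A : Finset Ag) : Labelled (C.comp (Cover.hat Δ A)) D where
  finite := by
    have := h.finite
    exact inferInstanceAs (Finite (Δ.HatState A))
  obs := h.obs
  label p y := h.label p ((Cover.hat Δ A).proj y)
  represents ψ hψ := (h.represents ψ hψ).pullback (Cover.hat Δ A)
  fresh ψ hψ y := h.fresh ψ hψ ((Cover.hat Δ A).proj y)

/-- Since `ψ` is fresh, its proposition ends up exactly on `X`; the other labels do not change, and
the views are untouched because nobody observes the new proposition. -/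
theorem mark (h : Labelled C D) (hψ : ψ ∉ D) {X : Set Δ.State} (hX : Represents C X ψ) :
    Labelled (C.comp (Cover.mark Δ (.inr ψ) X fun a => h.obs a ψ)) (insert ψ D) where
  finite := h.finite
  obs := h.obs
  label p y := by
    refine Iff.trans ?_ (h.label p y)
    exact or_iff_left fun h => by cases h.1
  represents χ hχ ρ i := by
    have key : ∀ y : Δ.State, (Sum.inr χ ∈ (Δ.mark (.inr ψ) X).label y ↔
        Sum.inr χ ∈ Δ.label y ∨ (χ = ψ ∧ y ∈ X)) := fun y =>
      or_congr Iff.rfl (and_congr Sum.inr_injective.eq_iff Iff.rfl)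
    refine (key _).trans ?_
    by_cases he : χ = ψ
    · subst he
      refine ((or_iff_right (h.fresh χ hψ _)).trans (and_iff_right rfl)).trans ?_
      exact hX ((Cover.mark Δ (.inr χ) X fun a => h.obs a χ).map ρ) i
    · refine (or_iff_left fun h => he h.1).trans ?_
      exact h.represents χ (hχ.resolve_left he)
        ((Cover.mark Δ (.inr ψ) X fun a => h.obs a ψ).map ρ) i
  fresh χ hχ y := by
    rintro (h' | h')
    · exact h.fresh χ (fun h => hχ (Or.inr h)) y h'
    · exact hχ (Or.inl (Sum.inr_injective h'.1))

theorem algStep [∀ a, Nonempty (Act a)] (h : Labelled C D) (hψ : ψ ∉ D)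
    (hch : ψ.children ⊆ D) : ∃ C' : Cover Γ (Δ.algStep ψ), Labelled C' (insert ψ D) := by
  have := h.finite
  cases ψ with
  | atom p =>
    refine ⟨_, h.mark hψ (X := {q | .inl p ∈ Δ.label q}) ?_⟩
    have : {q | .inl p ∈ Δ.label q} = {y | p ∈ Γ.label (C.proj y)} :=
      Set.ext fun y => h.label p y
    rw [this]
    exact Represents.atom C p
  | conj φ₁ φ₂ =>
    exact ⟨_, h.mark hψ (Represents.conj (h.represents _ (hch (Or.inl rfl)))
      (h.represents _ (hch (Or.inr rfl))))⟩
  | neg φ => exact ⟨_, h.mark hψ (Represents.neg (h.represents _ (hch rfl)))⟩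
  | know A φ => exact ⟨_, (h.hat A).mark hψ (Represents.know (h.represents _ (hch rfl)) A)⟩
  | nxt A φ =>
    refine ⟨_, (h.hat A).mark hψ (X := Δ.nextSet A (.inr φ)) ?_⟩
    rw [nextSet_eq]
    exact Represents.nxt (h.represents _ (hch rfl)) A
  | untl A φ₁ φ₂ =>
    refine ⟨_, (h.hat A).mark hψ (X := {y : Δ.HatState A |
      (Δ.untilAut A (.inr φ₁) (.inr φ₂) y).NonemptyLanguage}) ?_⟩
    simp only [nonemptyLanguage_untilAut_iff]
    exact Represents.untl (h.represents _ (hch (Or.inl rfl)))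
      (h.represents _ (hch (Or.inr rfl))) A
  | wuntl A φ₁ φ₂ =>
    refine ⟨_, (h.hat A).mark hψ (X := {y : Δ.HatState A |
      (Δ.wuntilAut A (.inr φ₁) (.inr φ₂) y).NonemptyLanguage}) ?_⟩
    simp only [nonemptyLanguage_wuntilAut_iff]
    exact Represents.wuntl (h.represents _ (hch (Or.inl rfl)))
      (h.represents _ (hch (Or.inr rfl))) A

/-- A child of the head is in `D` or in the list by closure. It is not the head, and the order
forbids it in the tail, so its label is already in place when the head is processed. -/
theorem foldl [∀ a, Nonempty (Act a)] (L : List (Formula Ag P)) (h : Labelled C D)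
    (hnd : L.Nodup) (hD : ∀ ψ ∈ L, ψ ∉ D) (hord : L.Pairwise fun ψ χ => χ ∉ ψ.subformulas)
    (hcl : ∀ ψ ∈ L, ∀ χ ∈ ψ.subformulas, χ ∈ D ∨ χ ∈ L) :
    ∃ C' : Cover Γ (L.foldl Arena.algStep Δ), Labelled C' (D ∪ {ψ | ψ ∈ L}) := by
  induction L generalizing Δ D with
  | nil => exact ⟨C, by simpa using h⟩
  | cons ψ L ih =>
    rw [List.nodup_cons] at hnd
    rw [List.pairwise_cons] at hord
    obtain ⟨C', h'⟩ := h.algStep (hD ψ List.mem_cons_self) fun χ hχ => by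
      have hs := Formula.mem_subformulas_of_mem_children hχ
      rcases hcl ψ List.mem_cons_self χ hs with h1 | h1
      · exact h1
      · rcases List.mem_cons.1 h1 with h1 | h1
        · exact absurd h1 (Formula.ne_of_mem_children hχ)
        · exact absurd hs (hord.1 χ h1)
    obtain ⟨C'', h''⟩ := ih h' hnd.2 (fun χ hχ => by
      rintro (rfl | h1)
      · exact hnd.1 hχ
      · exact hD χ (List.mem_cons_of_mem _ hχ) h1) hord.2 fun χ hχ ξ hξ => by
      rcases hcl χ (List.mem_cons_of_mem _ hχ) ξ hξ with h1 | h1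
      · exact Or.inl (Or.inr h1)
      · rcases List.mem_cons.1 h1 with h1 | h1
        · exact Or.inl (Or.inl h1)
        · exact Or.inr h1
    refine ⟨C'', ?_⟩
    have : D ∪ {χ | χ ∈ ψ :: L} = insert ψ D ∪ {χ | χ ∈ L} := by
      ext χ
      simp only [Set.mem_union, Set.mem_ofPred_eq, List.mem_cons, Set.mem_insert_iff]
      tauto
    rw [this]
    exact h''

end Labelled

theorem algResult_correct [∀ a, Nonempty (Act a)] (Γ : Arena.{u, v, w, x} Ag Act P)
    [Finite Γ.State] (φ : Formula Ag P) (L : List (Formula Ag P)) (hL : IsSubformulaEnum φ L) :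
    (∀ q ∈ (Γ.algResult L).init, Sum.inr φ ∈ (Γ.algResult L).label q) ↔
      ∀ ρ : Γ.Run, Γ.Sat φ ρ 0 := by
  obtain ⟨C, h⟩ := (Labelled.extend Γ).foldl L hL.nodup (fun ψ _ => Set.notMem_empty ψ) hL.ordered
    fun ψ hψ χ hχ => Or.inr ((hL.mem_iff χ).2
      (Formula.subformulas_trans hχ ((hL.mem_iff ψ).1 hψ)))
  exact (h.represents φ
    (Or.inr ((hL.mem_iff φ).2 φ.mem_subformulas_self))).forall_init_iff

end

end Arena

namespace ModelChecker

/-! ### Primitive recursive list programs -/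

section

variable {α β γ σ : Type} [Primcodable α] [Primcodable β] [Primcodable γ] [Primcodable σ]

attribute [fun_prop] Primrec

@[fun_prop] theorem primrec_const (x : β) : Primrec fun _ : α => x := Primrec.const x

@[fun_prop] theorem primrec_id : Primrec fun a : α => a := Primrec.id

@[fun_prop] theorem primrec_comp {f : β → σ} {g : α → β} (hf : Primrec f) (hg : Primrec g) :
    Primrec fun a => f (g a) := hf.comp hg

@[fun_prop] theorem primrec_mk {f : α → β} {g : α → γ} (hf : Primrec f) (hg : Primrec g) :
    Primrec fun a => (f a, g a) := hf.pair hg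

@[fun_prop] theorem primrec_fst {f : α → β × γ} (hf : Primrec f) : Primrec fun a => (f a).1 :=
  Primrec.fst.comp hf

@[fun_prop] theorem primrec_snd {f : α → β × γ} (hf : Primrec f) : Primrec fun a => (f a).2 :=
  Primrec.snd.comp hf

-- Function arguments of list combinators must be primitive recursive jointly in the parameter and
-- the list element; this form lets nested programs be treated one combinator at a time.
@[fun_prop] theorem primrec_map {f : α → List β} {g : α → β → γ} (hf : Primrec f)
    (hg : Primrec fun z : α × β => g z.1 z.2) : Primrec fun a => (f a).map (g a) :=
  Primrec.list_map hf hg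

@[fun_prop] theorem primrec_flatMap {f : α → List β} {g : α → β → List γ} (hf : Primrec f)
    (hg : Primrec fun z : α × β => g z.1 z.2) : Primrec fun a => (f a).flatMap (g a) :=
  Primrec.list_flatMap hf hg

@[fun_prop] theorem primrec_foldl {f : α → List β} {g : α → σ} {h : α → σ → β → σ}
    (hf : Primrec f) (hg : Primrec g) (hh : Primrec fun z : α × σ × β => h z.1 z.2.1 z.2.2) :
    Primrec fun a => (f a).foldl (h a) (g a) :=
  Primrec.list_foldl (h := fun a z => h a z.1 z.2) hf hg hh

@[fun_prop] theorem primrec_foldr {f : α → List β} {g : α → σ} {h : α → β → σ → σ}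
    (hf : Primrec f) (hg : Primrec g) (hh : Primrec fun z : α × β × σ => h z.1 z.2.1 z.2.2) :
    Primrec fun a => (f a).foldr (h a) (g a) :=
  Primrec.list_foldr (h := fun a z => h a z.1 z.2) hf hg hh

@[fun_prop] theorem primrec_cons {f : α → β} {g : α → List β} (hf : Primrec f)
    (hg : Primrec g) : Primrec fun a => f a :: g a := Primrec.list_cons.comp hf hg

@[fun_prop] theorem primrec_append {f g : α → List β} (hf : Primrec f)
    (hg : Primrec g) : Primrec fun a => f a ++ g a := Primrec.list_append.comp hf hg

@[fun_prop] theorem primrec_headI [Inhabited β] {f : α → List β} (hf : Primrec f) :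
    Primrec fun a => (f a).headI := Primrec.list_headI.comp hf

@[fun_prop] theorem primrec_tail {f : α → List β} (hf : Primrec f) :
    Primrec fun a => (f a).tail := Primrec.list_tail.comp hf

@[fun_prop] theorem primrec_range {f : α → ℕ} (hf : Primrec f) :
    Primrec fun a => List.range (f a) := Primrec.list_range.comp hf

@[fun_prop] theorem primrec_getElem? {f : α → List β} {g : α → ℕ} (hf : Primrec f)
    (hg : Primrec g) : Primrec fun a => (f a)[g a]? := Primrec.list_getElem?.comp hf hg

@[fun_prop] theorem primrec_encode {f : α → β} (hf : Primrec f) :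
    Primrec fun a => Encodable.encode (f a) := Primrec.encode.comp hf

@[fun_prop] theorem primrec_and {f g : α → Bool} (hf : Primrec f) (hg : Primrec g) :
    Primrec fun a => (f a && g a) := Primrec.and.comp hf hg

@[fun_prop] theorem primrec_or {f g : α → Bool} (hf : Primrec f) (hg : Primrec g) :
    Primrec fun a => (f a || g a) := Primrec.or.comp hf hg

@[fun_prop] theorem primrec_not {f : α → Bool} (hf : Primrec f) :
    Primrec fun a => !f a := Primrec.not.comp hf

@[fun_prop] theorem primrec_cond {c : α → Bool} {f g : α → σ} (hc : Primrec c) (hf : Primrec f)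
    (hg : Primrec g) : Primrec fun a => cond (c a) (f a) (g a) := Primrec.cond hc hf hg

@[fun_prop] theorem primrec_beq [BEq β] [LawfulBEq β] {f g : α → β} (hf : Primrec f)
    (hg : Primrec g) : Primrec fun a => f a == g a := by
  classical
  refine ((Primrec.eq (α := β)).decide.comp hf hg).of_eq fun a => ?_
  rw [Bool.eq_iff_iff]
  simp

@[fun_prop] theorem primrec_any {f : α → List β} {p : α → β → Bool} (hf : Primrec f)
    (hp : Primrec fun z : α × β => p z.1 z.2) : Primrec fun a => (f a).any (p a) := by
  have : Primrec fun a => (f a).foldr (fun b r => p a b || r) false := by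
    have hp' : Primrec fun z : α × β × Bool => p z.1 z.2.1 :=
      hp.comp (Primrec.fst.pair (Primrec.fst.comp Primrec.snd))
    fun_prop
  refine this.of_eq fun a => ?_
  induction f a with
  | nil => rfl
  | cons b l ih => simp [ih]

@[fun_prop] theorem primrec_all {f : α → List β} {p : α → β → Bool} (hf : Primrec f)
    (hp : Primrec fun z : α × β => p z.1 z.2) : Primrec fun a => (f a).all (p a) := by
  have : Primrec fun a => !((f a).any fun b => !p a b) := by fun_prop
  refine this.of_eq fun a => ?_
  induction f a with
  | nil => rfl
  | cons b l ih => simp [← ih]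

@[fun_prop] theorem primrec_filter {f : α → List β} {p : α → β → Bool} (hf : Primrec f)
    (hp : Primrec fun z : α × β => p z.1 z.2) : Primrec fun a => (f a).filter (p a) := by
  have : Primrec fun a => (f a).flatMap fun b => bif p a b then [b] else [] := by fun_prop
  refine this.of_eq fun a => ?_
  induction f a with
  | nil => rfl
  | cons b l ih =>
    rw [List.flatMap_cons, ih, List.filter_cons]
    cases p a b <;> simp

@[fun_prop] theorem primrec_contains [BEq β] [LawfulBEq β] {f : α → List β} {g : α → β}
    (hf : Primrec f) (hg : Primrec g) : Primrec fun a => (f a).contains (g a) := by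
  have : Primrec fun a => (f a).any fun b => g a == b := by fun_prop
  exact this.of_eq fun a => by rw [List.contains_eq_any_beq]

/-- All sublists of a list. -/
def pow (l : List α) : List (List α) :=
  l.foldr (fun a acc => acc ++ acc.map fun s => a :: s) [[]]

@[fun_prop] theorem primrec_pow {f : α → List β} (hf : Primrec f) :
    Primrec fun a => pow (f a) := by
  unfold pow
  fun_prop

end

theorem mem_pow {α : Type} (l s : List α) : s ∈ pow l ↔ s.Sublist l := by
  induction l generalizing s with
  | nil => simp [pow]
  | cons a l ih =>
    have : pow (a :: l) = pow l ++ (pow l).map fun s => a :: s := rfl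
    rw [this, List.mem_append, List.mem_map, List.sublist_cons_iff]
    simp only [ih]
    exact or_congr Iff.rfl ⟨fun ⟨r, h1, h2⟩ => ⟨r, h2.symm, h1⟩, fun ⟨r, h1, h2⟩ => ⟨r, h2, h1.symm⟩⟩

/-! ### The model checker -/

/-- Arenas as lists: states, initial states, transitions, labels and observability. -/
abbrev Sys : Type :=
  List ℕ × List ℕ × List (ℕ × List ℕ × ℕ) × List (ℕ × ℕ) × List (ℕ × ℕ)

namespace Sys

def states (G : Sys) : List ℕ := G.1

def init (G : Sys) : List ℕ := G.2.1

def trans (G : Sys) : List (ℕ × List ℕ × ℕ) := G.2.2.1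

def label (G : Sys) : List (ℕ × ℕ) := G.2.2.2.1

def obs (G : Sys) : List (ℕ × ℕ) := G.2.2.2.2

/-- The action tuples `d` and `e` have the same `A`-part. -/
def agree (A d e : List ℕ) : Bool := A.all fun a => d[a]? == e[a]?

def sameView (G : Sys) (A : List ℕ) (q r : ℕ) : Bool :=
  G.obs.all fun o => !A.contains o.1 || (G.label.contains (q, o.2) == G.label.contains (r, o.2))

/-- One code for each set of states: all codes are filters of the same list, so equality of sets
becomes equality of lists and families of sets can be searched by `contains`. -/
def canon (G : Sys) : List (List ℕ) :=
  (pow G.states).map fun S => G.states.filter fun q => S.contains q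

/-- The states that look like `r` and that are reached from `S` when `A` plays as in `c`. -/
def out (G : Sys) (A S c : List ℕ) (r : ℕ) : List ℕ :=
  G.states.filter fun s => G.sameView A s r &&
    G.trans.any fun t => S.contains t.1 && (agree A t.2.1 c && t.2.2 == s)

def safeStep (G : Sys) (A X₁ X₂ : List ℕ) (W : List (List ℕ)) (R c : List ℕ) : Bool :=
  G.trans.all fun t => !(R.contains t.1 && agree A t.2.1 c) ||
    ((X₁.contains t.2.2 || X₂.contains t.2.2) &&
      W.contains ((G.out A R c t.2.2).filter fun q => !X₂.contains q))

/-- Candidate actions are read off the transitions. The clause for `[]` matters in an arena without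
states, which has no transitions although `∅` is winning. -/
def gameStep (G : Sys) (A X₁ X₂ : List ℕ) (W : List (List ℕ)) (R : List ℕ) : Bool :=
  R == [] || G.trans.any fun t => G.safeStep A X₁ X₂ W R t.2.1

/-- By Knaster–Tarski, the least fixed point is the intersection of all pre-fixed points, and the
greatest one, below, the union of all post-fixed points. Exhaustive search thus replaces iteration.
-/
def winUntil (G : Sys) (A X₁ X₂ R : List ℕ) : Bool :=
  (pow G.canon).all fun W =>
    !(G.canon.all fun R' => !G.gameStep A X₁ X₂ W R' || W.contains R') || W.contains R

def winWeak (G : Sys) (A X₁ X₂ R : List ℕ) : Bool :=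
  (pow G.canon).any fun W => W.contains R && W.all fun R' => G.gameStep A X₁ X₂ W R'

/-- The states of the split arena, before they are encoded as numbers. -/
def splitStates (G : Sys) (A : List ℕ) : List (ℕ × List ℕ) :=
  G.states.flatMap fun q => (G.canon.filter fun S =>
    S.contains q && S.all fun s => G.sameView A s q).map fun S => (q, S)

/-- Encoding pairs as numbers keeps the type of systems fixed under repeated splitting, so that one
fold can process a whole formula. -/
def split (G : Sys) (A : List ℕ) : Sys :=
  ((G.splitStates A).map fun y => Encodable.encode y,
    ((G.splitStates A).filter fun y => G.init.contains y.1 &&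
      y.2 == G.states.filter fun s => G.init.contains s && G.sameView A s y.1).map
        fun y => Encodable.encode y,
    (G.splitStates A).flatMap fun y => (G.trans.filter fun t => t.1 == y.1).map
      fun t => (Encodable.encode y, t.2.1, Encodable.encode (t.2.2, G.out A y.2 t.2.1 t.2.2)),
    (G.splitStates A).flatMap fun y => (G.label.filter fun l => l.1 == y.1).map
      fun l => (Encodable.encode y, l.2),
    G.obs)

/-- The states of the split arena with a given property. -/
def mark (G : Sys) (A : List ℕ) (p : ℕ × List ℕ → Bool) : List ℕ :=
  ((G.splitStates A).filter p).map fun y => Encodable.encode y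

def know (X : List ℕ) (y : ℕ × List ℕ) : Bool := y.2.all fun s => X.contains s

def next (G : Sys) (A X : List ℕ) (y : ℕ × List ℕ) : Bool :=
  G.trans.any fun t => G.trans.all fun t' =>
    !(y.2.contains t'.1 && agree A t'.2.1 t.2.1) || X.contains t'.2.2

def until_ (G : Sys) (A X₁ X₂ : List ℕ) (y : ℕ × List ℕ) : Bool :=
  (y.2.all fun s => X₁.contains s || X₂.contains s) &&
    G.winUntil A X₁ X₂ (y.2.filter fun q => !X₂.contains q)

def weak (G : Sys) (A X₁ X₂ : List ℕ) (y : ℕ × List ℕ) : Bool :=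
  (y.2.all fun s => X₁.contains s || X₂.contains s) &&
    G.winWeak A X₁ X₂ (y.2.filter fun q => !X₂.contains q)

/-- Pass to the split arena: `X` is the new set of states, the other ones are pulled back. -/
def push (G : Sys) (A X : List ℕ) (rest : List (List ℕ)) : Sys × List (List ℕ) :=
  (G.split A, X :: rest.map fun Y => G.mark A fun y => Y.contains y.1)

/-- Process one token of a formula; the stack holds sets of states. -/
def step (s : Sys × List (List ℕ)) (tok : ℕ × List ℕ) : Sys × List (List ℕ) :=
  bif tok.1 == 0 then
    (s.1, (s.1.states.filter fun q => tok.2.any fun p => s.1.label.contains (q, p)) :: s.2)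
  else bif tok.1 == 1 then
    -- In postfix order the second argument is on top of the stack, the first one below it.
    (s.1, (s.1.states.filter fun q => s.2.tail.headI.contains q && s.2.headI.contains q) ::
      s.2.tail.tail)
  else bif tok.1 == 2 then
    (s.1, (s.1.states.filter fun q => !s.2.headI.contains q) :: s.2.tail)
  else bif tok.1 == 3 then
    s.1.push tok.2 (s.1.mark tok.2 (s.1.next tok.2 s.2.headI)) s.2.tail
  else bif tok.1 == 4 then
    s.1.push tok.2 (s.1.mark tok.2 (s.1.until_ tok.2 s.2.tail.headI s.2.headI)) s.2.tail.tail
  else bif tok.1 == 5 then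
    s.1.push tok.2 (s.1.mark tok.2 (s.1.weak tok.2 s.2.tail.headI s.2.headI)) s.2.tail.tail
  else
    s.1.push tok.2 (s.1.mark tok.2 (know s.2.headI)) s.2.tail

end Sys

/-- The arena that a code describes. -/
def sysOfCode (D : ArenaCode) : Sys :=
  -- An `ArenaCode` lists observability before labels, a `Sys` has them in the opposite order.
  (List.range D.1, D.2.2.2.2.1, D.2.2.2.1, D.2.2.2.2.2.2, D.2.2.2.2.2.1)

/-- The model checker. -/
def decideValid (x : ArenaCode × List (ℕ × List ℕ)) : Bool :=
  (x.2.foldl Sys.step (sysOfCode x.1, [])).1.init.all fun q =>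
    (x.2.foldl Sys.step (sysOfCode x.1, [])).2.headI.contains q

/-! ### The model checker is primitive recursive -/

section

variable {α : Type} [Primcodable α] {G : α → Sys} {A S c X X₁ X₂ R : α → List ℕ} {q r : α → ℕ}
  {W : α → List (List ℕ)} {y : α → ℕ × List ℕ}

namespace Sys

@[fun_prop] theorem primrec_states (hG : Primrec G) : Primrec fun a => (G a).states := by
  unfold states
  fun_prop

@[fun_prop] theorem primrec_init (hG : Primrec G) : Primrec fun a => (G a).init := by
  unfold init
  fun_prop

@[fun_prop] theorem primrec_trans (hG : Primrec G) : Primrec fun a => (G a).trans := by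
  unfold trans
  fun_prop

@[fun_prop] theorem primrec_label (hG : Primrec G) : Primrec fun a => (G a).label := by
  unfold label
  fun_prop

@[fun_prop] theorem primrec_obs (hG : Primrec G) : Primrec fun a => (G a).obs := by
  unfold obs
  fun_prop

@[fun_prop] theorem primrec_agree (hA : Primrec A) (hc : Primrec c) (hX : Primrec X) :
    Primrec fun a => agree (A a) (c a) (X a) := by
  unfold agree
  fun_prop

@[fun_prop] theorem primrec_sameView (hG : Primrec G) (hA : Primrec A) (hq : Primrec q)
    (hr : Primrec r) : Primrec fun a => (G a).sameView (A a) (q a) (r a) := by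
  unfold sameView
  fun_prop

@[fun_prop] theorem primrec_canon (hG : Primrec G) : Primrec fun a => (G a).canon := by
  unfold canon
  fun_prop

@[fun_prop] theorem primrec_out (hG : Primrec G) (hA : Primrec A) (hS : Primrec S)
    (hc : Primrec c) (hr : Primrec r) :
    Primrec fun a => (G a).out (A a) (S a) (c a) (r a) := by
  unfold out
  fun_prop

@[fun_prop] theorem primrec_safeStep (hG : Primrec G) (hA : Primrec A) (h₁ : Primrec X₁)
    (h₂ : Primrec X₂) (hW : Primrec W) (hR : Primrec R) (hc : Primrec c) :
    Primrec fun a => (G a).safeStep (A a) (X₁ a) (X₂ a) (W a) (R a) (c a) := by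
  unfold safeStep
  fun_prop

@[fun_prop] theorem primrec_gameStep (hG : Primrec G) (hA : Primrec A) (h₁ : Primrec X₁)
    (h₂ : Primrec X₂) (hW : Primrec W) (hR : Primrec R) :
    Primrec fun a => (G a).gameStep (A a) (X₁ a) (X₂ a) (W a) (R a) := by
  unfold gameStep
  fun_prop

@[fun_prop] theorem primrec_winUntil (hG : Primrec G) (hA : Primrec A) (h₁ : Primrec X₁)
    (h₂ : Primrec X₂) (hR : Primrec R) :
    Primrec fun a => (G a).winUntil (A a) (X₁ a) (X₂ a) (R a) := by
  unfold winUntil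
  fun_prop

@[fun_prop] theorem primrec_winWeak (hG : Primrec G) (hA : Primrec A) (h₁ : Primrec X₁)
    (h₂ : Primrec X₂) (hR : Primrec R) :
    Primrec fun a => (G a).winWeak (A a) (X₁ a) (X₂ a) (R a) := by
  unfold winWeak
  fun_prop

@[fun_prop] theorem primrec_splitStates (hG : Primrec G) (hA : Primrec A) :
    Primrec fun a => (G a).splitStates (A a) := by
  unfold splitStates
  fun_prop

@[fun_prop] theorem primrec_split (hG : Primrec G) (hA : Primrec A) :
    Primrec fun a => (G a).split (A a) := by
  unfold split
  fun_prop

@[fun_prop] theorem primrec_mark {p : α → ℕ × List ℕ → Bool} (hG : Primrec G) (hA : Primrec A)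
    (hp : Primrec fun z : α × ℕ × List ℕ => p z.1 z.2) :
    Primrec fun a => (G a).mark (A a) (p a) := by
  unfold mark
  fun_prop

@[fun_prop] theorem primrec_know (hX : Primrec X) (hy : Primrec y) :
    Primrec fun a => know (X a) (y a) := by
  unfold know
  fun_prop

@[fun_prop] theorem primrec_next (hG : Primrec G) (hA : Primrec A) (hX : Primrec X)
    (hy : Primrec y) : Primrec fun a => (G a).next (A a) (X a) (y a) := by
  unfold next
  fun_prop

@[fun_prop] theorem primrec_until (hG : Primrec G) (hA : Primrec A) (h₁ : Primrec X₁)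
    (h₂ : Primrec X₂) (hy : Primrec y) :
    Primrec fun a => (G a).until_ (A a) (X₁ a) (X₂ a) (y a) := by
  unfold until_
  fun_prop

@[fun_prop] theorem primrec_weak (hG : Primrec G) (hA : Primrec A) (h₁ : Primrec X₁)
    (h₂ : Primrec X₂) (hy : Primrec y) :
    Primrec fun a => (G a).weak (A a) (X₁ a) (X₂ a) (y a) := by
  unfold weak
  fun_prop

@[fun_prop] theorem primrec_push (hG : Primrec G) (hA : Primrec A) (hX : Primrec X)
    (hW : Primrec W) : Primrec fun a => (G a).push (A a) (X a) (W a) := by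
  unfold push
  fun_prop

@[fun_prop] theorem primrec_step {s : α → Sys × List (List ℕ)} {tok : α → ℕ × List ℕ}
    (hs : Primrec s) (ht : Primrec tok) : Primrec fun a => step (s a) (tok a) := by
  unfold step
  fun_prop

end Sys

theorem primrec_decideValid : Primrec decideValid := by
  unfold decideValid sysOfCode
  fun_prop

end

end ModelChecker

/-! ### Correctness of the list-based model checker. -/

namespace ModelChecker

open Arena

section

variable {m l : ℕ} {k : Fin (m + 1) → ℕ}

/-- Action tuples as lists of numbers. -/
def actCode (c : ∀ a, Fin (k a + 1)) : List ℕ := List.ofFn fun a => (c a : ℕ)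

/-- The lists `G` describe the arena `Δ`, the states of which are coded by `e`. -/
structure Rep (Δ : Arena.{0, 0, 0, 0} (Fin (m + 1)) (fun a => Fin (k a + 1)) (Fin l))
    (e : Δ.State → ℕ) (G : Sys) : Prop where
  inj : Function.Injective e
  states : ∀ n, n ∈ G.states ↔ ∃ y, e y = n
  init : ∀ n, n ∈ G.init ↔ ∃ y ∈ Δ.init, e y = n
  trans : ∀ t, t ∈ G.trans ↔ ∃ y c, ∃ z ∈ Δ.trans y c, t = (e y, actCode c, e z)
  label : ∀ y (p : Fin l), (e y, p.1) ∈ G.label ↔ p ∈ Δ.label y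
  obs : ∀ o, o ∈ G.obs ↔ ∃ a, ∃ p ∈ Δ.obs a, o = (a.1, p.1)

theorem mem_coalCode {n : ℕ} (A : Finset (Fin n)) (b : ℕ) :
    b ∈ coalCode A ↔ ∃ a ∈ A, a.1 = b := by
  simp [coalCode]

theorem val_mem_coalCode {n : ℕ} (A : Finset (Fin n)) (a : Fin n) : a.1 ∈ coalCode A ↔ a ∈ A := by
  rw [mem_coalCode]
  exact ⟨fun ⟨b, hb, h⟩ => Fin.val_injective h ▸ hb, fun h => ⟨a, h, rfl⟩⟩

theorem actCode_getElem? (c : ∀ a, Fin (k a + 1)) (a : Fin (m + 1)) :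
    (actCode c)[a.1]? = some (c a).1 := by
  rw [actCode, List.getElem?_ofFn, dif_pos a.2]

theorem agree_iff (A : Finset (Fin (m + 1))) (c d : ∀ a, Fin (k a + 1)) :
    Sys.agree (coalCode A) (actCode c) (actCode d) = true ↔
      restr (Act := fun a => Fin (k a + 1)) A c = restr A d := by
  simp only [Sys.agree, List.all_eq_true, mem_coalCode, beq_iff_eq, funext_iff, restr,
    Subtype.forall]
  constructor
  · intro h a ha
    have := h a ⟨a, ha, rfl⟩
    rw [actCode_getElem?, actCode_getElem?] at this
    exact Fin.val_injective (Option.some_injective _ this)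
  · rintro h _ ⟨a, ha, rfl⟩
    rw [actCode_getElem?, actCode_getElem?, h a ha]

namespace Rep

variable {Δ : Arena.{0, 0, 0, 0} (Fin (m + 1)) (fun a => Fin (k a + 1)) (Fin l)}
  {e : Δ.State → ℕ} {G : Sys} (A : Finset (Fin (m + 1)))

open Classical in
/-- The list that codes a set of states. -/
noncomputable def setCode (e : Δ.State → ℕ) (G : Sys) (T : Set Δ.State) : List ℕ :=
  G.states.filter fun n => ∃ y ∈ T, e y = n

theorem mem_setCode (h : Rep Δ e G) {T : Set Δ.State} {n : ℕ} :
    n ∈ setCode e G T ↔ ∃ y ∈ T, e y = n := by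
  simp only [setCode, List.mem_filter, decide_eq_true_eq, h.states]
  exact and_iff_right_of_imp fun ⟨y, _, hy⟩ => ⟨y, hy⟩

theorem apply_mem_setCode (h : Rep Δ e G) {T : Set Δ.State} {y : Δ.State} :
    e y ∈ setCode e G T ↔ y ∈ T := by
  rw [h.mem_setCode]
  exact ⟨fun ⟨z, hz, he⟩ => h.inj he ▸ hz, fun hy => ⟨y, hy, rfl⟩⟩

theorem setCode_inj (h : Rep Δ e G) {T T' : Set Δ.State}
    (hT : setCode e G T = setCode e G T') : T = T' := by
  ext y
  rw [← h.apply_mem_setCode, hT, h.apply_mem_setCode]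

/-- The equality is one of lists, not just of their members; every set the program computes is
therefore literally the canonical code. -/
theorem filter_eq_setCode (h : Rep Δ e G) (p : ℕ → Bool) (T : Set Δ.State)
    (hp : ∀ y, p (e y) = true ↔ y ∈ T) : G.states.filter p = setCode e G T := by
  refine List.filter_congr fun n hn => ?_
  obtain ⟨y, rfl⟩ := (h.states n).1 hn
  rw [Bool.eq_iff_iff, hp]
  simp only [decide_eq_true_eq]
  exact ⟨fun hy => ⟨y, hy, rfl⟩, fun ⟨z, hz, he⟩ => h.inj he ▸ hz⟩

theorem mem_canon (h : Rep Δ e G) {S : List ℕ} :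
    S ∈ G.canon ↔ ∃ T : Set Δ.State, S = setCode e G T := by
  simp only [Sys.canon, List.mem_map, mem_pow]
  constructor
  · rintro ⟨S, -, rfl⟩
    exact ⟨{y | e y ∈ S}, h.filter_eq_setCode _ _ fun y => by simp⟩
  · rintro ⟨T, rfl⟩
    refine ⟨setCode e G T, List.filter_sublist, h.filter_eq_setCode _ _ fun y => ?_⟩
    rw [List.contains_iff_mem, h.apply_mem_setCode]

theorem sameView_iff (h : Rep Δ e G) (y z : Δ.State) :
    G.sameView (coalCode A) (e y) (e z) = true ↔ Δ.view A y = Δ.view A z := by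
  simp only [Sys.sameView, List.all_eq_true, Bool.or_eq_true, Bool.not_eq_true', beq_iff_eq,
    h.obs]
  rw [Set.ext_iff]
  constructor
  · rintro h1 ⟨p, hp⟩
    obtain ⟨a, ha, hp⟩ := Set.mem_iUnion₂.1 hp
    have := (h1 _ ⟨a, p, hp, rfl⟩).resolve_left (by
      simpa [val_mem_coalCode] using ha)
    rw [Bool.eq_iff_iff, List.contains_iff_mem, List.contains_iff_mem, h.label, h.label] at this
    exact this
  · rintro h1 _ ⟨a, p, hp, rfl⟩
    by_cases ha : a ∈ A
    · right
      rw [Bool.eq_iff_iff, List.contains_iff_mem, List.contains_iff_mem, h.label, h.label]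
      exact h1 ⟨p, Set.mem_iUnion₂.2 ⟨a, ha, hp⟩⟩
    · left
      simpa [val_mem_coalCode] using ha

theorem any_trans (h : Rep Δ e G) (p : ℕ × List ℕ × ℕ → Bool) :
    G.trans.any p = true ↔ ∃ y c, ∃ z ∈ Δ.trans y c, p (e y, actCode c, e z) = true := by
  simp only [List.any_eq_true, h.trans]
  constructor
  · rintro ⟨_, ⟨y, c, z, hz, rfl⟩, hp⟩
    exact ⟨y, c, z, hz, hp⟩
  · rintro ⟨y, c, z, hz, hp⟩
    exact ⟨_, ⟨y, c, z, hz, rfl⟩, hp⟩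

theorem all_trans (h : Rep Δ e G) (p : ℕ × List ℕ × ℕ → Bool) :
    G.trans.all p = true ↔ ∀ y c, ∀ z ∈ Δ.trans y c, p (e y, actCode c, e z) = true := by
  simp only [List.all_eq_true, h.trans]
  constructor
  · exact fun h y c z hz => h _ ⟨y, c, z, hz, rfl⟩
  · rintro h _ ⟨y, c, z, hz, rfl⟩
    exact h y c z hz

theorem out_eq (h : Rep Δ e G) (T : Set Δ.State) (c : ∀ a, Fin (k a + 1)) (z : Δ.State) :
    G.out (coalCode A) (setCode e G T) (actCode c) (e z) =
      setCode e G (Δ.out A T (restr A c) (Δ.view A z)) := by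
  refine h.filter_eq_setCode _ _ fun y => ?_
  rw [Bool.and_eq_true, h.sameView_iff, h.any_trans]
  simp only [Bool.and_eq_true, List.contains_iff_mem, h.apply_mem_setCode, agree_iff, beq_iff_eq,
    h.inj.eq_iff]
  constructor
  · rintro ⟨hv, s, d, y, hd, hs, hc, rfl⟩
    exact ⟨⟨s, hs, d, hc, hd⟩, hv⟩
  · rintro ⟨⟨s, hs, d, hc, hd⟩, hv⟩
    exact ⟨hv, s, d, y, hd, hs, hc, rfl⟩

theorem filter_setCode (h : Rep Δ e G) (T X : Set Δ.State) (Y : List ℕ)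
    (hX : ∀ y, e y ∈ Y ↔ y ∈ X) :
    ((setCode e G T).filter fun q => !Y.contains q) = setCode e G (T \ X) := by
  rw [setCode, List.filter_filter]
  refine h.filter_eq_setCode _ _ fun y => ?_
  simp only [Bool.and_eq_true, Bool.not_eq_true', decide_eq_true_eq]
  rw [← Bool.not_eq_true, List.contains_iff_mem, hX, and_comm]
  exact and_congr ⟨fun ⟨z, hz, he⟩ => h.inj he ▸ hz, fun hy => ⟨y, hy, rfl⟩⟩ Iff.rfl

variable {X₁ X₂ : Set Δ.State} {Y₁ Y₂ : List ℕ}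

theorem safeStep_iff (h : Rep Δ e G) (h₁ : ∀ y, e y ∈ Y₁ ↔ y ∈ X₁) (h₂ : ∀ y, e y ∈ Y₂ ↔ y ∈ X₂)
    (W : List (List ℕ)) (R : Set Δ.State) (c : ∀ a, Fin (k a + 1)) :
    G.safeStep (coalCode A) Y₁ Y₂ W (setCode e G R) (actCode c) = true ↔
      Δ.SafeStep A X₁ X₂ {T | setCode e G T ∈ W} R (restr A c) := by
  rw [Sys.safeStep, h.all_trans]
  simp only [Bool.or_eq_true, Bool.not_eq_true', Bool.and_eq_true, ← Bool.not_eq_true,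
    List.contains_iff_mem, h.apply_mem_setCode, agree_iff, h₁, h₂, h.out_eq,
    h.filter_setCode _ _ _ h₂]
  constructor
  · intro h1 r hr d hd r' hr'
    exact (h1 r d r' hr').resolve_left fun h => h ⟨hr, hd⟩
  · intro h1 r d r' hr'
    by_cases hc : r ∈ R ∧ restr (Act := fun a => Fin (k a + 1)) A d = restr A c
    · exact Or.inr (h1 r hc.1 d hc.2 r' hr')
    · exact Or.inl hc

theorem gameStep_iff (h : Rep Δ e G) (h₁ : ∀ y, e y ∈ Y₁ ↔ y ∈ X₁)
    (h₂ : ∀ y, e y ∈ Y₂ ↔ y ∈ X₂) (W : List (List ℕ)) (R : Set Δ.State) :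
    G.gameStep (coalCode A) Y₁ Y₂ W (setCode e G R) = true ↔
      R ∈ Δ.gameOp A X₁ X₂ {T | setCode e G T ∈ W} := by
  rw [Sys.gameStep, Bool.or_eq_true, h.any_trans, mem_gameOp]
  simp only [h.safeStep_iff A h₁ h₂, beq_iff_eq]
  constructor
  · rintro (h0 | ⟨y, c, z, -, hc⟩)
    · refine ⟨fun _ => 0, fun r hr => ?_⟩
      rw [← h.apply_mem_setCode, h0] at hr
      cases hr
    · exact ⟨_, hc⟩
  · rintro ⟨cA, hc⟩
    obtain ⟨c, rfl⟩ := exists_restr_eq A cA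
    rcases R.eq_empty_or_nonempty with rfl | ⟨r, hr⟩
    · left
      simp [setCode]
    · obtain ⟨z, hz⟩ := Δ.trans_nonempty r c
      exact Or.inr ⟨r, c, z, hz, hc⟩

/-- The true winning family is itself among the sublists of `canon`, so testing all listed pre-fixed
points suffices; conversely each of them contains the least fixed point. -/
theorem winUntil_iff (h : Rep Δ e G) (h₁ : ∀ y, e y ∈ Y₁ ↔ y ∈ X₁)
    (h₂ : ∀ y, e y ∈ Y₂ ↔ y ∈ X₂) (R : Set Δ.State) :
    G.winUntil (coalCode A) Y₁ Y₂ (setCode e G R) = true ↔ R ∈ Δ.winUntil A X₁ X₂ := by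
  classical
  simp only [Sys.winUntil, List.all_eq_true, Bool.or_eq_true, Bool.not_eq_true',
    ← Bool.not_eq_true, List.contains_iff_mem, mem_pow, ← imp_iff_not_or]
  constructor
  · intro h1
    have hmem : ∀ T, setCode e G T ∈ G.canon.filter (fun S => ∃ T ∈ Δ.winUntil A X₁ X₂,
        setCode e G T = S) ↔ T ∈ Δ.winUntil A X₁ X₂ := by
      intro T
      simp only [List.mem_filter, decide_eq_true_eq, h.mem_canon]
      exact ⟨fun ⟨_, T', hT', he⟩ => h.setCode_inj he ▸ hT', fun hT => ⟨⟨T, rfl⟩, T, hT, rfl⟩⟩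
    rw [← hmem]
    refine h1 _ List.filter_sublist fun S hS hg => ?_
    obtain ⟨T, rfl⟩ := h.mem_canon.1 hS
    rw [h.gameStep_iff A h₁ h₂] at hg
    simp only [hmem] at hg
    rw [hmem, ← winUntil_eq]
    exact hg
  · intro hR W hW hpre
    have : Δ.winUntil A X₁ X₂ ≤ {T | setCode e G T ∈ W} := by
      refine OrderHom.lfp_le _ fun T hT => ?_
      exact hpre _ (h.mem_canon.2 ⟨T, rfl⟩) ((h.gameStep_iff A h₁ h₂ W T).2 hT)
    exact this hR

theorem winWeak_iff (h : Rep Δ e G) (h₁ : ∀ y, e y ∈ Y₁ ↔ y ∈ X₁)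
    (h₂ : ∀ y, e y ∈ Y₂ ↔ y ∈ X₂) (R : Set Δ.State) :
    G.winWeak (coalCode A) Y₁ Y₂ (setCode e G R) = true ↔ R ∈ Δ.winWeak A X₁ X₂ := by
  classical
  simp only [Sys.winWeak, List.any_eq_true, List.all_eq_true, Bool.and_eq_true,
    List.contains_iff_mem, mem_pow]
  constructor
  · rintro ⟨W, -, hR, hpost⟩
    have : {T | setCode e G T ∈ W} ≤ Δ.winWeak A X₁ X₂ :=
      OrderHom.le_gfp _ fun T hT => (h.gameStep_iff A h₁ h₂ W T).1 (hpost _ hT)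
    exact this hR
  · intro hR
    have hmem : ∀ T, setCode e G T ∈ G.canon.filter (fun S => ∃ T ∈ Δ.winWeak A X₁ X₂,
        setCode e G T = S) ↔ T ∈ Δ.winWeak A X₁ X₂ := by
      intro T
      simp only [List.mem_filter, decide_eq_true_eq, h.mem_canon]
      exact ⟨fun ⟨_, T', hT', he⟩ => h.setCode_inj he ▸ hT', fun hT => ⟨⟨T, rfl⟩, T, hT, rfl⟩⟩
    refine ⟨_, List.filter_sublist, (hmem R).2 hR, fun S hS => ?_⟩
    obtain ⟨T, rfl⟩ := h.mem_canon.1 (List.mem_filter.1 hS).1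
    rw [h.gameStep_iff A h₁ h₂]
    simp only [hmem]
    have := (hmem T).1 hS
    rw [← winWeak_eq] at this
    exact this

/-- The code of a state of the split arena, before it is made a number. -/
noncomputable def pairCode (e : Δ.State → ℕ) (G : Sys) (A : Finset (Fin (m + 1)))
    (y : Δ.HatState A) : ℕ × List ℕ :=
  (e y.1.1, setCode e G y.1.2)

theorem pairCode_inj (h : Rep Δ e G) : Function.Injective (pairCode e G A) := by
  intro y z hyz
  have h1 := h.inj (congrArg Prod.fst hyz)
  have h2 := h.setCode_inj (congrArg Prod.snd hyz)
  exact Subtype.ext (Prod.ext h1 h2)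

theorem mem_splitStates (h : Rep Δ e G) {x : ℕ × List ℕ} :
    x ∈ G.splitStates (coalCode A) ↔ ∃ y, x = pairCode e G A y := by
  simp only [Sys.splitStates, List.mem_flatMap, List.mem_map, List.mem_filter, Bool.and_eq_true,
    List.all_eq_true, List.contains_iff_mem, h.states, h.mem_canon]
  constructor
  · rintro ⟨_, ⟨q, rfl⟩, _, ⟨⟨T, rfl⟩, hq, hv⟩, rfl⟩
    refine ⟨⟨(q, T), h.apply_mem_setCode.1 hq, fun s hs => ?_⟩, rfl⟩
    exact (h.sameView_iff A s q).1 (hv _ (h.apply_mem_setCode.2 hs))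
  · rintro ⟨y, rfl⟩
    refine ⟨_, ⟨y.1.1, rfl⟩, _, ⟨⟨y.1.2, rfl⟩, h.apply_mem_setCode.2 y.2.1, fun n hn => ?_⟩, rfl⟩
    obtain ⟨s, hs, rfl⟩ := h.mem_setCode.1 hn
    exact (h.sameView_iff A s y.1.1).2 (y.2.2 s hs)

theorem mem_mark (h : Rep Δ e G) (p : ℕ × List ℕ → Bool) (y : Δ.HatState A) :
    Encodable.encode (pairCode e G A y) ∈ G.mark (coalCode A) p ↔
      p (pairCode e G A y) = true := by
  simp only [Sys.mark, List.mem_map, List.mem_filter, h.mem_splitStates A]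
  constructor
  · rintro ⟨_, ⟨⟨z, rfl⟩, hp⟩, he⟩
    rwa [← Encodable.encode_injective he]
  · exact fun hp => ⟨_, ⟨⟨y, rfl⟩, hp⟩, rfl⟩

/-- Splitting on lists agrees with splitting on arenas, because `out_eq` and `filter_eq_setCode`
make the second components canonical codes. -/
theorem split (h : Rep Δ e G) : Rep (Δ.hat A) (fun y => Encodable.encode (pairCode e G A y))
    (G.split (coalCode A)) where
  inj := Encodable.encode_injective.comp (h.pairCode_inj A)
  states n := by
    simp only [Sys.split, Sys.states, List.mem_map, h.mem_splitStates A]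
    constructor
    · rintro ⟨_, ⟨y, rfl⟩, rfl⟩
      exact ⟨y, rfl⟩
    · rintro ⟨y, rfl⟩
      exact ⟨_, ⟨y, rfl⟩, rfl⟩
  init n := by
    have key : ∀ y : Δ.HatState A, ((fun x : ℕ × List ℕ => G.init.contains x.1 &&
        x.2 == G.states.filter fun s => G.init.contains s && G.sameView (coalCode A) s x.1)
          (pairCode e G A y) = true) ↔ y ∈ (Δ.hat A).init := by
      intro y
      have hin : ∀ q, e q ∈ G.init ↔ q ∈ Δ.init := by
        intro q
        rw [h.init]
        exact ⟨fun ⟨z, hz, he⟩ => h.inj he ▸ hz, fun hq => ⟨q, hq, rfl⟩⟩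
      simp only [Bool.and_eq_true, List.contains_iff_mem, pairCode, hin, beq_iff_eq]
      refine and_congr Iff.rfl ?_
      rw [h.filter_eq_setCode _ {s | s ∈ Δ.init ∧ Δ.view A s = Δ.view A y.1.1} fun s => by
        simp only [Bool.and_eq_true, List.contains_iff_mem, hin, h.sameView_iff]
        exact Iff.rfl]
      exact ⟨fun he => h.setCode_inj he, fun he => he ▸ rfl⟩
    change n ∈ G.mark (coalCode A) _ ↔ _
    constructor
    · intro hn
      have hn' := hn
      simp only [Sys.mark, List.mem_map, List.mem_filter, h.mem_splitStates A] at hn'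
      obtain ⟨_, ⟨⟨y, rfl⟩, -⟩, rfl⟩ := hn'
      exact ⟨y, (key y).1 ((h.mem_mark A _ y).1 hn), rfl⟩
    · rintro ⟨y, hy, rfl⟩
      exact (h.mem_mark A _ y).2 ((key y).2 hy)
  trans t := by
    simp only [Sys.split, Sys.trans, List.mem_flatMap, List.mem_map, List.mem_filter,
      h.mem_splitStates A, beq_iff_eq]
    constructor
    · rintro ⟨_, ⟨y, rfl⟩, t, ⟨ht, he⟩, rfl⟩
      obtain ⟨q, c, r, hr, rfl⟩ := (h.trans t).1 ht
      obtain rfl : q = y.1.1 := h.inj he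
      refine ⟨y, c, ⟨(r, Δ.out A y.1.2 (restr A c) (Δ.view A r)), ⟨⟨y.1.1, y.2.1, c, rfl, hr⟩, rfl⟩,
        fun s hs => hs.2⟩, ⟨hr, rfl⟩, ?_⟩
      simp only [pairCode, h.out_eq]
    · rintro ⟨y, c, z, ⟨hz1, hz2⟩, rfl⟩
      change Δ.HatState A at y z
      refine ⟨_, ⟨y, rfl⟩, (e y.1.1, actCode c, e z.1.1),
        ⟨(h.trans _).2 ⟨_, _, _, hz1, rfl⟩, rfl⟩, ?_⟩
      simp only [pairCode, h.out_eq]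
      rw [← hz2]
  label y p := by
    simp only [Sys.split, Sys.label, List.mem_flatMap, List.mem_map, List.mem_filter,
      h.mem_splitStates A, beq_iff_eq]
    refine Iff.trans ?_ (h.label (y : Δ.HatState A).1.1 p)
    constructor
    · rintro ⟨_, ⟨z, rfl⟩, t, ⟨ht, he⟩, heq⟩
      obtain ⟨h1, h2⟩ := Prod.mk.inj heq
      have hz := Encodable.encode_injective h1
      have : t = (e (y : Δ.HatState A).1.1, p.1) :=
        Prod.ext (he.trans (congrArg Prod.fst hz)) h2
      rwa [← this]
    · intro ht
      exact ⟨_, ⟨y, rfl⟩, _, ⟨ht, rfl⟩, rfl⟩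
  obs := h.obs

end Rep

/-- The state of the model checker represents the formulas `Φ`. -/
def Good (Γ : Arena.{0, 0, 0, 0} (Fin (m + 1)) (fun a => Fin (k a + 1)) (Fin l))
    (s : Sys × List (List ℕ)) (Φ : List (Formula (Fin (m + 1)) (Fin l))) : Prop :=
  ∃ (Δ : Arena.{0, 0, 0, 0} (Fin (m + 1)) (fun a => Fin (k a + 1)) (Fin l)) (C : Cover Γ Δ)
    (e : Δ.State → ℕ), Finite Δ.State ∧ Rep Δ e s.1 ∧
      (∀ y, Δ.label y = Γ.label (C.proj y)) ∧
      List.Forall₂ (fun ψ Y => ∃ X, (∀ y, e y ∈ Y ↔ y ∈ X) ∧ Represents C X ψ) Φ s.2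

variable {Γ : Arena.{0, 0, 0, 0} (Fin (m + 1)) (fun a => Fin (k a + 1)) (Fin l)}

/-- The new set is computed on the split arena, while the sets waiting on the stack are pulled back
to it; they still represent their formulas by `Represents.pullback`. -/
theorem Good.push {Δ : Arena.{0, 0, 0, 0} (Fin (m + 1)) (fun a => Fin (k a + 1)) (Fin l)}
    {C : Cover Γ Δ} {e : Δ.State → ℕ} {G : Sys} [Finite Δ.State] (h : Rep Δ e G)
    (hl : ∀ y, Δ.label y = Γ.label (C.proj y))
    {Φ : List (Formula (Fin (m + 1)) (Fin l))} {stk : List (List ℕ)}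
    (hs : List.Forall₂ (fun ψ Y => ∃ X, (∀ y, e y ∈ Y ↔ y ∈ X) ∧ Represents C X ψ) Φ stk)
    {A : Finset (Fin (m + 1))} {ψ : Formula (Fin (m + 1)) (Fin l)} {p : ℕ × List ℕ → Bool}
    {X : Set (Δ.hat A).State} (hX : Represents (C.comp (Cover.hat Δ A)) X ψ)
    (hp : ∀ y, p (Rep.pairCode e G A y) = true ↔ y ∈ X) :
    Good Γ (G.push (coalCode A) (G.mark (coalCode A) p) stk) (ψ :: Φ) := by
  refine ⟨Δ.hat A, C.comp (Cover.hat Δ A), _, inferInstanceAs (Finite (Δ.HatState A)), h.split A,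
    fun y => hl _, List.Forall₂.cons ⟨X, fun y => (h.mem_mark A p y).trans (hp y), hX⟩ ?_⟩
  rw [List.forall₂_map_right_iff]
  refine hs.imp ?_
  rintro χ Y ⟨X', h1, h2⟩
  refine ⟨_, fun y => (h.mem_mark A _ y).trans ?_, h2.pullback (Cover.hat Δ A)⟩
  rw [List.contains_iff_mem]
  exact h1 _

theorem Good.atom {s : Sys × List (List ℕ)} {Φ : List (Formula (Fin (m + 1)) (Fin l))}
    (h : Good Γ s Φ) (p : Fin l) : Good Γ (Sys.step s (0, [p.1])) (.atom p :: Φ) := by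
  obtain ⟨G, stk⟩ := s
  obtain ⟨Δ, C, e, hfin, hr, hl, hs⟩ := h
  refine ⟨Δ, C, e, hfin, hr, hl, List.Forall₂.cons ⟨_, fun y => ?_, Represents.atom C p⟩ hs⟩
  simp [hr.states, hr.label, hl]

theorem Good.conj {s : Sys × List (List ℕ)} {Φ : List (Formula (Fin (m + 1)) (Fin l))}
    {φ ψ : Formula (Fin (m + 1)) (Fin l)} (h : Good Γ s (ψ :: φ :: Φ)) :
    Good Γ (Sys.step s (1, [])) (.conj φ ψ :: Φ) := by
  obtain ⟨G, stk⟩ := s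
  obtain ⟨Δ, C, e, hfin, hr, hl, hs⟩ := h
  obtain @⟨⟩ | @⟨_, Y₂, _, _, ⟨X₂, h2, r2⟩, @⟨⟩ | @⟨_, Y₁, _, rest, ⟨X₁, h1, r1⟩, hs⟩⟩ := hs
  refine ⟨Δ, C, e, hfin, hr, hl, List.Forall₂.cons ⟨_, fun y => ?_, r1.conj r2⟩ hs⟩
  simp [hr.states, h1, h2]

theorem Good.neg {s : Sys × List (List ℕ)} {Φ : List (Formula (Fin (m + 1)) (Fin l))}
    {φ : Formula (Fin (m + 1)) (Fin l)} (h : Good Γ s (φ :: Φ)) :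
    Good Γ (Sys.step s (2, [])) (.neg φ :: Φ) := by
  obtain ⟨G, stk⟩ := s
  obtain ⟨Δ, C, e, hfin, hr, hl, hs⟩ := h
  obtain @⟨⟩ | @⟨_, Y₁, _, rest, ⟨X₁, h1, r1⟩, hs⟩ := hs
  refine ⟨Δ, C, e, hfin, hr, hl, List.Forall₂.cons ⟨_, fun y => ?_, r1.neg⟩ hs⟩
  simp [hr.states, h1]

theorem Good.nxt {s : Sys × List (List ℕ)} {Φ : List (Formula (Fin (m + 1)) (Fin l))}
    {φ : Formula (Fin (m + 1)) (Fin l)} (h : Good Γ s (φ :: Φ)) (A : Finset (Fin (m + 1))) :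
    Good Γ (Sys.step s (3, coalCode A)) (.nxt A φ :: Φ) := by
  obtain ⟨G, stk⟩ := s
  obtain ⟨Δ, C, e, hfin, hr, hl, hs⟩ := h
  obtain @⟨⟩ | @⟨_, Y₁, _, rest, ⟨X₁, h1, r1⟩, hs⟩ := hs
  refine Good.push hr hl hs (r1.nxt A) fun y => ?_
  change G.trans.any _ = true ↔ ∃ cA, _
  rw [hr.any_trans]
  simp only [hr.all_trans, Bool.or_eq_true, Bool.not_eq_true', ← Bool.not_eq_true,
    Bool.and_eq_true, List.contains_iff_mem, Rep.pairCode, hr.apply_mem_setCode, agree_iff,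
    List.headI_cons, h1]
  constructor
  · rintro ⟨_, c, _, -, h2⟩
    exact ⟨restr A c, fun r hr d hd r' hr' => (h2 r d r' hr').resolve_left fun h => h ⟨hr, hd⟩⟩
  · rintro ⟨cA, h2⟩
    obtain ⟨c, rfl⟩ := exists_restr_eq A cA
    -- The program tries only actions that label some transition; totality provides one for `c`.
    obtain ⟨z, hz⟩ := Δ.trans_nonempty y.1.1 c
    refine ⟨_, c, z, hz, fun r d r' hr' => ?_⟩
    by_cases hc : r ∈ y.1.2 ∧ restr (Act := fun a => Fin (k a + 1)) A d = restr A c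
    · exact Or.inr (h2 r hc.1 d hc.2 r' hr')
    · exact Or.inl hc

theorem Good.know {s : Sys × List (List ℕ)} {Φ : List (Formula (Fin (m + 1)) (Fin l))}
    {φ : Formula (Fin (m + 1)) (Fin l)} (h : Good Γ s (φ :: Φ)) (A : Finset (Fin (m + 1))) :
    Good Γ (Sys.step s (6, coalCode A)) (.know A φ :: Φ) := by
  obtain ⟨G, stk⟩ := s
  obtain ⟨Δ, C, e, hfin, hr, hl, hs⟩ := h
  obtain @⟨⟩ | @⟨_, Y₁, _, rest, ⟨X₁, h1, r1⟩, hs⟩ := hs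
  refine Good.push hr hl hs (r1.know A) fun y => ?_
  simp only [Sys.know, List.all_eq_true, List.contains_iff_mem, Rep.pairCode, hr.mem_setCode,
    List.headI_cons]
  exact ⟨fun h2 s hs => (h1 s).1 (h2 _ ⟨s, hs, rfl⟩), by
    rintro h2 _ ⟨s, hs, rfl⟩
    exact (h1 s).2 (h2 s hs)⟩

theorem Rep.all_setCode {Δ : Arena.{0, 0, 0, 0} (Fin (m + 1)) (fun a => Fin (k a + 1)) (Fin l)}
    {e : Δ.State → ℕ} {G : Sys} (h : Rep Δ e G) {X₁ X₂ : Set Δ.State} {Y₁ Y₂ : List ℕ}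
    (h₁ : ∀ y, e y ∈ Y₁ ↔ y ∈ X₁) (h₂ : ∀ y, e y ∈ Y₂ ↔ y ∈ X₂) (T : Set Δ.State) :
    ((Rep.setCode e G T).all fun s => Y₁.contains s || Y₂.contains s) = true ↔
      ∀ s ∈ T, s ∈ X₁ ∨ s ∈ X₂ := by
  simp only [List.all_eq_true, Bool.or_eq_true, List.contains_iff_mem, h.mem_setCode]
  exact ⟨fun h3 s hs => (or_congr (h₁ s) (h₂ s)).1 (h3 _ ⟨s, hs, rfl⟩), by
    rintro h3 _ ⟨s, hs, rfl⟩
    exact (or_congr (h₁ s) (h₂ s)).2 (h3 s hs)⟩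

theorem Good.untl {s : Sys × List (List ℕ)} {Φ : List (Formula (Fin (m + 1)) (Fin l))}
    {φ ψ : Formula (Fin (m + 1)) (Fin l)} (h : Good Γ s (ψ :: φ :: Φ))
    (A : Finset (Fin (m + 1))) :
    Good Γ (Sys.step s (4, coalCode A)) (.untl A φ ψ :: Φ) := by
  obtain ⟨G, stk⟩ := s
  obtain ⟨Δ, C, e, hfin, hr, hl, hs⟩ := h
  obtain @⟨⟩ | @⟨_, Y₂, _, _, ⟨X₂, h2, r2⟩, @⟨⟩ | @⟨_, Y₁, _, rest, ⟨X₁, h1, r1⟩, hs⟩⟩ := hs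
  refine Good.push hr hl hs (r1.untl r2 A) fun y => ?_
  refine Bool.and_eq_true_iff.trans (and_congr (hr.all_setCode h1 h2 y.1.2) ?_)
  rw [← hr.winUntil_iff A h1 h2, ← hr.filter_setCode _ _ _ h2]
  exact Iff.rfl

theorem Good.wuntl {s : Sys × List (List ℕ)} {Φ : List (Formula (Fin (m + 1)) (Fin l))}
    {φ ψ : Formula (Fin (m + 1)) (Fin l)} (h : Good Γ s (ψ :: φ :: Φ))
    (A : Finset (Fin (m + 1))) :
    Good Γ (Sys.step s (5, coalCode A)) (.wuntl A φ ψ :: Φ) := by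
  obtain ⟨G, stk⟩ := s
  obtain ⟨Δ, C, e, hfin, hr, hl, hs⟩ := h
  obtain @⟨⟩ | @⟨_, Y₂, _, _, ⟨X₂, h2, r2⟩, @⟨⟩ | @⟨_, Y₁, _, rest, ⟨X₁, h1, r1⟩, hs⟩⟩ := hs
  refine Good.push hr hl hs (r1.wuntl r2 A) fun y => ?_
  refine Bool.and_eq_true_iff.trans (and_congr (hr.all_setCode h1 h2 y.1.2) ?_)
  rw [← hr.winWeak_iff A h1 h2, ← hr.filter_setCode _ _ _ h2]
  exact Iff.rfl

/-- The statement allows an arbitrary stack, since the second argument of a binary connective is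
evaluated above the value of the first. -/
theorem Good.foldl_code (φ : Formula (Fin (m + 1)) (Fin l)) {s : Sys × List (List ℕ)}
    {Φ : List (Formula (Fin (m + 1)) (Fin l))} (h : Good Γ s Φ) :
    Good Γ (φ.code.foldl Sys.step s) (φ :: Φ) := by
  induction φ generalizing s Φ with
  | atom p => exact h.atom p
  | conj φ ψ ih₁ ih₂ =>
    rw [Formula.code, List.foldl_append, List.foldl_append]
    exact (ih₂ (ih₁ h)).conj
  | neg φ ih =>
    rw [Formula.code, List.foldl_append]
    exact (ih h).neg
  | nxt A φ ih =>
    rw [Formula.code, List.foldl_append]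
    exact (ih h).nxt A
  | untl A φ ψ ih₁ ih₂ =>
    rw [Formula.code, List.foldl_append, List.foldl_append]
    exact (ih₂ (ih₁ h)).untl A
  | wuntl A φ ψ ih₁ ih₂ =>
    rw [Formula.code, List.foldl_append, List.foldl_append]
    exact (ih₂ (ih₁ h)).wuntl A
  | know A φ ih =>
    rw [Formula.code, List.foldl_append]
    exact (ih h).know A

theorem Good.check_iff {s : Sys × List (List ℕ)} {φ : Formula (Fin (m + 1)) (Fin l)}
    (h : Good Γ s [φ]) :
    (s.1.init.all fun q => s.2.headI.contains q) = true ↔ Γ.Valid φ := by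
  obtain ⟨G, stk⟩ := s
  obtain ⟨Δ, C, e, hfin, hr, hl, hs⟩ := h
  obtain @⟨⟩ | @⟨_, Y₁, _, rest, ⟨X₁, h1, r1⟩, hs⟩ := hs
  refine Iff.trans ?_ r1.forall_init_iff
  simp only [List.all_eq_true, List.contains_iff_mem, hr.init, List.headI_cons]
  exact ⟨fun h y hy => (h1 y).1 (h _ ⟨y, hy, rfl⟩), by
    rintro h _ ⟨y, hy, rfl⟩
    exact (h1 y).2 (h y hy)⟩

end

theorem rep_code (D : ArenaData) : Rep D.toArena (fun q : Fin D.numStates => q.1)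
    (sysOfCode D.code) where
  inj := Fin.val_injective
  states n := by
    change n ∈ List.range D.numStates ↔ _
    rw [List.mem_range]
    exact ⟨fun h => ⟨⟨n, h⟩, rfl⟩, fun ⟨q, hq⟩ => hq ▸ q.2⟩
  init n := by
    change n ∈ D.initList.map _ ↔ _
    rw [List.mem_map]
    exact Iff.rfl
  trans t := by
    change t ∈ D.transList.map _ ↔ _
    rw [List.mem_map]
    constructor
    · rintro ⟨⟨q, c, r⟩, ht, rfl⟩
      exact ⟨q, c, r, ht, rfl⟩
    · rintro ⟨q, c, r, ht, rfl⟩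
      exact ⟨(q, c, r), ht, rfl⟩
  label q p := by
    change (q.1, p.1) ∈ D.labelList.map _ ↔ _
    rw [List.mem_map]
    constructor
    · rintro ⟨⟨q', p'⟩, ht, he⟩
      obtain ⟨h1, h2⟩ := Prod.mk.inj he
      obtain rfl := Fin.val_injective h1
      obtain rfl := Fin.val_injective h2
      exact ht
    · exact fun h => ⟨(q, p), h, rfl⟩
  obs o := by
    change o ∈ D.obsList.map _ ↔ _
    rw [List.mem_map]
    constructor
    · rintro ⟨⟨a, p⟩, ht, rfl⟩
      exact ⟨a, p, ht, rfl⟩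
    · rintro ⟨a, p, ht, rfl⟩
      exact ⟨(a, p), ht, rfl⟩

theorem decideValid_iff (D : ArenaData) (φ : Formula (Fin (D.m + 1)) (Fin D.numProps)) :
    decideValid (D.code, φ.code) = true ↔ D.toArena.Valid φ := by
  refine Good.check_iff (Good.foldl_code φ ⟨D.toArena, Cover.refl _, _, ?_, rep_code D,
    fun _ => rfl, List.Forall₂.nil⟩)
  exact inferInstanceAs (Finite (Fin D.numStates))

end ModelChecker

theorem modelCheckingDecidable : ModelCheckingDecidable :=
  ⟨ModelChecker.decideValid, ModelChecker.primrec_decideValid.to_comp, ModelChecker.decideValid_iff⟩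

end ATLD

theorem mainTheorem1 :
    (∀ {Ag : Type u} [Finite Ag] [Nonempty Ag] {Act : Ag → Type v} [∀ a, Finite (Act a)]
        [∀ a, Nonempty (Act a)] {P : Type w} (Γ : ATLD.Arena.{u, v, w, x} Ag Act P)
        [Finite Γ.State] (φ : ATLD.Formula Ag P) (L : List (ATLD.Formula Ag P)),
        ATLD.IsSubformulaEnum φ L →
        ((∀ q ∈ (Γ.algResult L).init, Sum.inr φ ∈ (Γ.algResult L).label q) ↔
          ∀ ρ : Γ.Run, Γ.Sat φ ρ 0)) ∧
      ATLD.ModelCheckingDecidable :=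
  ⟨fun Γ _ φ L hL => Γ.algResult_correct φ L hL, ATLD.modelCheckingDecidable⟩
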